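/- **Problem.** Let $\xi\sim\mathcal P$, $f(x)=\mathbb E[F(x;\xi)]$ for $x\in\mathbb R^d$, and $c:\mathbb R^d\to\mathbb R^m$ with Jacobian $G=\nabla^Tc\in\mathbb R^{m\times d}$; consider $\min f(x)$ s.t. $c(x)=0$. Put $\nabla_x\mathcal L=\nabla f+G^T\lambda$, $\nabla_x^2\mathcal L=\nabla^2f+\sum_j\lambda_j\nabla^2c_j$, $M=\nabla_x^2\mathcal L\,G^T+(\nabla^2c_1\nabla_x\mathcal L,\dots,\nabla^2c_m\nabla_x\mathcal L)$ and $$\mathcal L_{\mu,\nu}(x,\lambda)=f(x)+\lambda^Tc(x)+\tfrac\mu2\|c(x)\|^2+\tfrac\nu2\|G(x)\nabla_x\mathcal L(x,\lambda)\|^2 .$$ A superscript or subscript $k$ denotes evaluation at $(x^k,\lambda^k)$. **Algorithm.** Inputs: $\nu\ge\gamma_{RH}>0$, $\bar\alpha_0=\alpha_{max}>0$, $\bar\mu_0,\bar\epsilon_0>0$, $\kappa_{grad}>0$, $\rho>1$, $p_{grad},p_f,\beta\in(0,1)$, $\kappa_f\in(0,\beta/(4\alpha_{max}))$. Let $\mathcal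 F_{-1}=\sigma(x^0,\lambda^0)$, let $\mathcal F_k$ be generated by $\mathcal F_{-1}$ and the sample batches $\xi_g^j,\xi_f^j$, $j\le k$, and let $\mathcal F_{k-0.5}=\mathcal F_{k-1}\vee\sigma(\xi_g^k)$. Iteration $k\ge0$: 1. Draw a batch $\xi_g^k$ of independent realizations of $\xi$ (fresh, i.e. drawn independently of $\mathcal F_{k-1}$), $|\xi_g^k|\ge|\xi_g^{k-1}|+1$, $|\xi_g^{-1}|=0$; let $\bar g_k,\bar H_k$ be the batch means of $\nabla F(x^k;\cdot),\nabla^2F(x^k;\cdot)$, and $\bar\nabla_x\mathcal L^k,\bar M_k$ be $\nabla_x\mathcal L^k,M_k$ with $\nabla f_k,\nabla^2 f_k$ replaced by $\bar g_k,\bar H_k$. With $$r_k=\begin{pmatrix}\bar\nabla_x\mathcal L^k+\nu\bar M_kG_k\bar\nabla_x\mathcal L^k+G_k^Tc_k\\ \nu G_kG_k^TG_k\bar\nabla_x\mathcal L^k\end{pmatrix},\quad \mathcal A_k=\left\{\left\|\begin{pmatrix}\bar g_k-\nabla f_k+\nu(\bar M_kG_k\bar\nabla_x\mathcal L^k-M_kG_k\nabla_x\mathcal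 L^k)\\ \nu G_kG_k^TG_k(\bar g_k-\nabla f_k)\end{pmatrix}\right\|\le\kappa_{grad}\bar\alpha_k\|r_k\|\right\}$$ it is required that $P(\mathcal A_k^c\mid\mathcal F_{k-1})\le p_{grad}$ a.s. 2. With an $\mathcal F_{k-1}$-measurable matrix $B_k$, the direction $\bar\Delta^k=(\bar\Delta x^k,\bar\Delta\lambda^k)$ solves $B_k\bar\Delta x^k+G_k^T\tilde\Delta\lambda^k=-\bar\nabla_x\mathcal L^k$, $G_k\bar\Delta x^k=-c_k$, $G_kG_k^T\bar\Delta\lambda^k=-(G_k\bar\nabla_x\mathcal L^k+\bar M_k^T\bar\Delta x^k)$. Put $s_k=(\bar\Delta x^k;G_k\bar\nabla_x\mathcal L^k)$ and $\bar\nabla\mathcal L^k_{\mu,\nu}=\big((I+\nu\bar M_kG_k)\bar\nabla_x\mathcal L^k+\mu G_k^Tc_k;\ c_k+\nu G_kG_k^TG_k\bar\nabla_x\mathcal L^k\big)$. Starting from its previous value, the penalty parameter is multiplied by $\rho$ as long as the condition $$(\bar\nabla\mathcal L^k_{\mu,\nu})^T\bar\Delta^k\le-\tfrac{\gamma_{RH}}2\|s_k\|^2\quad\text{and}\quad\|c_k\|\le\|\bar\nabla\mathcal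 L^k_{\mu,\nu}\|$$ fails; $\bar\mu_k$ is the value obtained (this loop terminates along the run). Put $q_k=(\bar\nabla\mathcal L^k_{\bar\mu_k,\nu})^T\bar\Delta^k$. 3. Let $(x^{s_k},\lambda^{s_k})=(x^k,\lambda^k)+\bar\alpha_k\bar\Delta^k$. Draw a nonempty batch $\xi_f^k$ of independent realizations (fresh, i.e. independently of $\mathcal F_{k-0.5}$) and let $\bar{\mathcal L}^k_{\bar\mu_k,\nu},\bar{\mathcal L}^{s_k}_{\bar\mu_k,\nu}$ be $\mathcal L_{\bar\mu_k,\nu}$ at $(x^k,\lambda^k)$, $(x^{s_k},\lambda^{s_k})$ with $f,\nabla f$ replaced by batch means. With $\mathcal B_k=\{|\bar{\mathcal L}^k_{\bar\mu_k,\nu}-\mathcal L^k_{\bar\mu_k,\nu}|\vee|\bar{\mathcal L}^{s_k}_{\bar\mu_k,\nu}-\mathcal L^{s_k}_{\bar\mu_k,\nu}|\le-\kappa_f\bar\alpha_k^2q_k\}$ it is required that a.s. $P(\mathcal B_k^c\mid\mathcal F_{k-0.5})\le p_f$ and $\mathbb E[|\bar{\mathcal L}^k_{\bar\mu_k,\nu}-\mathcal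 L^k_{\bar\mu_k,\nu}|^2\mid\mathcal F_{k-0.5}]\vee\mathbb E[|\bar{\mathcal L}^{s_k}_{\bar\mu_k,\nu}-\mathcal L^{s_k}_{\bar\mu_k,\nu}|^2\mid\mathcal F_{k-0.5}]\le\bar\epsilon_k^2$ (the squared errors being integrable). 4. If $\bar{\mathcal L}^{s_k}_{\bar\mu_k,\nu}\le\bar{\mathcal L}^k_{\bar\mu_k,\nu}+\bar\alpha_k\beta q_k$, set $(x^{k+1},\lambda^{k+1})=(x^{s_k},\lambda^{s_k})$, $\bar\alpha_{k+1}=\alpha_{max}\wedge\rho\bar\alpha_k$, and $\bar\epsilon_{k+1}=\rho\bar\epsilon_k$ if $-\bar\alpha_k\beta q_k\ge\bar\epsilon_k$, $\bar\epsilon_{k+1}=\bar\epsilon_k/\rho$ otherwise. If not, keep $(x^k,\lambda^k)$ and set $\bar\alpha_{k+1}=\bar\alpha_k/\rho$, $\bar\epsilon_{k+1}=\bar\epsilon_k/\rho$. **Assumptions.** All iterates lie in $\mathcal X\times\Lambda$ with $\mathcal X,\Lambda$ convex and compact; near $\mathcal X$, $f$ and $c$ are three times and each $F(\cdot;\xi)$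 is twice continuously differentiable; $G(x)$ has full row rank for $x\in\mathcal X$; $v^TB_kv\ge\gamma_{RH}\|v\|^2$ whenever $G_kv=0$, and $\|B_k\|\le\kappa_B$; $\|(\nabla_x\mathcal L^k,c_k)\|>0$ and $\|\bar\Delta^k\|>0$; for all $\xi$ and $x\in\mathcal X$, $|F(x;\xi)-f(x)|\le M_0$, $\|\nabla F(x;\xi)-\nabla f(x)\|\le M_1$, $\|\nabla^2F(x;\xi)-\nabla^2f(x)\|\le M_2$. **Constants.** Let $\tilde\mu,\kappa_\nu,\Upsilon_1,\Upsilon_3,\Upsilon_4>0$ be deterministic constants such that, for all $k$, $\bar\mu_k\le\tilde\mu$, $\|r_k\|\le\Upsilon_1\|s_k\|$, $\|\bar\Delta^k\|\le\Upsilon_3\|s_k\|$, $\|\bar\nabla\mathcal L^k_{\bar\mu_k,\nu}\|\le\Upsilon_4\|s_k\|$, and $\sup_{\mathcal X\times\Lambda}\|\nabla^2\mathcal L_{\mu,\nu}\|\le\kappa_{\mathcal L_{\mu,\nu}}:=\mu\sup_{\mathcal X}\|\nabla(G^Tc)\|+\kappa_\nu$ for all $\mu\ge0$. **Stabilization.**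 Let $\bar K$ be a (possibly infinite) stopping time of $(\mathcal F_k)_{k\ge0}$ such that almost surely $\bar\mu_k=\bar\mu_{\bar K}$ for all finite $k\ge\bar K$ (the value $\bar\mu_{\bar K}$ on $\{\bar K=\infty\}$ is immaterial and may be taken to be some fixed $\bar\mu_j$). For $\omega\in(0,1)$ let $$\Phi^k_{\bar\mu_{\bar K}}=\omega\mathcal L^k_{\bar\mu_{\bar K},\nu}+\tfrac{1-\omega}2\bar\epsilon_k+\tfrac{1-\omega}2\bar\alpha_k\|\nabla\mathcal L^k_{\bar\mu_{\bar K},\nu}\|^2 .$$ **Theorem (one-step error recursion).** Constants $\tilde\mu,\kappa_\nu,\Upsilon_1,\Upsilon_3,\Upsilon_4$ as above exist. For any such constants, if $$\frac{\omega}{1-\omega}\ge\frac{32\rho\big(\kappa_{\mathcal L_{\tilde\mu,\nu}}\alpha_{max}\Upsilon_3\vee(\kappa_{grad}\alpha_{max}\Upsilon_1+\Upsilon_4)\big)^2}{\beta\gamma_{RH}}\vee4(\rho-1),\qquad \frac{p_{grad}+\sqrt{p_f}}{(1-p_{grad})(1-p_f)}\le\frac{\rho-1}{8\rho}\Big(\frac1\rho\wedge\frac{1-\omega}\omega\Big),$$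 then for every $k$ the variable $\Phi^{k+1}_{\bar\mu_{\bar K}}-\Phi^k_{\bar\mu_{\bar K}}$ is integrable and, almost surely on $\{k>\bar K\}$, $$\mathbb E[\Phi^{k+1}_{\bar\mu_{\bar K}}-\Phi^k_{\bar\mu_{\bar K}}\mid\mathcal F_{k-1}]\le-\tfrac14(1-p_{grad})(1-p_f)(1-\omega)\Big(1-\frac1\rho\Big)\Big(\bar\epsilon_k+\bar\alpha_k\|\nabla\mathcal L^k_{\bar\mu_{\bar K},\nu}\|^2\Big).$$ -/

import Mathlib

open MeasureTheory ProbabilityTheory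
open scoped RealInnerProductSpace

noncomputable section

namespace StoSQP

/-! ### Spaces, derivatives of the constraint, and the augmented Lagrangian -/

/-- `ℝⁿ` with the Euclidean norm. -/
abbrev Vec (n : ℕ) : Type := EuclideanSpace ℝ (Fin n)

/-- Primal-dual pairs `(x, λ) ∈ ℝᵈ × ℝᵐ` with the Euclidean norm of the stacked vector. -/
abbrev Pair (d m : ℕ) : Type := WithLp 2 (Vec d × Vec m)

/-- The stacked vector `(u; v)`. -/
def stack {d m : ℕ} (u : Vec d) (v : Vec m) : Pair d m := WithLp.toLp 2 (u, v)

/-- The Hessian of a scalar function, as the derivative of its gradient. -/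
def hess {n : ℕ} (h : Vec n → ℝ) (x : Vec n) : Vec n →L[ℝ] Vec n :=
  fderiv ℝ (gradient h) x

/-- The Jacobian `G(x)` of the constraint, an `m × d` matrix seen as a linear map. -/
def jac {d m : ℕ} (c : Vec d → Vec m) (x : Vec d) : Vec d →L[ℝ] Vec m :=
  fderiv ℝ c x

/-- The transposed Jacobian `G(x)ᵀ`. -/
def jacT {d m : ℕ} (c : Vec d → Vec m) (x : Vec d) : Vec m →L[ℝ] Vec d :=
  ContinuousLinearMap.adjoint (jac c x)

/-- `g + G(x)ᵀ λ`: the gradient in `x` of the Lagrangian when `g` is the gradient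
(or an estimate of the gradient) of the objective. -/
def lagGrad {d m : ℕ} (c : Vec d → Vec m) (g : Vec d) (x : Vec d) (lam : Vec m) : Vec d :=
  g + jacT c x lam

/-- `H + ∑ⱼ λⱼ ∇²cⱼ(x)`: the Hessian in `x` of the Lagrangian when `H` is the Hessian
(or an estimate of the Hessian) of the objective. -/
def lagHess {d m : ℕ} (c : Vec d → Vec m) (H : Vec d →L[ℝ] Vec d) (x : Vec d) (lam : Vec m) :
    Vec d →L[ℝ] Vec d :=
  H + ∑ j, lam j • hess (fun y => c y j) x

/-- The `d × m` matrix with columns `∇²cⱼ(x) u`. -/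
def matT {d m : ℕ} (c : Vec d → Vec m) (x u : Vec d) : Vec m →L[ℝ] Vec d :=
  ∑ j, (EuclideanSpace.proj j : Vec m →L[ℝ] ℝ).smulRight (hess (fun y => c y j) x u)

/-- `M = ∇²ₓL Gᵀ + T`, formed from a gradient `g` and a Hessian `H` of the objective
(exact or estimated). -/
def matM {d m : ℕ} (c : Vec d → Vec m) (g : Vec d) (H : Vec d →L[ℝ] Vec d)
    (x : Vec d) (lam : Vec m) : Vec m →L[ℝ] Vec d :=
  (lagHess c H x lam).comp (jacT c x) + matT c x (lagGrad c g x lam)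

/-- `v + cᵀλ + (μ/2)‖c‖² + (ν/2)‖G(g + Gᵀλ)‖²` : the augmented Lagrangian formed from a value `v`
and a gradient `g` of the objective (exact or estimated). -/
def augValue {d m : ℕ} (c : Vec d → Vec m) (μ ν v : ℝ) (g : Vec d) (x : Vec d) (lam : Vec m) : ℝ :=
  v + ⟪c x, lam⟫ + μ / 2 * ‖c x‖ ^ 2 + ν / 2 * ‖jac c x (lagGrad c g x lam)‖ ^ 2

/-- The exact augmented Lagrangian `L_{μ,ν}(x, λ)` of the objective `f` and the constraint `c`. -/
def augLag {d m : ℕ} (f : Vec d → ℝ) (c : Vec d → Vec m) (μ ν : ℝ) (z : Pair d m) : ℝ :=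
  augValue c μ ν (f z.fst) (gradient f z.fst) z.fst z.snd

/-- `((I + ν M G) ∇ₓL + μ Gᵀ c ; c + ν G Gᵀ G ∇ₓL)`, the gradient of the augmented Lagrangian
formed from a gradient `g` and a Hessian `H` of the objective (exact or estimated). -/
def augGradFormula {d m : ℕ} (c : Vec d → Vec m) (μ ν : ℝ) (g : Vec d) (H : Vec d →L[ℝ] Vec d)
    (x : Vec d) (lam : Vec m) : Pair d m :=
  stack
    (lagGrad c g x lam + ν • matM c g H x lam (jac c x (lagGrad c g x lam)) + μ • jacT c x (c x))
    (c x + ν • jac c x (jacT c x (jac c x (lagGrad c g x lam))))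

/-! ### The stochastic problem -/

/-- The problem `min f(x) = E[F(x; ξ)]` subject to `c(x) = 0`, with `ξ` distributed as `law`. -/
structure Problem (d m : ℕ) (Ξ : Type*) [MeasurableSpace Ξ] where
  F : Vec d → Ξ → ℝ
  c : Vec d → Vec m
  law : Measure Ξ
  isProb : IsProbabilityMeasure law
  measurable_F : Measurable fun p : Vec d × Ξ => F p.1 p.2
  measurable_gradF : Measurable fun p : Vec d × Ξ => gradient (fun y => F y p.2) p.1
  measurable_hessF : Measurable fun p : Vec d × Ξ => hess (fun y => F y p.2) p.1
  measurable_c : Measurable c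
  integrable_F : ∀ x, Integrable (F x) law

/-- The objective `f(x) = E[F(x; ξ)]`. -/
def Problem.f {d m : ℕ} {Ξ : Type*} [MeasurableSpace Ξ] (Q : Problem d m Ξ) (x : Vec d) : ℝ :=
  ∫ ξ, Q.F x ξ ∂Q.law

/-- The scalar inputs of the algorithm. -/
structure Params where
  ν : ℝ
  γ : ℝ
  αmax : ℝ
  μ₀ : ℝ
  ε₀ : ℝ
  κgrad : ℝ
  κf : ℝ
  ρ : ℝ
  pgrad : ℝ
  pf : ℝ
  β : ℝ

/-- The ranges of the scalar inputs. -/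
structure Params.Valid (θ : Params) : Prop where
  γ_pos : 0 < θ.γ
  γ_le_ν : θ.γ ≤ θ.ν
  αmax_pos : 0 < θ.αmax
  μ₀_pos : 0 < θ.μ₀
  ε₀_pos : 0 < θ.ε₀
  κgrad_pos : 0 < θ.κgrad
  ρ_gt_one : 1 < θ.ρ
  pgrad_mem : θ.pgrad ∈ Set.Ioo (0 : ℝ) 1
  pf_mem : θ.pf ∈ Set.Ioo (0 : ℝ) 1
  β_mem : θ.β ∈ Set.Ioo (0 : ℝ) 1
  κf_mem : θ.κf ∈ Set.Ioo (0 : ℝ) (θ.β / (4 * θ.αmax))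

/-! ### Sample batches and the processes generated by the algorithm -/

/-- A finite batch of realizations: its size together with its members. -/
abbrev Batch (Ξ : Type*) : Type _ := Σ n : ℕ, (Fin n → Ξ)

/-- The average of `h` over a batch. -/
def batchMean {Ξ V : Type*} [AddCommGroup V] [Module ℝ V] (b : Batch Ξ) (h : Ξ → V) : V :=
  (b.1 : ℝ)⁻¹ • ∑ i, h (b.2 i)

/-- The random quantities appearing in a run: the iterate `z k = (xᵏ, λᵏ)`, the stepsize `α k`,
the reliability parameter `ε k`, the penalty parameter `μ k` after the while loop of iteration `k`,
the matrix `B k`, the solution `(Δx, Δt, Δlam)` of the linear systems, and the batches. -/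
structure Trajectory (d m : ℕ) (Ξ Ω : Type*) [MeasurableSpace Ξ] [MeasurableSpace Ω] where
  z : ℕ → Ω → Pair d m
  α : ℕ → Ω → ℝ
  ε : ℕ → Ω → ℝ
  μ : ℕ → Ω → ℝ
  B : ℕ → Ω → Vec d →L[ℝ] Vec d
  Δx : ℕ → Ω → Vec d
  Δt : ℕ → Ω → Vec m
  Δlam : ℕ → Ω → Vec m
  ξg : ℕ → Ω → Batch Ξ
  ξf : ℕ → Ω → Batch Ξ
  measurable_z_zero : Measurable (z 0)
  measurable_ξg : ∀ k, Measurable (ξg k)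
  measurable_ξf : ∀ k, Measurable (ξf k)

section Derived

variable {d m : ℕ} {Ξ Ω : Type*} [MeasurableSpace Ξ] [mΩ : MeasurableSpace Ω]

namespace Trajectory

/-- `past k` is the σ-algebra `F_{k-1}` generated by the initial iterate and by all batches of the
iterations `0, …, k-1`. -/
def past (r : Trajectory d m Ξ Ω) : ℕ → MeasurableSpace Ω
  | 0 => MeasurableSpace.comap (r.z 0) inferInstance
  | k + 1 => r.past k ⊔ MeasurableSpace.comap (r.ξg k) inferInstance
      ⊔ MeasurableSpace.comap (r.ξf k) inferInstance

/-- `mid k` is the σ-algebra `F_{k-1/2}` generated by `F_{k-1}` and the batch `ξg k`. -/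
def mid (r : Trajectory d m Ξ Ω) (k : ℕ) : MeasurableSpace Ω :=
  r.past k ⊔ MeasurableSpace.comap (r.ξg k) inferInstance

theorem past_le (r : Trajectory d m Ξ Ω) (k : ℕ) : r.past k ≤ mΩ := by
  induction k with
  | zero => exact r.measurable_z_zero.comap_le
  | succ k ih =>
    exact sup_le (sup_le ih (r.measurable_ξg k).comap_le) (r.measurable_ξf k).comap_le

/-- The filtration `F_0 ⊆ F_1 ⊆ …`, where `F_k = past (k + 1)`. -/
def filtration (r : Trajectory d m Ξ Ω) : Filtration ℕ mΩ where
  seq k := r.past (k + 1)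
  mono' := monotone_nat_of_le_succ fun k =>
    (le_sup_left.trans le_sup_left : r.past (k + 1) ≤ r.past (k + 2))
  le' k := r.past_le (k + 1)

/-- The primal iterate `xᵏ`. -/
def x (r : Trajectory d m Ξ Ω) (k : ℕ) (ω : Ω) : Vec d := (r.z k ω).fst

/-- The dual iterate `λᵏ`. -/
def lam (r : Trajectory d m Ξ Ω) (k : ℕ) (ω : Ω) : Vec m := (r.z k ω).snd

/-- The search direction `(Δx, Δλ)`. -/
def dir (r : Trajectory d m Ξ Ω) (k : ℕ) (ω : Ω) : Pair d m := stack (r.Δx k ω) (r.Δlam k ω)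

/-- The trial point `(xᵏ, λᵏ) + αₖ (Δx, Δλ)`. -/
def trial (r : Trajectory d m Ξ Ω) (k : ℕ) (ω : Ω) : Pair d m := r.z k ω + r.α k ω • r.dir k ω

/-- The penalty parameter at the start of iteration `k`. -/
def μStart (r : Trajectory d m Ξ Ω) (θ : Params) : ℕ → Ω → ℝ
  | 0 => fun _ => θ.μ₀
  | k + 1 => r.μ k

end Trajectory

variable (Q : Problem d m Ξ) (θ : Params) (r : Trajectory d m Ξ Ω) (k : ℕ) (ω : Ω)

/-- The gradient estimate of the objective from the batch `ξg k`. -/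
def gBar : Vec d := batchMean (r.ξg k ω) fun ζ => gradient (fun y => Q.F y ζ) (r.x k ω)

/-- The Hessian estimate of the objective from the batch `ξg k`. -/
def hBar : Vec d →L[ℝ] Vec d := batchMean (r.ξg k ω) fun ζ => hess (fun y => Q.F y ζ) (r.x k ω)

/-- The estimate of the gradient in `x` of the Lagrangian. -/
def lagGradBar : Vec d := lagGrad Q.c (gBar Q r k ω) (r.x k ω) (r.lam k ω)

/-- The exact gradient in `x` of the Lagrangian at the iterate. -/
def lagGradTrue : Vec d := lagGrad Q.c (gradient Q.f (r.x k ω)) (r.x k ω) (r.lam k ω)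

/-- The estimate of the matrix `M`. -/
def mBar : Vec m →L[ℝ] Vec d :=
  matM Q.c (gBar Q r k ω) (hBar Q r k ω) (r.x k ω) (r.lam k ω)

/-- The exact matrix `M` at the iterate. -/
def mTrue : Vec m →L[ℝ] Vec d :=
  matM Q.c (gradient Q.f (r.x k ω)) (hess Q.f (r.x k ω)) (r.x k ω) (r.lam k ω)

/-- The estimate of the gradient of the augmented Lagrangian with penalty parameter `μ`. -/
def augGradBar (μ : ℝ) : Pair d m :=
  augGradFormula Q.c μ θ.ν (gBar Q r k ω) (hBar Q r k ω) (r.x k ω) (r.lam k ω)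

/-- The stacked vector `(Δx ; G ∇ₓL)` with the estimated gradient of the Lagrangian. -/
def stepVec : Pair d m := stack (r.Δx k ω) (jac Q.c (r.x k ω) (lagGradBar Q r k ω))

/-- `(∇ₓL + ν M G ∇ₓL + Gᵀ c ; ν G Gᵀ G ∇ₓL)` with the estimated quantities. -/
def refVec : Pair d m :=
  stack
    (lagGradBar Q r k ω + θ.ν • mBar Q r k ω (jac Q.c (r.x k ω) (lagGradBar Q r k ω))
      + jacT Q.c (r.x k ω) (Q.c (r.x k ω)))
    (θ.ν • jac Q.c (r.x k ω) (jacT Q.c (r.x k ω) (jac Q.c (r.x k ω) (lagGradBar Q r k ω))))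

/-- The error of the estimated gradient of the augmented Lagrangian. -/
def errVec : Pair d m :=
  stack
    (gBar Q r k ω - gradient Q.f (r.x k ω)
      + θ.ν • (mBar Q r k ω (jac Q.c (r.x k ω) (lagGradBar Q r k ω))
        - mTrue Q r k ω (jac Q.c (r.x k ω) (lagGradTrue Q r k ω))))
    (θ.ν • jac Q.c (r.x k ω) (jacT Q.c (r.x k ω)
      (jac Q.c (r.x k ω) (gBar Q r k ω - gradient Q.f (r.x k ω)))))

/-- The estimated directional derivative of the augmented Lagrangian along the search direction. -/
def slope (μ : ℝ) : ℝ := ⟪augGradBar Q θ r k ω μ, r.dir k ω⟫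

/-- The acceptance condition of the while loop for the penalty parameter. -/
def PenaltyOK (μ : ℝ) : Prop :=
  slope Q θ r k ω μ ≤ -(θ.γ / 2) * ‖stepVec Q r k ω‖ ^ 2 ∧
    ‖Q.c (r.x k ω)‖ ≤ ‖augGradBar Q θ r k ω μ‖

/-- The estimate of the augmented Lagrangian at the point `z` from the batch `ξf k`. -/
def augBar (z : Pair d m) : ℝ :=
  augValue Q.c (r.μ k ω) θ.ν (batchMean (r.ξf k ω) fun ζ => Q.F z.fst ζ)
    (batchMean (r.ξf k ω) fun ζ => gradient (fun y => Q.F y ζ) z.fst) z.fst z.snd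

/-- The exact augmented Lagrangian at the point `z` with the penalty parameter of iteration `k`. -/
def augTrue (z : Pair d m) : ℝ := augLag Q.f Q.c (r.μ k ω) θ.ν z

/-- The stochastic Armijo condition. -/
def Armijo : Prop :=
  augBar Q θ r k ω (r.trial k ω) ≤
    augBar Q θ r k ω (r.z k ω) + r.α k ω * θ.β * slope Q θ r k ω (r.μ k ω)

/-- The reliability condition. -/
def Reliable : Prop := r.ε k ω ≤ -(r.α k ω * θ.β * slope Q θ r k ω (r.μ k ω))

/-- The event that the gradient of the augmented Lagrangian is estimated accurately. -/
def eventA : Set Ω := {ω | ‖errVec Q θ r k ω‖ ≤ θ.κgrad * r.α k ω * ‖refVec Q θ r k ω‖}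

/-- The event that the augmented Lagrangian is estimated accurately at the iterate and at the
trial point. -/
def eventB : Set Ω :=
  {ω | max |augBar Q θ r k ω (r.z k ω) - augTrue Q θ r k ω (r.z k ω)|
        |augBar Q θ r k ω (r.trial k ω) - augTrue Q θ r k ω (r.trial k ω)| ≤
      -θ.κf * r.α k ω ^ 2 * slope Q θ r k ω (r.μ k ω)}

end Derived

/-! ### Runs of the algorithm -/

/-- `ξ` consists of independent realizations of `law`, drawn independently of the σ-algebra `𝓕`:
it is an initial segment, of possibly random and adaptively chosen length, of an i.i.d. stream that
is independent of `𝓕`. -/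
def IsFreshBatch {Ξ Ω : Type*} (𝓕 : MeasurableSpace Ω) [MeasurableSpace Ξ] [mΩ : MeasurableSpace Ω]
    (P : Measure Ω) (law : Measure Ξ) (ξ : Ω → Batch Ξ) : Prop :=
  ∃ ζ : ℕ → Ω → Ξ, (∀ i, Measurable[mΩ] (ζ i)) ∧ iIndepFun ζ P ∧ (∀ i, P.map (ζ i) = law) ∧
    Indep (⨆ i, MeasurableSpace.comap (ζ i) inferInstance) 𝓕 P ∧
    ∀ ω, ∀ i : Fin (ξ ω).1, (ξ ω).2 i = ζ i ω

/-- The mean square of `Y`, conditionally on `𝓕`, exists and is at most `b`. -/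
def CondSqLE {Ω : Type*} (𝓕 : MeasurableSpace Ω) [MeasurableSpace Ω] (P : Measure Ω)
    (Y b : Ω → ℝ) : Prop :=
  Integrable (fun ω => Y ω ^ 2) P ∧ ∀ᵐ ω ∂P, (P[fun ω => Y ω ^ 2 | 𝓕]) ω ≤ b ω

/-- `r` is a run of the adaptive stochastic SQP algorithm for the problem `Q`. -/
structure IsRun {d m : ℕ} {Ξ Ω : Type*} [MeasurableSpace Ξ] [MeasurableSpace Ω]
    (Q : Problem d m Ξ) (θ : Params) (P : Measure Ω) (r : Trajectory d m Ξ Ω) : Prop where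
  α_zero : ∀ ω, r.α 0 ω = θ.αmax
  ε_zero : ∀ ω, r.ε 0 ω = θ.ε₀
  /- sampling for the derivatives -/
  fresh_g : ∀ k, IsFreshBatch (r.past k) P Q.law (r.ξg k)
  size_g_zero : ∀ ω, 1 ≤ (r.ξg 0 ω).1
  size_g_succ : ∀ k ω, (r.ξg k ω).1 + 1 ≤ (r.ξg (k + 1) ω).1
  accurate_g : ∀ k, ∀ᵐ ω ∂P, (P⟦(eventA Q θ r k)ᶜ | r.past k⟧) ω ≤ θ.pgrad
  /- search direction -/
  measurable_B : ∀ k, Measurable[r.past k] (r.B k)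
  newton_x : ∀ k ω, r.B k ω (r.Δx k ω) + jacT Q.c (r.x k ω) (r.Δt k ω) = -lagGradBar Q r k ω
  newton_c : ∀ k ω, jac Q.c (r.x k ω) (r.Δx k ω) = -Q.c (r.x k ω)
  newton_lam : ∀ k ω, jac Q.c (r.x k ω) (jacT Q.c (r.x k ω) (r.Δlam k ω)) =
    -(jac Q.c (r.x k ω) (lagGradBar Q r k ω)
      + ContinuousLinearMap.adjoint (mBar Q r k ω) (r.Δx k ω))
  /- while loop for the penalty parameter -/
  penalty : ∀ k ω, ∃ j : ℕ, r.μ k ω = θ.ρ ^ j * r.μStart θ k ω ∧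
    PenaltyOK Q θ r k ω (r.μ k ω) ∧ ∀ i < j, ¬ PenaltyOK Q θ r k ω (θ.ρ ^ i * r.μStart θ k ω)
  /- sampling for the merit function -/
  fresh_f : ∀ k, IsFreshBatch (r.mid k) P Q.law (r.ξf k)
  size_f : ∀ k ω, 1 ≤ (r.ξf k ω).1
  accurate_f : ∀ k, ∀ᵐ ω ∂P, (P⟦(eventB Q θ r k)ᶜ | r.mid k⟧) ω ≤ θ.pf
  meanSq_iterate : ∀ k, CondSqLE (r.mid k) P
    (fun ω => augBar Q θ r k ω (r.z k ω) - augTrue Q θ r k ω (r.z k ω)) (fun ω => r.ε k ω ^ 2)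
  meanSq_trial : ∀ k, CondSqLE (r.mid k) P
    (fun ω => augBar Q θ r k ω (r.trial k ω) - augTrue Q θ r k ω (r.trial k ω))
    (fun ω => r.ε k ω ^ 2)
  /- line search -/
  successful : ∀ k ω, Armijo Q θ r k ω →
    r.z (k + 1) ω = r.trial k ω ∧ r.α (k + 1) ω = min θ.αmax (θ.ρ * r.α k ω)
  reliable : ∀ k ω, Armijo Q θ r k ω → Reliable Q θ r k ω → r.ε (k + 1) ω = θ.ρ * r.ε k ω
  unreliable : ∀ k ω, Armijo Q θ r k ω → ¬ Reliable Q θ r k ω → r.ε (k + 1) ω = r.ε k ω / θ.ρ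
  unsuccessful : ∀ k ω, ¬ Armijo Q θ r k ω →
    r.z (k + 1) ω = r.z k ω ∧ r.α (k + 1) ω = r.α k ω / θ.ρ ∧ r.ε (k + 1) ω = r.ε k ω / θ.ρ

/-- The standing assumption: bounded iterates, smoothness, full row rank of the Jacobian,
conditions on `B`, nondegeneracy, and bounded noise. -/
structure Standing {d m : ℕ} {Ξ Ω : Type*} [MeasurableSpace Ξ] [MeasurableSpace Ω]
    (Q : Problem d m Ξ) (θ : Params) (r : Trajectory d m Ξ Ω)
    (X : Set (Vec d)) (Lam : Set (Vec m)) (κB M₀ M₁ M₂ : ℝ) : Prop where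
  compact_X : IsCompact X
  convex_X : Convex ℝ X
  compact_Lam : IsCompact Lam
  convex_Lam : Convex ℝ Lam
  mem_X : ∀ k ω, r.x k ω ∈ X
  mem_Lam : ∀ k ω, r.lam k ω ∈ Lam
  smooth : ∃ U : Set (Vec d), IsOpen U ∧ X ⊆ U ∧ ContDiffOn ℝ 3 Q.f U ∧ ContDiffOn ℝ 3 Q.c U ∧
    ∀ ξ, ContDiffOn ℝ 2 (fun y => Q.F y ξ) U
  full_rank : ∀ x ∈ X, Function.Surjective (jac Q.c x)
  B_pos : ∀ k ω v, jac Q.c (r.x k ω) v = 0 → θ.γ * ‖v‖ ^ 2 ≤ ⟪v, r.B k ω v⟫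
  B_bound : ∀ k ω, ‖r.B k ω‖ ≤ κB
  kkt_ne_zero : ∀ k ω, 0 < ‖stack (lagGradTrue Q r k ω) (Q.c (r.x k ω))‖
  dir_ne_zero : ∀ k ω, 0 < ‖r.dir k ω‖
  noise_F : ∀ ξ, ∀ x ∈ X, |Q.F x ξ - Q.f x| ≤ M₀
  noise_grad : ∀ ξ, ∀ x ∈ X, ‖gradient (fun y => Q.F y ξ) x - gradient Q.f x‖ ≤ M₁
  noise_hess : ∀ ξ, ∀ x ∈ X, ‖hess (fun y => Q.F y ξ) x - hess Q.f x‖ ≤ M₂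

/-! ### The constants, and the Lyapunov function -/

/-- The deterministic constants of the analysis: `μt` bounds the penalty parameters, `κν` is the
part of the Hessian bound of the augmented Lagrangian that does not depend on the penalty parameter,
and `Υ₁, Υ₃, Υ₄` compare the search direction with the estimated gradients. -/
structure Constants where
  μt : ℝ
  κν : ℝ
  Υ₁ : ℝ
  Υ₃ : ℝ
  Υ₄ : ℝ

/-- The Hessian bound `κ_{L_{μ,ν}} = μ sup_X ‖∇(Gᵀ c)‖ + κν`. -/
def Constants.κL {d m : ℕ} (C : Constants) (c : Vec d → Vec m) (X : Set (Vec d)) (μ : ℝ) : ℝ :=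
  μ * sSup ((fun x => ‖fderiv ℝ (fun y => jacT c y (c y)) x‖) '' X) + C.κν

/-- The defining properties of the constants. -/
structure Constants.Valid {d m : ℕ} {Ξ Ω : Type*} [MeasurableSpace Ξ] [MeasurableSpace Ω]
    (C : Constants) (Q : Problem d m Ξ) (θ : Params) (r : Trajectory d m Ξ Ω)
    (X : Set (Vec d)) (Lam : Set (Vec m)) : Prop where
  μt_pos : 0 < C.μt
  κν_pos : 0 < C.κν
  Υ₁_pos : 0 < C.Υ₁
  Υ₃_pos : 0 < C.Υ₃
  Υ₄_pos : 0 < C.Υ₄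
  penalty_le : ∀ k ω, r.μ k ω ≤ C.μt
  hessian_le : ∀ μ : ℝ, 0 ≤ μ → ∀ z : Pair d m, z.fst ∈ X → z.snd ∈ Lam →
    ‖fderiv ℝ (gradient (augLag Q.f Q.c μ θ.ν)) z‖ ≤ C.κL Q.c X μ
  refVec_le : ∀ k ω, ‖refVec Q θ r k ω‖ ≤ C.Υ₁ * ‖stepVec Q r k ω‖
  dir_le : ∀ k ω, ‖r.dir k ω‖ ≤ C.Υ₃ * ‖stepVec Q r k ω‖
  augGradBar_le : ∀ k ω, ‖augGradBar Q θ r k ω (r.μ k ω)‖ ≤ C.Υ₄ * ‖stepVec Q r k ω‖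

/-- The requirement on the weight `w` of the Lyapunov function. -/
def WeightCond {d m : ℕ} (C : Constants) (c : Vec d → Vec m) (θ : Params) (X : Set (Vec d))
    (w : ℝ) : Prop :=
  max (32 * θ.ρ * (max (C.κL c X C.μt * θ.αmax * C.Υ₃) (θ.κgrad * θ.αmax * C.Υ₁ + C.Υ₄)) ^ 2
        / (θ.β * θ.γ))
      (4 * (θ.ρ - 1)) ≤ w / (1 - w)

/-- The requirement on the failure probabilities. -/
def ProbCond (θ : Params) (w : ℝ) : Prop :=
  (θ.pgrad + Real.sqrt θ.pf) / ((1 - θ.pgrad) * (1 - θ.pf)) ≤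
    (θ.ρ - 1) / (8 * θ.ρ) * min (1 / θ.ρ) ((1 - w) / w)

/-- The squared norm of the gradient of `L_{μ,ν}` at the `k`-th iterate. -/
def gradSq {d m : ℕ} {Ξ Ω : Type*} [MeasurableSpace Ξ] [MeasurableSpace Ω]
    (Q : Problem d m Ξ) (θ : Params) (r : Trajectory d m Ξ Ω) (μ : ℝ) (k : ℕ) (ω : Ω) : ℝ :=
  ‖gradient (augLag Q.f Q.c μ θ.ν) (r.z k ω)‖ ^ 2

/-- The Lyapunov function
`w L_{μ,ν}(xᵏ, λᵏ) + (1 - w)/2 εₖ + (1 - w)/2 αₖ ‖∇L_{μ,ν}(xᵏ, λᵏ)‖²`. -/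
def lyapunov {d m : ℕ} {Ξ Ω : Type*} [MeasurableSpace Ξ] [MeasurableSpace Ω]
    (Q : Problem d m Ξ) (θ : Params) (r : Trajectory d m Ξ Ω) (w μ : ℝ) (k : ℕ) (ω : Ω) : ℝ :=
  w * augLag Q.f Q.c μ θ.ν (r.z k ω) + (1 - w) / 2 * r.ε k ω
    + (1 - w) / 2 * (r.α k ω * gradSq Q θ r μ k ω)

end StoSQP

end

/-!
The argument splits into a pathwise inequality, a conditional expectation, and the measurability
that makes the latter legitimate.

*Pathwise.* Write `g = (1 - w) / 2 * (1 - 1 / ρ) * (ε + α * ‖∇L‖ ^ 2)` at iteration `k` and let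
`e` be the sum of the errors of the two merit estimates. Along every trajectory whose penalty
parameter at iteration `k` is `μ`, the Lyapunov function with parameter `μ` changes by at most
`-g + w * 1_{Bᶜ} * e + (1 - w) * ρ * 1_{Aᶜ} * α * ‖∇L‖ ^ 2` (`lyapunov_succ_sub_le`). A rejected step
leaves the augmented Lagrangian unchanged, and the shrinking of `α` and `ε` alone gives `-g`. An
accepted step decreases the estimated merit function by at least `-α β q`, and half of that
survives in the true one if the estimates are accurate; a quarter pays for a possible growth of
`ε`, a quarter for the growth of the gradient (`augTrue_trial_sub_le`, `accepted_step_bound`),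
because `q ≤ -γ_RH / 2 * ‖s‖ ^ 2` and the new gradient differs from the old one by a multiple of
`‖s‖`. On `A` the old gradient itself is a multiple of `‖s‖`; off `A` it enters as an error.

*In the mean.* By a conditional Cauchy-Schwarz inequality (`condExp_indicator_mul_abs_le`),
`1_{Bᶜ} * e` has conditional mean at most `2 √p_f ε`, and `1_{Aᶜ}` has conditional mean at most
`p_grad`. The condition on the probabilities lets half of `g` absorb both errors
(`ProbCond.bound`). The stopped value of the penalty is not known at the start of iteration `k`,
but on `{Kbar < k}` it equals the penalty parameter of iteration `k - 1`, which is; the event is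
itself known at that time, so the conditional expectation may be localized to it.

*Measurability.* The penalty parameter is the first accepted one of a sequence. The search
direction is the unique solution of a linear system with measurable coefficients, and such a
solution is measurable (`measurable_of_injective_apply_eq`). By induction the whole state at the
start of an iteration is known to the past (`stateMeasurable`).

*Existence of the constants.* On the compact region of the iterates the data are bounded and
`G Gᵀ` is bounded below (`exists_jacT_lower_bound`), which bounds the direction by `s`. With the
slope inequality `NewtonStep.slope_le`, every large penalty parameter is acceptable, uniformly
over the run, so the increases stop below a deterministic bound (`exists_constants`). The Hessian
bound (`exists_hessian_bound`) uses that the Hessian of the augmented Lagrangian is affine in `μ`.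
-/

noncomputable section

namespace StoSQP

open Topology

/-! ### Derivatives of the augmented Lagrangian -/

section Calculus

variable {d m n : ℕ}

/-- The inverse of the Riesz isomorphism, as an `ℝ`-linear continuous map. -/
def rieszInv (E : Type*) [NormedAddCommGroup E] [InnerProductSpace ℝ E] [CompleteSpace E] :
    (E →L[ℝ] ℝ) →L[ℝ] E :=
  LinearMap.mkContinuous
    { toFun := fun l => (InnerProductSpace.toDual ℝ E).symm l
      map_add' := fun a b => by simp
      map_smul' := fun a b => by simp } 1 (fun l => by simp)

theorem gradient_eq_rieszInv {E : Type*} [NormedAddCommGroup E] [InnerProductSpace ℝ E]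
    [CompleteSpace E] (h : E → ℝ) : gradient h = fun x => rieszInv E (fderiv ℝ h x) :=
  rfl

/-- Transposition of matrices, as an `ℝ`-linear continuous map. -/
def transposeL (d m : ℕ) : (Vec d →L[ℝ] Vec m) →L[ℝ] (Vec m →L[ℝ] Vec d) :=
  LinearMap.toContinuousLinearMap
    { toFun := fun A => ContinuousLinearMap.adjoint A
      map_add' := fun a b => by simp
      map_smul' := fun a b => by simp }

theorem jacT_eq_transposeL (c : Vec d → Vec m) : jacT c = fun x => transposeL d m (jac c x) := rfl

theorem inner_jacT (c : Vec d → Vec m) (x : Vec d) (lam : Vec m) (u : Vec d) :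
    ⟪jacT c x lam, u⟫ = ⟪lam, jac c x u⟫ := ContinuousLinearMap.adjoint_inner_left _ _ _

theorem inner_jacT' (c : Vec d → Vec m) (x : Vec d) (lam : Vec m) (u : Vec d) :
    ⟪u, jacT c x lam⟫ = ⟪jac c x u, lam⟫ := ContinuousLinearMap.adjoint_inner_right _ _ _

theorem ContDiffAt.gradient {E : Type*} [NormedAddCommGroup E] [InnerProductSpace ℝ E]
    [CompleteSpace E] {h : E → ℝ} {x : E} {p q : ℕ} (hh : ContDiffAt ℝ q h x)
    (hpq : p + 1 ≤ q) : ContDiffAt ℝ p (gradient h) x := by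
  rw [gradient_eq_rieszInv]
  exact (rieszInv E).contDiff.contDiffAt.comp x (hh.fderiv_right (by exact_mod_cast hpq))

theorem inner_hess {h : Vec n → ℝ} {x : Vec n} (hh : ContDiffAt ℝ 2 h x) (u v : Vec n) :
    ⟪hess h x u, v⟫ = fderiv ℝ (fderiv ℝ h) x u v := by
  have hd : DifferentiableAt ℝ (fderiv ℝ h) x :=
    (hh.fderiv_right (m := 1) (by norm_num)).differentiableAt (by norm_num)
  have : hess h x u = rieszInv (Vec n) (fderiv ℝ (fderiv ℝ h) x u) := by
    rw [hess, gradient_eq_rieszInv]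
    have := (rieszInv (Vec n)).hasFDerivAt.comp x hd.hasFDerivAt
    exact congrArg (fun L : Vec n →L[ℝ] Vec n => L u) this.fderiv
  rw [this]
  exact InnerProductSpace.toDual_symm_apply

theorem hess_symm {h : Vec n → ℝ} {x : Vec n} (hh : ContDiffAt ℝ 2 h x) (u v : Vec n) :
    ⟪hess h x u, v⟫ = ⟪hess h x v, u⟫ := by
  rw [inner_hess hh, inner_hess hh]
  exact hh.isSymmSndFDerivAt (by simp) u v

theorem contDiffAt_component {c : Vec d → Vec m} {x : Vec d} {q : ℕ}
    (hc : ContDiffAt ℝ q c x) (j : Fin m) : ContDiffAt ℝ q (fun y => c y j) x :=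
  (EuclideanSpace.proj j : Vec m →L[ℝ] ℝ).contDiff.contDiffAt.comp x hc

/-- The entries of the derivative of the Jacobian are the entries of the component Hessians. -/
theorem fderiv_jac_apply {c : Vec d → Vec m} {x : Vec d} (hc : ContDiffAt ℝ 2 c x)
    (u h : Vec d) (j : Fin m) :
    fderiv ℝ (jac c) x h u j = ⟪hess (fun y => c y j) x u, h⟫ := by
  have hcj : ContDiffAt ℝ 2 (fun y => c y j) x := contDiffAt_component (q := 2) hc j
  rw [hess_symm hcj, inner_hess hcj]
  have hd : DifferentiableAt ℝ (jac c) x :=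
    (hc.fderiv_right (m := 1) (by norm_num)).differentiableAt (by norm_num)
  have hev : fderiv ℝ (fun y => c y j) =ᶠ[𝓝 x]
      fun y => (EuclideanSpace.proj j : Vec m →L[ℝ] ℝ).comp (jac c y) := by
    filter_upwards [hc.eventually (by simp)] with y hy
    exact ((EuclideanSpace.proj j : Vec m →L[ℝ] ℝ).hasFDerivAt.comp y
      (hy.differentiableAt (by norm_num)).hasFDerivAt).fderiv
  rw [hev.fderiv_eq]
  have : HasFDerivAt (fun y => (EuclideanSpace.proj j : Vec m →L[ℝ] ℝ).comp (jac c y))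
      ((ContinuousLinearMap.compL ℝ (Vec d) (Vec m) ℝ (EuclideanSpace.proj j)).comp
        (fderiv ℝ (jac c) x)) x :=
    (ContinuousLinearMap.compL ℝ (Vec d) (Vec m) ℝ
      (EuclideanSpace.proj j)).hasFDerivAt.comp x hd.hasFDerivAt
  rw [this.fderiv]
  rfl

/-- Pairing the derivative of the Jacobian with `a` gives the matrix `(∇²c₁ u, …, ∇²cₘ u)`. -/
theorem inner_fderiv_jac {c : Vec d → Vec m} {x : Vec d} (hc : ContDiffAt ℝ 2 c x)
    (a : Vec m) (u h : Vec d) :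
    ⟪a, fderiv ℝ (jac c) x h u⟫ = ⟪matT c x u a, h⟫ := by
  simp only [matT, _root_.sum_apply, ContinuousLinearMap.smulRight_apply, sum_inner,
    real_inner_smul_left, PiLp.inner_apply (𝕜 := ℝ) (f := fun _ : Fin m => ℝ),
    fderiv_jac_apply hc]
  refine Finset.sum_congr rfl fun j _ => ?_
  simp [mul_comm]

/-- The same pairing, with the component Hessians combined before they are applied. -/
theorem inner_fderiv_jac' {c : Vec d → Vec m} {x : Vec d} (hc : ContDiffAt ℝ 2 c x)
    (a : Vec m) (u h : Vec d) :
    ⟪a, fderiv ℝ (jac c) x h u⟫ = ⟪∑ j, a j • hess (fun y => c y j) x u, h⟫ := by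
  rw [inner_fderiv_jac hc]
  simp [matT]

/-- The first component of a pair, as a continuous linear map. -/
abbrev fstP (d m : ℕ) : Pair d m →L[ℝ] Vec d := WithLp.fstL 2 ℝ (Vec d) (Vec m)

/-- The second component of a pair, as a continuous linear map. -/
abbrev sndP (d m : ℕ) : Pair d m →L[ℝ] Vec m := WithLp.sndL 2 ℝ (Vec d) (Vec m)

theorem stack_fst (u : Vec d) (v : Vec m) : (stack u v).fst = u := rfl

theorem stack_snd (u : Vec d) (v : Vec m) : (stack u v).snd = v := rfl

theorem inner_pair (z w : Pair d m) : ⟪z, w⟫ = ⟪z.fst, w.fst⟫ + ⟪z.snd, w.snd⟫ :=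
  WithLp.prod_inner_apply z w

theorem contDiffAt_jac {c : Vec d → Vec m} {x : Vec d} {p q : ℕ} (hc : ContDiffAt ℝ q c x)
    (hpq : p + 1 ≤ q) : ContDiffAt ℝ p (jac c) x := hc.fderiv_right (by exact_mod_cast hpq)

theorem contDiffAt_jacT {c : Vec d → Vec m} {x : Vec d} {p q : ℕ} (hc : ContDiffAt ℝ q c x)
    (hpq : p + 1 ≤ q) : ContDiffAt ℝ p (jacT c) x := by
  rw [jacT_eq_transposeL]
  exact (transposeL d m).contDiff.contDiffAt.comp x (contDiffAt_jac hc hpq)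

/-- The augmented Lagrangian is one order less smooth than the objective and the constraint. -/
theorem contDiffAt_augLag {f : Vec d → ℝ} {c : Vec d → Vec m} {z : Pair d m} {p q : ℕ} (μ ν : ℝ)
    (hf : ContDiffAt ℝ q f z.fst) (hc : ContDiffAt ℝ q c z.fst) (hpq : p + 1 ≤ q) :
    ContDiffAt ℝ p (augLag f c μ ν) z := by
  have h1 : ContDiffAt ℝ p (fun z : Pair d m => z.fst) z := (fstP d m).contDiff.contDiffAt
  have h2 : ContDiffAt ℝ p (fun z : Pair d m => z.snd) z := (sndP d m).contDiff.contDiffAt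
  have hle : (p : WithTop ℕ∞) ≤ (q : ℕ) := by exact_mod_cast (by omega : p ≤ q)
  have hf' : ContDiffAt ℝ p (fun z : Pair d m => f z.fst) z := (hf.of_le hle).comp z h1
  have hc' : ContDiffAt ℝ p (fun z : Pair d m => c z.fst) z := (hc.of_le hle).comp z h1
  have hg : ContDiffAt ℝ p (fun z : Pair d m => gradient f z.fst) z :=
    (ContDiffAt.gradient hf hpq).comp z h1
  have hG : ContDiffAt ℝ p (fun z : Pair d m => jac c z.fst) z :=
    (contDiffAt_jac hc hpq).comp z h1
  have hGT : ContDiffAt ℝ p (fun z : Pair d m => jacT c z.fst) z :=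
    (contDiffAt_jacT hc hpq).comp z h1
  unfold augLag augValue lagGrad
  exact ((hf'.add (hc'.inner ℝ h2)).add (contDiffAt_const.mul (hc'.norm_sq ℝ))).add
    (contDiffAt_const.mul ((hG.clm_apply (hg.add (hGT.clm_apply h2))).norm_sq ℝ))

/-- The gradient formula for the exact augmented Lagrangian. -/
theorem hasGradientAt_augLag {f : Vec d → ℝ} {c : Vec d → Vec m} {z : Pair d m} (μ ν : ℝ)
    (hf : ContDiffAt ℝ 2 f z.fst) (hc : ContDiffAt ℝ 2 c z.fst) :
    HasGradientAt (augLag f c μ ν)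
      (augGradFormula c μ ν (gradient f z.fst) (hess f z.fst) z.fst z.snd) z := by
  have h1 : HasFDerivAt (fun z : Pair d m => z.fst) (fstP d m) z := (fstP d m).hasFDerivAt
  have h2 : HasFDerivAt (fun z : Pair d m => z.snd) (sndP d m) z := (sndP d m).hasFDerivAt
  have hf' : HasFDerivAt (fun z : Pair d m => f z.fst) _ z :=
    (hf.differentiableAt (by norm_num)).hasFDerivAt.comp z h1
  have hc' : HasFDerivAt (fun z : Pair d m => c z.fst) ((jac c z.fst).comp (fstP d m)) z :=
    (hc.differentiableAt (by norm_num)).hasFDerivAt.comp z h1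
  have hg : HasFDerivAt (fun z : Pair d m => gradient f z.fst)
      ((hess f z.fst).comp (fstP d m)) z :=
    ((ContDiffAt.gradient (p := 1) (q := 2) hf (by norm_num)).differentiableAt
      (by norm_num)).hasFDerivAt.comp z h1
  have hG0 := ((contDiffAt_jac (p := 1) (q := 2) hc (by norm_num)).differentiableAt
      (by norm_num)).hasFDerivAt
  have hG : HasFDerivAt (fun z : Pair d m => jac c z.fst) _ z := hG0.comp z h1
  have hGT : HasFDerivAt (fun z : Pair d m => jacT c z.fst) _ z :=
    ((transposeL d m).hasFDerivAt.comp z.fst hG0).comp z h1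
  have hl : HasFDerivAt (fun z : Pair d m => lagGrad c (gradient f z.fst) z.fst z.snd) _ z :=
    hg.add (hGT.clm_apply h2)
  have hb := hG.clm_apply hl
  have key := ((hf'.add (hc'.inner ℝ h2)).add ((hc'.norm_sq).const_mul (μ / 2))).add
    (hb.norm_sq.const_mul (ν / 2))
  -- the chain rule has produced a derivative; it remains to recognize it as the claimed gradient
  rw [hasGradientAt_iff_hasFDerivAt]
  refine key.congr_fderiv ?_
  ext v
  set x := z.fst
  set lam := z.snd
  set l := lagGrad c (gradient f x) x lam with hldef
  set b := jac c x l
  have e1 : fderiv ℝ f x v.fst = ⟪gradient f x, v.fst⟫ := (inner_gradient_left).symm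
  have e2 : ∀ a : Vec m, ∀ u h : Vec d,
      ⟪a, fderiv ℝ (jac c) x h u⟫ = ⟪matT c x u a, h⟫ := fun a u h => inner_fderiv_jac hc a u h
  -- the contribution of `∇²ₓL` that comes from the curvature of the constraint
  have e3 : ⟪b, jac c x (ContinuousLinearMap.adjoint (fderiv ℝ (jac c) x v.fst) lam)⟫
      = ⟪∑ j, lam j • hess (fun y => c y j) x (jacT c x b), v.fst⟫ := by
    rw [← inner_jacT, ContinuousLinearMap.adjoint_inner_right, real_inner_comm,
      inner_fderiv_jac' hc]
  have e4 : ⟪b, jac c x (hess f x v.fst)⟫ = ⟪hess f x (jacT c x b), v.fst⟫ := by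
    rw [← inner_jacT, real_inner_comm, hess_symm hf]
  have e5 : fderiv ℝ f x v.fst + (⟪c x, v.snd⟫ + ⟪jac c x v.fst, lam⟫)
        + μ / 2 * (2 * ⟪c x, jac c x v.fst⟫)
        + ν / 2 * (2 * ⟪b, jac c x (hess f x v.fst + (jacT c x v.snd
            + ContinuousLinearMap.adjoint (fderiv ℝ (jac c) x v.fst) lam))
          + fderiv ℝ (jac c) x v.fst l⟫)
      = ⟪augGradFormula c μ ν (gradient f x) (hess f x) x lam, v⟫ := by
    rw [inner_pair, augGradFormula, stack_fst, stack_snd, ← hldef]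
    simp only [map_add, inner_add_left, inner_add_right, real_inner_smul_left, e1, e2, e3, e4,
      matM, lagHess, add_apply, inner_jacT, ContinuousLinearMap.comp_apply, _root_.sum_apply,
      smul_apply]
    have e6 : ⟪b, jac c x (jacT c x v.snd)⟫ = ⟪jac c x (jacT c x b), v.snd⟫ := by
      rw [← inner_jacT, inner_jacT']
    have e7 : ⟪jac c x v.fst, lam⟫ = ⟪lam, jac c x v.fst⟫ := real_inner_comm _ _
    have e8 : ⟪l, v.fst⟫ = ⟪gradient f x, v.fst⟫ + ⟪lam, jac c x v.fst⟫ := by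
      rw [hldef, lagGrad, inner_add_left, inner_jacT]
    rw [e6, e7, e8]
    ring
  rw [InnerProductSpace.toDual_apply_apply, ← e5]
  simp only [add_apply, smul_apply, ContinuousLinearMap.comp_apply, fderivInnerCLM_apply,
    ContinuousLinearMap.prod_apply, nsmul_eq_mul, ContinuousLinearMap.flip_apply, smul_eq_mul,
    innerSL_apply_apply, Nat.cast_ofNat]
  rfl

end Calculus

/-! ### Uniform bounds on the compact region of the iterates -/

section Bounds

variable {d m : ℕ}

/-- The region `X × Λ` of primal-dual pairs. -/
def region (X : Set (Vec d)) (Lam : Set (Vec m)) : Set (Pair d m) :=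
  {z | z.fst ∈ X ∧ z.snd ∈ Lam}

theorem isCompact_region {X : Set (Vec d)} {Lam : Set (Vec m)} (hX : IsCompact X)
    (hL : IsCompact Lam) : IsCompact (region X Lam) := by
  have := (WithLp.prodContinuousLinearEquiv 2 ℝ (Vec d) (Vec m)).toHomeomorph.isCompact_preimage.2
    (hX.prod hL)
  exact this

theorem convex_region {X : Set (Vec d)} {Lam : Set (Vec m)} (hX : Convex ℝ X)
    (hL : Convex ℝ Lam) : Convex ℝ (region X Lam) := by
  intro z hz w hw a b ha hb hab
  exact ⟨hX hz.1 hw.1 ha hb hab, hL hz.2 hw.2 ha hb hab⟩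

theorem exists_pos_bound {E F : Type*} [TopologicalSpace E] [SeminormedAddCommGroup F]
    {K : Set E} (hK : IsCompact K) {g : E → F} (hg : ContinuousOn g K) :
    ∃ C > 0, ∀ x ∈ K, ‖g x‖ ≤ C := by
  obtain ⟨C, hC⟩ := hK.exists_bound_of_continuousOn hg
  exact ⟨max C 1, by positivity, fun x hx => (hC x hx).trans (le_max_left _ _)⟩

/-- The embedding `u ↦ (u; 0)`. -/
def inlP (d m : ℕ) : Vec d →L[ℝ] Pair d m :=
  (WithLp.prodContinuousLinearEquiv 2 ℝ (Vec d) (Vec m)).symm.toContinuousLinearMap.comp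
    (ContinuousLinearMap.inl ℝ (Vec d) (Vec m))

theorem norm_stack_sq (u : Vec d) (v : Vec m) : ‖stack u v‖ ^ 2 = ‖u‖ ^ 2 + ‖v‖ ^ 2 :=
  WithLp.prod_norm_sq_eq_of_L2 _

theorem norm_stack_le (u : Vec d) (v : Vec m) : ‖stack u v‖ ≤ ‖u‖ + ‖v‖ := by
  refine abs_le_of_sq_le_sq' ?_ (by positivity) |>.2
  rw [norm_stack_sq]
  nlinarith [norm_nonneg u, norm_nonneg v]

theorem norm_fst_le_stack (u : Vec d) (v : Vec m) : ‖u‖ ≤ ‖stack u v‖ := by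
  refine abs_le_of_sq_le_sq' ?_ (by positivity) |>.2
  rw [norm_stack_sq]
  nlinarith [norm_nonneg v]

theorem norm_snd_le_stack (u : Vec d) (v : Vec m) : ‖v‖ ≤ ‖stack u v‖ := by
  refine abs_le_of_sq_le_sq' ?_ (by positivity) |>.2
  rw [norm_stack_sq]
  nlinarith [norm_nonneg u]

theorem norm_inlP (u : Vec d) : ‖inlP d m u‖ = ‖u‖ := by
  have h : ‖inlP d m u‖ ^ 2 = ‖u‖ ^ 2 := by
    refine (norm_stack_sq u (0 : Vec m)).trans ?_
    simp
  exact (sq_eq_sq₀ (norm_nonneg _) (norm_nonneg _)).1 h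

/-- The gradient formula is affine in the penalty parameter. -/
theorem augGradFormula_eq_add (c : Vec d → Vec m) (μ ν : ℝ) (g : Vec d) (H : Vec d →L[ℝ] Vec d)
    (x : Vec d) (lam : Vec m) :
    augGradFormula c μ ν g H x lam
      = augGradFormula c 0 ν g H x lam + μ • inlP d m (jacT c x (c x)) := by
  change stack _ _ = stack _ _ + μ • stack _ 0
  simp [stack, ← WithLp.toLp_add, ← WithLp.toLp_smul]

section Smooth

variable {X : Set (Vec d)} {Lam : Set (Vec m)} {f : Vec d → ℝ} {c : Vec d → Vec m}

theorem gradient_augLag {z : Pair d m} (μ ν : ℝ) (hf : ContDiffAt ℝ 3 f z.fst)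
    (hc : ContDiffAt ℝ 3 c z.fst) :
    gradient (augLag f c μ ν) z
      = augGradFormula c μ ν (gradient f z.fst) (hess f z.fst) z.fst z.snd :=
  (hasGradientAt_augLag μ ν (hf.of_le (by norm_num)) (hc.of_le (by norm_num))).gradient

theorem contDiffAt_gradient_augLag {z : Pair d m} (μ ν : ℝ) (hf : ContDiffAt ℝ 3 f z.fst)
    (hc : ContDiffAt ℝ 3 c z.fst) : ContDiffAt ℝ 1 (gradient (augLag f c μ ν)) z := by
  have h := contDiffAt_augLag (p := 2) (q := 3) μ ν hf hc (by norm_num)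
  exact ContDiffAt.gradient (p := 1) (q := 2) h (by norm_num)

theorem eventually_contDiffAt_fst {F : Type*} [NormedAddCommGroup F] [NormedSpace ℝ F]
    {h : Vec d → F} {z : Pair d m} (hh : ContDiffAt ℝ 3 h z.fst) :
    ∀ᶠ y : Pair d m in 𝓝 z, ContDiffAt ℝ 3 h y.fst :=
  (fstP d m).continuous.continuousAt.eventually (hh.eventually (by simp))

/-- `∇(Gᵀc)` exists and is continuous where `c` is smooth. -/
theorem contDiffAt_jacT_apply {x : Vec d} (hc : ContDiffAt ℝ 3 c x) :
    ContDiffAt ℝ 1 (fun y => jacT c y (c y)) x :=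
  (contDiffAt_jacT (p := 1) (q := 3) hc (by norm_num)).clm_apply (hc.of_le (by norm_num))

theorem ContDiffAt.continuousAt_fderiv {E F : Type*} [NormedAddCommGroup E] [NormedSpace ℝ E]
    [NormedAddCommGroup F] [NormedSpace ℝ F] {h : E → F} {x : E} (hh : ContDiffAt ℝ 1 h x) :
    ContinuousAt (fderiv ℝ h) x :=
  (hh.fderiv_right (m := 0) (by norm_num)).continuousAt

theorem norm_fderiv_add_smul_le {E F : Type*} [NormedAddCommGroup E] [NormedSpace ℝ E]
    [NormedAddCommGroup F] [NormedSpace ℝ F] {g h : E → F} {x : E} (hg : DifferentiableAt ℝ g x)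
    (hh : DifferentiableAt ℝ h x) {μ : ℝ} (hμ : 0 ≤ μ) :
    ‖fderiv ℝ (fun y => g y + μ • h y) x‖ ≤ ‖fderiv ℝ g x‖ + μ * ‖fderiv ℝ h x‖ := by
  have : HasFDerivAt (fun y => g y + μ • h y) (fderiv ℝ g x + μ • fderiv ℝ h x) x :=
    hg.hasFDerivAt.add (hh.hasFDerivAt.const_smul μ)
  rw [this.fderiv]
  refine (norm_add_le _ _).trans_eq ?_
  rw [norm_smul, Real.norm_of_nonneg hμ]

/-- A restatement for normed spaces, where instance search on `Pair d m` is cheap. -/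
theorem fderiv_eq_of_hasFDerivAt {E F : Type*} [NormedAddCommGroup E] [NormedSpace ℝ E]
    [NormedAddCommGroup F] [NormedSpace ℝ F] {g : E → F} {g' : E →L[ℝ] F} {x : E}
    (hg : HasFDerivAt g g' x) : fderiv ℝ g x = g' := hg.fderiv

/-- Embedding and projecting does not increase the norm of a derivative. -/
theorem norm_fderiv_inlP_comp {h : Vec d → Vec d} {z : Pair d m}
    (hh : DifferentiableAt ℝ h z.fst) :
    DifferentiableAt ℝ (fun y : Pair d m => inlP d m (h y.fst)) z ∧
      ‖fderiv ℝ (fun y : Pair d m => inlP d m (h y.fst)) z‖ ≤ ‖fderiv ℝ h z.fst‖ := by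
  have hD : HasFDerivAt (fun y : Pair d m => inlP d m (h y.fst))
      ((inlP d m).comp ((fderiv ℝ h z.fst).comp (fstP d m))) z :=
    (inlP d m).hasFDerivAt.comp z (hh.hasFDerivAt.comp z (fstP d m).hasFDerivAt)
  have he : fderiv ℝ (fun y : Pair d m => inlP d m (h y.fst)) z
      = (inlP d m).comp ((fderiv ℝ h z.fst).comp (fstP d m)) := fderiv_eq_of_hasFDerivAt hD
  refine ⟨hD.differentiableAt, ?_⟩
  rw [he]
  refine ContinuousLinearMap.opNorm_le_bound _ (norm_nonneg _) fun v => ?_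
  change ‖inlP d m (fderiv ℝ h z.fst v.fst)‖ ≤ _
  rw [norm_inlP]
  refine (ContinuousLinearMap.le_opNorm _ _).trans ?_
  gcongr
  exact norm_fst_le_stack v.fst v.snd

/-- The Hessian of the augmented Lagrangian is affine in the penalty parameter, with the derivative
of `Gᵀc` as slope; this gives a Hessian bound of the required form. -/
theorem exists_hessian_bound (hX : IsCompact X) (hL : IsCompact Lam) (ν : ℝ)
    (hf : ∀ x ∈ X, ContDiffAt ℝ 3 f x) (hc : ∀ x ∈ X, ContDiffAt ℝ 3 c x) :
    ∃ κ > 0, ∀ μ : ℝ, 0 ≤ μ → ∀ z : Pair d m, z.fst ∈ X → z.snd ∈ Lam →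
      ‖fderiv ℝ (gradient (augLag f c μ ν)) z‖
        ≤ μ * sSup ((fun x => ‖fderiv ℝ (fun y => jacT c y (c y)) x‖) '' X) + κ := by
  obtain ⟨κ, hκ, hb⟩ := exists_pos_bound (isCompact_region hX hL)
    (g := fderiv ℝ (gradient (augLag f c 0 ν))) fun z hz =>
      (ContDiffAt.continuousAt_fderiv (contDiffAt_gradient_augLag 0 ν (hf _ hz.1)
        (hc _ hz.1))).continuousWithinAt
  refine ⟨κ, hκ, fun μ hμ z hz1 hz2 => ?_⟩
  have hbdd : BddAbove ((fun x => ‖fderiv ℝ (fun y => jacT c y (c y)) x‖) '' X) :=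
    hX.bddAbove_image fun x hx =>
      (ContDiffAt.continuousAt_fderiv (contDiffAt_jacT_apply (hc x hx))).norm.continuousWithinAt
  have hD := (contDiffAt_jacT_apply (hc _ hz1)).differentiableAt (by norm_num)
  obtain ⟨hD1, hD2⟩ := norm_fderiv_inlP_comp hD
  have h0 := ((contDiffAt_gradient_augLag 0 ν (hf _ hz1) (hc _ hz1)).differentiableAt
    (by norm_num))
  have hev : gradient (augLag f c μ ν) =ᶠ[𝓝 z] fun y =>
      gradient (augLag f c 0 ν) y + μ • inlP d m (jacT c y.fst (c y.fst)) := by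
    filter_upwards [eventually_contDiffAt_fst (hf _ hz1), eventually_contDiffAt_fst (hc _ hz1)]
      with y hy1 hy2
    rw [gradient_augLag μ ν hy1 hy2, gradient_augLag 0 ν hy1 hy2, augGradFormula_eq_add]
  -- the supremum of an unbounded set would be a junk value, so boundedness is needed here
  have hsup : ‖fderiv ℝ (fun y => jacT c y (c y)) z.fst‖
      ≤ sSup ((fun x => ‖fderiv ℝ (fun y => jacT c y (c y)) x‖) '' X) :=
    le_csSup hbdd ⟨z.fst, hz1, rfl⟩
  have h1 := norm_fderiv_add_smul_le h0 hD1 hμ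
  rw [hev.fderiv_eq]
  have h2 := hb z ⟨hz1, hz2⟩
  have h3 := mul_le_mul_of_nonneg_left (hD2.trans hsup) hμ
  linarith

/-- The gradient of the augmented Lagrangian is Lipschitz on the convex region of the iterates. -/
theorem norm_gradient_augLag_sub_le (hX : Convex ℝ X) (hL : Convex ℝ Lam) (μ ν : ℝ)
    (hf : ∀ x ∈ X, ContDiffAt ℝ 3 f x) (hc : ∀ x ∈ X, ContDiffAt ℝ 3 c x) {κ : ℝ}
    (hκ : ∀ z : Pair d m, z.fst ∈ X → z.snd ∈ Lam →
      ‖fderiv ℝ (gradient (augLag f c μ ν)) z‖ ≤ κ)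
    {z w : Pair d m} (hz : z ∈ region X Lam) (hw : w ∈ region X Lam) :
    ‖gradient (augLag f c μ ν) w - gradient (augLag f c μ ν) z‖ ≤ κ * ‖w - z‖ :=
  (convex_region hX hL).norm_image_sub_le_of_norm_fderiv_le
    (fun y hy => (contDiffAt_gradient_augLag μ ν (hf _ hy.1) (hc _ hy.1)).differentiableAt
      (by norm_num)) (fun y hy => hκ y hy.1 hy.2) hz hw

/-- Full row rank of the Jacobian on a compact set makes its transpose uniformly injective. -/
theorem exists_jacT_lower_bound (hX : IsCompact X) (hc : ∀ x ∈ X, ContDiffAt ℝ 3 c x)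
    (hr : ∀ x ∈ X, Function.Surjective (jac c x)) :
    ∃ σ > 0, ∀ x ∈ X, ∀ y : Vec m, σ * ‖y‖ ≤ ‖jacT c x y‖ := by
  have hcont : ContinuousOn (fun p : Vec d × Vec m => ‖jacT c p.1 p.2‖)
      (X ×ˢ Metric.sphere (0 : Vec m) 1) := by
    rintro ⟨x, y⟩ ⟨hx, -⟩
    have h1 : ContinuousAt (fun p : Vec d × Vec m => jacT c p.1) (x, y) :=
      ContinuousAt.comp (g := jacT c) (f := Prod.fst)
        (contDiffAt_jacT (p := 2) (q := 3) (hc x hx) (by norm_num)).continuousAt continuousAt_fst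
    exact (h1.clm_apply continuousAt_snd).norm.continuousWithinAt
  -- full row rank makes the transpose injective, so it has no zero on the unit sphere
  have hpos : ∀ p ∈ X ×ˢ Metric.sphere (0 : Vec m) 1, 0 < ‖jacT c p.1 p.2‖ := by
    rintro ⟨x, y⟩ ⟨hx, hy⟩
    rw [norm_pos_iff]
    intro h0
    obtain ⟨u, hu⟩ := hr x hx y
    have : ⟪y, y⟫ = 0 := by
      rw [show ⟪y, y⟫ = ⟪y, jac c x u⟫ by rw [hu], ← inner_jacT]
      simp only at h0
      simp [h0]
    have hy0 : y = 0 := inner_self_eq_zero.1 this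
    simp [hy0] at hy
  obtain ⟨σ, hσ, hb⟩ := (hX.prod (isCompact_sphere (0 : Vec m) 1)).exists_forall_le' hcont hpos
  refine ⟨σ, hσ, fun x hx y => ?_⟩
  by_cases hy : y = 0
  · simp [hy]
  have hn : 0 < ‖y‖ := norm_pos_iff.2 hy
  have := hb (x, ‖y‖⁻¹ • y) ⟨hx, by simp [norm_smul, hn.ne']⟩
  simp only [map_smul, norm_smul, norm_inv, norm_norm] at this
  calc σ * ‖y‖ ≤ ‖y‖⁻¹ * ‖jacT c x y‖ * ‖y‖ := by gcongr
    _ = ‖jacT c x y‖ := by field_simp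

theorem continuousAt_hess {n : ℕ} {h : Vec n → ℝ} {x : Vec n} (hh : ContDiffAt ℝ 2 h x) :
    ContinuousAt (hess h) x :=
  ContDiffAt.continuousAt_fderiv (ContDiffAt.gradient (p := 1) (q := 2) hh (by norm_num))

/-- The matrix `M` is uniformly bounded when its arguments are. -/
theorem exists_matM_bound (hX : IsCompact X) (hL : IsCompact Lam)
    (hc : ∀ x ∈ X, ContDiffAt ℝ 3 c x) (R₁ R₂ : ℝ) :
    ∃ κ > 0, ∀ (g : Vec d) (H : Vec d →L[ℝ] Vec d) (x : Vec d) (lam : Vec m), ‖g‖ ≤ R₁ → ‖H‖ ≤ R₂ →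
      x ∈ X → lam ∈ Lam → ‖matM c g H x lam‖ ≤ κ := by
  have hcont : ContinuousOn
      (fun p : (Vec d × (Vec d →L[ℝ] Vec d)) × (Vec d × Vec m) => matM c p.1.1 p.1.2 p.2.1 p.2.2)
      ((Metric.closedBall 0 R₁ ×ˢ Metric.closedBall 0 R₂) ×ˢ (X ×ˢ Lam)) := by
    rintro ⟨⟨g, H⟩, ⟨x, lam⟩⟩ ⟨-, hx, -⟩
    refine ContinuousAt.continuousWithinAt ?_
    have hx1 : ContinuousAt (fun p : (Vec d × (Vec d →L[ℝ] Vec d)) × (Vec d × Vec m) => p.2.1)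
      ((g, H), (x, lam)) := by fun_prop
    have h1 : ContinuousAt (fun p : (Vec d × (Vec d →L[ℝ] Vec d)) × (Vec d × Vec m) =>
        jacT c p.2.1) ((g, H), (x, lam)) :=
      ContinuousAt.comp (g := jacT c)
        (contDiffAt_jacT (p := 2) (q := 3) (hc x hx) (by norm_num)).continuousAt hx1
    have h2 : ∀ j, ContinuousAt (fun p : (Vec d × (Vec d →L[ℝ] Vec d)) × (Vec d × Vec m) =>
        hess (fun y => c y j) p.2.1) ((g, H), (x, lam)) := fun j =>
      ContinuousAt.comp (g := hess (fun y => c y j))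
        (continuousAt_hess (contDiffAt_component (q := 2) ((hc x hx).of_le (by norm_num)) j)) hx1
    have h3 : ContinuousAt (fun p : (Vec d × (Vec d →L[ℝ] Vec d)) × (Vec d × Vec m) =>
        lagGrad c p.1.1 p.2.1 p.2.2) ((g, H), (x, lam)) := by
      unfold lagGrad
      fun_prop
    have h4 : ContinuousAt (fun p : (Vec d × (Vec d →L[ℝ] Vec d)) × (Vec d × Vec m) =>
        lagHess c p.1.2 p.2.1 p.2.2) ((g, H), (x, lam)) := by
      unfold lagHess
      refine ContinuousAt.add (by fun_prop) (tendsto_finsetSum _ fun j _ => ?_)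
      have h2' : ContinuousAt (fun p : (Vec d × (Vec d →L[ℝ] Vec d)) × (Vec d × Vec m) =>
          p.2.2 j) ((g, H), (x, lam)) := by fun_prop
      exact ContinuousAt.smul h2' (h2 j)
    have h5 : ContinuousAt (fun p : (Vec d × (Vec d →L[ℝ] Vec d)) × (Vec d × Vec m) =>
        matT c p.2.1 (lagGrad c p.1.1 p.2.1 p.2.2)) ((g, H), (x, lam)) := by
      unfold matT
      refine tendsto_finsetSum _ fun j _ => ?_
      exact ((ContinuousLinearMap.smulRightL ℝ (Vec m) (Vec d)
        (EuclideanSpace.proj j)).continuous.continuousAt).comp ((h2 j).clm_apply h3)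
    exact (h4.clm_comp h1).add h5
  obtain ⟨κ, hκ, hb⟩ := exists_pos_bound
    (((isCompact_closedBall (0 : Vec d) R₁).prod
      (isCompact_closedBall (0 : Vec d →L[ℝ] Vec d) R₂)).prod (hX.prod hL)) hcont
  refine ⟨κ, hκ, fun g H x lam hg hH hx hl => hb ((g, H), (x, lam)) ⟨⟨?_, ?_⟩, hx, hl⟩⟩
  · simpa using hg
  · simpa using hH

end Smooth

end Bounds

/-! ### Linear algebra of the search direction -/

section LinearAlgebra

variable {d m : ℕ}

/-- The triple `(Δx, Δt, Δl)` solves the two linear systems of an iteration, with data bounded by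
`κB, κG, κM`, with a transposed Jacobian bounded below by `σ`, and with `B` coercive on the kernel
of the Jacobian `G`. -/
structure NewtonStep (G : Vec d →L[ℝ] Vec m) (B : Vec d →L[ℝ] Vec d) (M : Vec m →L[ℝ] Vec d)
    (cv : Vec m) (l Δx : Vec d) (Δt Δl : Vec m) (γ κB κG κM σ : ℝ) : Prop where
  eq_x : B Δx + ContinuousLinearMap.adjoint G Δt = -l
  eq_c : G Δx = -cv
  eq_l : G (ContinuousLinearMap.adjoint G Δl) = -(G l + ContinuousLinearMap.adjoint M Δx)
  σ_pos : 0 < σ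
  γ_pos : 0 < γ
  lower : ∀ y, σ * ‖y‖ ≤ ‖ContinuousLinearMap.adjoint G y‖
  coercive : ∀ v, G v = 0 → γ * ‖v‖ ^ 2 ≤ ⟪v, B v⟫
  norm_B : ‖B‖ ≤ κB
  norm_G : ‖G‖ ≤ κG
  norm_M : ‖M‖ ≤ κM

/-- A penalty parameter beyond which the search direction is a descent direction. The sum
`(κG κB + 1) / σ² + (1 + κM) / σ²` bounds `‖Δt + Δl‖` relative to `‖(Δx; G l)‖`, and `1 / σ` bounds
the normal component of `Δx` relative to the constraint violation. -/
def penaltyThreshold (γ κB κG κM σ : ℝ) : ℝ :=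
  (2 * κB * (1 / σ) + ((κG * κB + 1) / σ ^ 2 + (1 + κM) / σ ^ 2)) ^ 2 / (2 * γ)
    + ((κG * κB + 1) / σ ^ 2 + (1 + κM) / σ ^ 2) ^ 2 / (2 * γ) + κB * (1 / σ) ^ 2
    + ((κG * κB + 1) / σ ^ 2 + (1 + κM) / σ ^ 2) * (1 / σ) + γ * (1 / σ) ^ 2 / 2

theorem norm_adjoint_eq (A : Vec d →L[ℝ] Vec m) : ‖ContinuousLinearMap.adjoint A‖ = ‖A‖ :=
  ContinuousLinearMap.adjoint.norm_map A

/-- A lower bound for `Gᵀ` gives one for the Gram matrix `G Gᵀ`. -/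
theorem norm_le_of_lower {G : Vec d →L[ℝ] Vec m} {σ : ℝ} (hσ : 0 < σ)
    (h : ∀ y, σ * ‖y‖ ≤ ‖ContinuousLinearMap.adjoint G y‖) (y : Vec m) :
    σ ^ 2 * ‖y‖ ≤ ‖G (ContinuousLinearMap.adjoint G y)‖ := by
  by_cases hy : ‖y‖ = 0
  · rw [hy]; simp
  have hn : 0 < ‖y‖ := lt_of_le_of_ne (norm_nonneg _) (Ne.symm hy)
  have h1 : ‖ContinuousLinearMap.adjoint G y‖ ^ 2
      = ⟪y, G (ContinuousLinearMap.adjoint G y)⟫ := by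
    rw [← real_inner_self_eq_norm_sq, ContinuousLinearMap.adjoint_inner_left]
  have h2 := real_inner_le_norm y (G (ContinuousLinearMap.adjoint G y))
  have h3 : (σ * ‖y‖) ^ 2 ≤ ‖ContinuousLinearMap.adjoint G y‖ ^ 2 :=
    pow_le_pow_left₀ (by positivity) (h y) 2
  have h4 : ‖y‖ * (σ ^ 2 * ‖y‖) ≤ ‖y‖ * ‖G (ContinuousLinearMap.adjoint G y)‖ := by nlinarith
  exact le_of_mul_le_mul_left h4 hn

theorem exists_gram_solution {G : Vec d →L[ℝ] Vec m} {σ : ℝ} (hσ : 0 < σ)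
    (h : ∀ y, σ * ‖y‖ ≤ ‖ContinuousLinearMap.adjoint G y‖) (v : Vec m) :
    ∃ y, G (ContinuousLinearMap.adjoint G y) = v := by
  let L : Vec m →ₗ[ℝ] Vec m := (G.comp (ContinuousLinearMap.adjoint G)).toLinearMap
  have hinj : Function.Injective L := by
    refine (injective_iff_map_eq_zero L).2 fun y hy => ?_
    have h1 := norm_le_of_lower hσ h y
    rw [show G (ContinuousLinearMap.adjoint G y) = 0 from hy, norm_zero] at h1
    have h2 : 0 < σ ^ 2 := by positivity
    exact norm_eq_zero.1 (le_antisymm (by nlinarith [norm_nonneg y]) (norm_nonneg y))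
  exact LinearMap.injective_iff_surjective.1 hinj v

namespace NewtonStep

variable {G : Vec d →L[ℝ] Vec m} {B : Vec d →L[ℝ] Vec d} {M : Vec m →L[ℝ] Vec d}
  {cv : Vec m} {l Δx : Vec d} {Δt Δl : Vec m} {γ κB κG κM σ : ℝ}

theorem κB_nonneg (h : NewtonStep G B M cv l Δx Δt Δl γ κB κG κM σ) : 0 ≤ κB :=
  (norm_nonneg _).trans h.norm_B

theorem κG_nonneg (h : NewtonStep G B M cv l Δx Δt Δl γ κB κG κM σ) : 0 ≤ κG :=
  (norm_nonneg _).trans h.norm_G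

theorem κM_nonneg (h : NewtonStep G B M cv l Δx Δt Δl γ κB κG κM σ) : 0 ≤ κM :=
  (norm_nonneg _).trans h.norm_M

theorem norm_B_apply (h : NewtonStep G B M cv l Δx Δt Δl γ κB κG κM σ) (u : Vec d) :
    ‖B u‖ ≤ κB * ‖u‖ := B.le_of_opNorm_le h.norm_B u

theorem norm_G_apply (h : NewtonStep G B M cv l Δx Δt Δl γ κB κG κM σ) (u : Vec d) :
    ‖G u‖ ≤ κG * ‖u‖ := G.le_of_opNorm_le h.norm_G u

theorem norm_GT_apply (h : NewtonStep G B M cv l Δx Δt Δl γ κB κG κM σ) (y : Vec m) :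
    ‖ContinuousLinearMap.adjoint G y‖ ≤ κG * ‖y‖ :=
  ContinuousLinearMap.le_of_opNorm_le _ (by rw [norm_adjoint_eq]; exact h.norm_G) y

theorem norm_M_apply (h : NewtonStep G B M cv l Δx Δt Δl γ κB κG κM σ) (y : Vec m) :
    ‖M y‖ ≤ κM * ‖y‖ := M.le_of_opNorm_le h.norm_M y

theorem norm_MT_apply (h : NewtonStep G B M cv l Δx Δt Δl γ κB κG κM σ) (u : Vec d) :
    ‖ContinuousLinearMap.adjoint M u‖ ≤ κM * ‖u‖ :=
  ContinuousLinearMap.le_of_opNorm_le _ (by rw [norm_adjoint_eq]; exact h.norm_M) u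

theorem norm_c_le (h : NewtonStep G B M cv l Δx Δt Δl γ κB κG κM σ) :
    ‖cv‖ ≤ κG * ‖stack Δx (G l)‖ := by
  have : ‖cv‖ = ‖G Δx‖ := by rw [h.eq_c, norm_neg]
  rw [this]
  refine (h.norm_G_apply Δx).trans ?_
  have := h.κG_nonneg
  gcongr
  exact norm_fst_le_stack _ _

theorem norm_Δt_le (h : NewtonStep G B M cv l Δx Δt Δl γ κB κG κM σ) :
    ‖Δt‖ ≤ (κG * κB + 1) / σ ^ 2 * ‖stack Δx (G l)‖ := by
  have h1 := norm_le_of_lower h.σ_pos h.lower Δt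
  have h2 : G (ContinuousLinearMap.adjoint G Δt) = -(G (B Δx) + G l) := by
    have := congrArg G h.eq_x
    rw [map_add, map_neg] at this
    rw [neg_add, ← this]; abel
  have h3 : ‖G (ContinuousLinearMap.adjoint G Δt)‖ ≤ (κG * κB + 1) * ‖stack Δx (G l)‖ := by
    rw [h2, norm_neg]
    refine (norm_add_le _ _).trans ?_
    have h4 : ‖G (B Δx)‖ ≤ κG * (κB * ‖stack Δx (G l)‖) := by
      refine (h.norm_G_apply _).trans ?_
      have := h.κG_nonneg
      gcongr
      refine (h.norm_B_apply _).trans ?_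
      have := h.κB_nonneg
      gcongr
      exact norm_fst_le_stack _ _
    have h5 := norm_snd_le_stack Δx (G l)
    linarith
  have hσ : 0 < σ ^ 2 := by have := h.σ_pos; positivity
  rw [div_mul_eq_mul_div, le_div_iff₀ hσ]
  linarith

theorem norm_Δl_le (h : NewtonStep G B M cv l Δx Δt Δl γ κB κG κM σ) :
    ‖Δl‖ ≤ (1 + κM) / σ ^ 2 * ‖stack Δx (G l)‖ := by
  have h1 := norm_le_of_lower h.σ_pos h.lower Δl
  have h3 : ‖G (ContinuousLinearMap.adjoint G Δl)‖ ≤ (1 + κM) * ‖stack Δx (G l)‖ := by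
    rw [h.eq_l, norm_neg]
    refine (norm_add_le _ _).trans ?_
    have h4 : ‖ContinuousLinearMap.adjoint M Δx‖ ≤ κM * ‖stack Δx (G l)‖ := by
      refine (h.norm_MT_apply _).trans ?_
      have := h.κM_nonneg
      gcongr
      exact norm_fst_le_stack _ _
    have h5 := norm_snd_le_stack Δx (G l)
    linarith
  have hσ : 0 < σ ^ 2 := by have := h.σ_pos; positivity
  rw [div_mul_eq_mul_div, le_div_iff₀ hσ]
  linarith

theorem norm_dir_le (h : NewtonStep G B M cv l Δx Δt Δl γ κB κG κM σ) :
    ‖stack Δx Δl‖ ≤ (1 + (1 + κM) / σ ^ 2) * ‖stack Δx (G l)‖ := by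
  refine (norm_stack_le _ _).trans ?_
  have h1 := norm_fst_le_stack Δx (G l)
  have h2 := h.norm_Δl_le
  linarith

theorem norm_l_le (h : NewtonStep G B M cv l Δx Δt Δl γ κB κG κM σ) :
    ‖l‖ ≤ (κB + κG * ((κG * κB + 1) / σ ^ 2)) * ‖stack Δx (G l)‖ := by
  have h1 : ‖l‖ = ‖B Δx + ContinuousLinearMap.adjoint G Δt‖ := by rw [h.eq_x, norm_neg]
  rw [h1]
  refine (norm_add_le _ _).trans ?_
  rw [add_mul]
  refine add_le_add ?_ ?_
  · refine (h.norm_B_apply _).trans ?_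
    have := h.κB_nonneg
    gcongr
    exact norm_fst_le_stack _ _
  · refine (h.norm_GT_apply _).trans ?_
    have := h.κG_nonneg
    rw [mul_assoc]
    gcongr
    exact h.norm_Δt_le

/-- The directional derivative of the augmented Lagrangian along the search direction: all terms
with `M` cancel. -/
theorem slope_eq (h : NewtonStep G B M cv l Δx Δt Δl γ κB κG κM σ) (μ ν : ℝ) :
    ⟪stack (l + ν • M (G l) + μ • ContinuousLinearMap.adjoint G cv)
        (cv + ν • G (ContinuousLinearMap.adjoint G (G l))), stack Δx Δl⟫
      = -⟪Δx, B Δx⟫ + ⟪cv, Δt + Δl⟫ - μ * ‖cv‖ ^ 2 - ν * ‖G l‖ ^ 2 := by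
  rw [inner_pair, stack_fst, stack_fst, stack_snd, stack_snd]
  simp only [inner_add_left, inner_add_right, real_inner_smul_left]
  have h1 : ⟪l, Δx⟫ = -⟪Δx, B Δx⟫ + ⟪cv, Δt⟫ := by
    have e : l = -(B Δx + ContinuousLinearMap.adjoint G Δt) := by rw [h.eq_x, neg_neg]
    rw [e, inner_neg_left, inner_add_left, ContinuousLinearMap.adjoint_inner_left, h.eq_c,
      inner_neg_right, real_inner_comm, real_inner_comm cv]
    ring
  have h2 : ⟪M (G l), Δx⟫ = ⟪G l, ContinuousLinearMap.adjoint M Δx⟫ := by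
    rw [ContinuousLinearMap.adjoint_inner_right]
  have h3 : ⟪ContinuousLinearMap.adjoint G cv, Δx⟫ = -‖cv‖ ^ 2 := by
    rw [ContinuousLinearMap.adjoint_inner_left, h.eq_c, inner_neg_right,
      real_inner_self_eq_norm_sq]
  have h4 : ⟪G (ContinuousLinearMap.adjoint G (G l)), Δl⟫
      = -‖G l‖ ^ 2 - ⟪G l, ContinuousLinearMap.adjoint M Δx⟫ := by
    rw [← ContinuousLinearMap.adjoint_inner_right, ContinuousLinearMap.adjoint_inner_left, h.eq_l,
      inner_neg_right, inner_add_right, real_inner_self_eq_norm_sq]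
    ring
  rw [h1, h2, h3, h4]
  ring

/-- The scalar estimate behind `slope_le`, with `a` and `v` the norms of the tangential and normal
components of `Δx`, `b` the norm of `G l` and `C` that of the constraint: every mixed product with
`C` is split by Young's inequality, at the price of half of the coercivity in `a` and `b`. -/
theorem slope_bound_aux {γ κ τ E a C b v p inn cr s μ ν : ℝ} (hγ : 0 < γ) (hν : γ ≤ ν)
    (hκ : 0 ≤ κ) (hE : 0 ≤ E) (hC : 0 ≤ C) (ha : 0 ≤ a) (hv : 0 ≤ v) (hvC : v ≤ τ * C)
    (hp : p = a ^ 2 + v ^ 2) (hs : s ≤ a + v + b)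
    (hinn : γ * a ^ 2 - 2 * κ * a * v - κ * v ^ 2 ≤ inn) (hcr : cr ≤ C * (E * s)) :
    -inn + cr - μ * C ^ 2 - ν * b ^ 2 ≤
      -(μ - ((2 * κ * τ + E) ^ 2 / (2 * γ) + E ^ 2 / (2 * γ) + κ * τ ^ 2 + E * τ
        + γ * τ ^ 2 / 2)) * C ^ 2 - γ / 2 * (p + b ^ 2) := by
  have h1 : a * v ≤ a * (τ * C) := mul_le_mul_of_nonneg_left hvC ha
  have h2 : v ^ 2 ≤ (τ * C) ^ 2 := pow_le_pow_left₀ hv hvC 2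
  have h3 : C * (E * s) ≤ C * (E * (a + τ * C + b)) := by
    refine mul_le_mul_of_nonneg_left (mul_le_mul_of_nonneg_left ?_ hE) hC
    linarith
  have h4 : (2 * κ * τ + E) * a * C ≤ γ / 2 * a ^ 2 + (2 * κ * τ + E) ^ 2 / (2 * γ) * C ^ 2 := by
    have e : γ / 2 * a ^ 2 + (2 * κ * τ + E) ^ 2 / (2 * γ) * C ^ 2 - (2 * κ * τ + E) * a * C
      = (γ * a - (2 * κ * τ + E) * C) ^ 2 / (2 * γ) := by field_simp; ring
    have : 0 ≤ (γ * a - (2 * κ * τ + E) * C) ^ 2 / (2 * γ) := by positivity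
    linarith
  have h5 : E * b * C ≤ γ / 2 * b ^ 2 + E ^ 2 / (2 * γ) * C ^ 2 := by
    have e : γ / 2 * b ^ 2 + E ^ 2 / (2 * γ) * C ^ 2 - E * b * C
      = (γ * b - E * C) ^ 2 / (2 * γ) := by field_simp; ring
    have : 0 ≤ (γ * b - E * C) ^ 2 / (2 * γ) := by positivity
    linarith
  have h6 : γ * b ^ 2 ≤ ν * b ^ 2 := mul_le_mul_of_nonneg_right hν (sq_nonneg b)
  have h7 : 2 * κ * a * v ≤ 2 * κ * (a * (τ * C)) := by nlinarith
  have h8 : κ * v ^ 2 ≤ κ * (τ * C) ^ 2 := mul_le_mul_of_nonneg_left h2 hκ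
  have h9 : γ / 2 * v ^ 2 ≤ γ / 2 * (τ * C) ^ 2 := mul_le_mul_of_nonneg_left h2 (by positivity)
  subst hp
  nlinarith

/-- For a large penalty parameter the search direction is a descent direction. -/
theorem slope_le (h : NewtonStep G B M cv l Δx Δt Δl γ κB κG κM σ) {ν : ℝ} (hν : γ ≤ ν) (μ : ℝ) :
    ⟪stack (l + ν • M (G l) + μ • ContinuousLinearMap.adjoint G cv)
        (cv + ν • G (ContinuousLinearMap.adjoint G (G l))), stack Δx Δl⟫
      ≤ -(μ - penaltyThreshold γ κB κG κM σ) * ‖cv‖ ^ 2 - γ / 2 * ‖stack Δx (G l)‖ ^ 2 := by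
  have hσ := h.σ_pos
  have hκB := h.κB_nonneg
  have hκG := h.κG_nonneg
  have hκM := h.κM_nonneg
  -- split `Δx` into `u` in the kernel of `G` and `v` in the range of the transpose
  obtain ⟨y, hy⟩ := exists_gram_solution h.σ_pos h.lower (-cv)
  set v := ContinuousLinearMap.adjoint G y with hv
  set u := Δx - v with hu
  have hΔ : Δx = u + v := by rw [hu]; abel
  have hGu : G u = 0 := by rw [hu, map_sub, h.eq_c, hy, sub_self]
  have huv : ⟪u, v⟫ = 0 := by
    rw [hv, ContinuousLinearMap.adjoint_inner_right, hGu, inner_zero_left]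
  have hnv : ‖v‖ ≤ 1 / σ * ‖cv‖ := by
    have h1 : ‖v‖ ^ 2 ≤ ‖y‖ * ‖cv‖ := by
      rw [← real_inner_self_eq_norm_sq]
      nth_rewrite 1 [hv]
      rw [ContinuousLinearMap.adjoint_inner_left, hy]
      refine (real_inner_le_norm _ _).trans_eq (by rw [norm_neg])
    have h2 := h.lower y
    by_cases h0 : ‖v‖ = 0
    · rw [h0]; positivity
    have h0' : 0 < ‖v‖ := lt_of_le_of_ne (norm_nonneg _) (Ne.symm h0)
    rw [div_mul_eq_mul_div, one_mul, le_div_iff₀ hσ]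
    refine le_of_mul_le_mul_left ?_ h0'
    nlinarith [norm_nonneg cv]
  have hp : ‖Δx‖ ^ 2 = ‖u‖ ^ 2 + ‖v‖ ^ 2 := by
    rw [hΔ, norm_add_sq_real, huv]; ring
  have hs : ‖stack Δx (G l)‖ ≤ ‖u‖ + ‖v‖ + ‖G l‖ :=
    (norm_stack_le _ _).trans (by gcongr; rw [hΔ]; exact norm_add_le _ _)
  have hin : γ * ‖u‖ ^ 2 - 2 * κB * ‖u‖ * ‖v‖ - κB * ‖v‖ ^ 2 ≤ ⟪Δx, B Δx⟫ := by
    have e : ⟪Δx, B Δx⟫ = ⟪u, B u⟫ + ⟪u, B v⟫ + ⟪v, B u⟫ + ⟪v, B v⟫ := by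
      rw [hΔ]; simp only [map_add, inner_add_left, inner_add_right]; ring
    have key : ∀ a b : Vec d, -(κB * (‖a‖ * ‖b‖)) ≤ ⟪a, B b⟫ := fun a b => by
      have h1 := abs_real_inner_le_norm a (B b)
      have h2 : ‖a‖ * ‖B b‖ ≤ ‖a‖ * (κB * ‖b‖) :=
        mul_le_mul_of_nonneg_left (h.norm_B_apply b) (norm_nonneg a)
      have h3 := neg_abs_le ⟪a, B b⟫
      nlinarith
    have h1 := h.coercive u hGu
    have h2 := key u v
    have h3 := key v u
    have h4 := key v v
    rw [e]
    nlinarith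
  have hcr : ⟪cv, Δt + Δl⟫ ≤ ‖cv‖ * (((κG * κB + 1) / σ ^ 2 + (1 + κM) / σ ^ 2)
      * ‖stack Δx (G l)‖) := by
    refine (real_inner_le_norm _ _).trans ?_
    gcongr
    refine (norm_add_le _ _).trans ?_
    rw [add_mul]
    exact add_le_add h.norm_Δt_le h.norm_Δl_le
  have := slope_bound_aux (μ := μ) h.γ_pos hν h.κB_nonneg (by positivity) (norm_nonneg cv)
    (norm_nonneg u) (norm_nonneg v) hnv hp hs hin hcr
  rw [h.slope_eq, norm_stack_sq, penaltyThreshold]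
  exact this

/-- A sufficiently negative slope forces a gradient that dominates the constraint violation. -/
theorem norm_c_le_of_slope_le {g D : Pair d m} {s C T Υ γ : ℝ} (hγ : 0 < γ) (hs : 0 < s)
    (hΥ : 0 < Υ) (hD : ‖D‖ ≤ Υ * s) (hT : Υ ^ 2 / (2 * γ) ≤ T)
    (h : ⟪g, D⟫ ≤ -T * C ^ 2 - γ / 2 * s ^ 2) : C ≤ ‖g‖ := by
  have h1 : -(‖g‖ * ‖D‖) ≤ ⟪g, D⟫ := (abs_le.1 (abs_real_inner_le_norm g D)).1
  have h2 : ‖g‖ * ‖D‖ ≤ ‖g‖ * (Υ * s) := mul_le_mul_of_nonneg_left hD (norm_nonneg g)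
  have h3 : Υ ^ 2 / (2 * γ) * C ^ 2 ≤ T * C ^ 2 := mul_le_mul_of_nonneg_right hT (sq_nonneg C)
  have h4 : C * (Υ * s) ≤ Υ ^ 2 / (2 * γ) * C ^ 2 + γ / 2 * s ^ 2 := by
    have e : Υ ^ 2 / (2 * γ) * C ^ 2 + γ / 2 * s ^ 2 - C * (Υ * s)
      = (Υ * C - γ * s) ^ 2 / (2 * γ) := by field_simp; ring
    have : 0 ≤ (Υ * C - γ * s) ^ 2 / (2 * γ) := by positivity
    linarith
  refine le_of_mul_le_mul_right (a := Υ * s) ?_ (by positivity)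
  linarith

end NewtonStep

end LinearAlgebra

/-! ### Existence of the constants -/

theorem norm_batchMean_sub_le {Ξ V : Type*} [NormedAddCommGroup V] [NormedSpace ℝ V]
    {b : Batch Ξ} (hb : 1 ≤ b.1) {h : Ξ → V} {a : V} {M : ℝ} (hM : ∀ ζ, ‖h ζ - a‖ ≤ M) :
    ‖batchMean b h - a‖ ≤ M := by
  have hn : (0 : ℝ) < b.1 := by exact_mod_cast hb
  have e : batchMean b h - a = (b.1 : ℝ)⁻¹ • ∑ i, (h (b.2 i) - a) := by
    rw [batchMean, Finset.sum_sub_distrib, smul_sub, Finset.sum_const, Finset.card_univ,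
      Fintype.card_fin, ← Nat.cast_smul_eq_nsmul ℝ, smul_smul, inv_mul_cancel₀ hn.ne', one_smul]
  rw [e, norm_smul, norm_inv, Real.norm_of_nonneg hn.le, inv_mul_le_iff₀ hn]
  refine (norm_sum_le _ _).trans ((Finset.sum_le_sum fun i _ => hM (b.2 i)).trans_eq ?_)
  simp

section Run

variable {d m : ℕ} {Ξ Ω : Type*} [MeasurableSpace Ξ] [MeasurableSpace Ω] {P : Measure Ω}
  {Q : Problem d m Ξ} {θ : Params} {r : Trajectory d m Ξ Ω}
  {X : Set (Vec d)} {Lam : Set (Vec m)} {κB M₀ M₁ M₂ : ℝ}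

namespace Params.Valid

theorem ρ_pos (hθ : θ.Valid) : 0 < θ.ρ := zero_lt_one.trans hθ.ρ_gt_one

theorem ν_pos (hθ : θ.Valid) : 0 < θ.ν := hθ.γ_pos.trans_le hθ.γ_le_ν

end Params.Valid

namespace Standing

theorem contDiffAt_f (hst : Standing Q θ r X Lam κB M₀ M₁ M₂) :
    ∀ x ∈ X, ContDiffAt ℝ 3 Q.f x := by
  obtain ⟨U, hU, hXU, hf, -⟩ := hst.smooth
  exact fun x hx => hf.contDiffAt (hU.mem_nhds (hXU hx))

theorem contDiffAt_c (hst : Standing Q θ r X Lam κB M₀ M₁ M₂) :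
    ∀ x ∈ X, ContDiffAt ℝ 3 Q.c x := by
  obtain ⟨U, hU, hXU, -, hc, -⟩ := hst.smooth
  exact fun x hx => hc.contDiffAt (hU.mem_nhds (hXU hx))

end Standing

namespace IsRun

theorem one_le_size_g (h : IsRun Q θ P r) (k : ℕ) (ω : Ω) : 1 ≤ (r.ξg k ω).1 := by
  induction k with
  | zero => exact h.size_g_zero ω
  | succ k ih => exact (Nat.le_succ_of_le ih).trans (h.size_g_succ k ω)

theorem α_pos (hθ : θ.Valid) (h : IsRun Q θ P r) (k : ℕ) (ω : Ω) : 0 < r.α k ω := by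
  induction k with
  | zero => rw [h.α_zero]; exact hθ.αmax_pos
  | succ k ih =>
    by_cases hA : Armijo Q θ r k ω
    · rw [(h.successful k ω hA).2]
      exact lt_min hθ.αmax_pos (mul_pos hθ.ρ_pos ih)
    · rw [(h.unsuccessful k ω hA).2.1]
      exact div_pos ih hθ.ρ_pos

theorem α_le (hθ : θ.Valid) (h : IsRun Q θ P r) (k : ℕ) (ω : Ω) : r.α k ω ≤ θ.αmax := by
  induction k with
  | zero => exact (h.α_zero ω).le
  | succ k ih =>
    by_cases hA : Armijo Q θ r k ω
    · rw [(h.successful k ω hA).2]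
      exact min_le_left _ _
    · rw [(h.unsuccessful k ω hA).2.1]
      exact (div_le_self (h.α_pos hθ k ω).le hθ.ρ_gt_one.le).trans ih

theorem ε_succ (h : IsRun Q θ P r) (k : ℕ) (ω : Ω) :
    r.ε (k + 1) ω = θ.ρ * r.ε k ω ∨ r.ε (k + 1) ω = r.ε k ω / θ.ρ := by
  by_cases hA : Armijo Q θ r k ω
  · by_cases hR : Reliable Q θ r k ω
    · exact Or.inl (h.reliable k ω hA hR)
    · exact Or.inr (h.unreliable k ω hA hR)
  · exact Or.inr (h.unsuccessful k ω hA).2.2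

theorem ε_mem (hθ : θ.Valid) (h : IsRun Q θ P r) (k : ℕ) :
    ∃ a > 0, ∃ b, ∀ ω, a ≤ r.ε k ω ∧ r.ε k ω ≤ b := by
  induction k with
  | zero => exact ⟨θ.ε₀, hθ.ε₀_pos, θ.ε₀, fun ω => by rw [h.ε_zero]; exact ⟨le_rfl, le_rfl⟩⟩
  | succ k ih =>
    obtain ⟨a, ha, b, hb⟩ := ih
    have hρ := hθ.ρ_pos
    refine ⟨a / θ.ρ, by positivity, θ.ρ * b, fun ω => ?_⟩
    obtain ⟨h1, h2⟩ := hb ω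
    have h3 : r.ε k ω / θ.ρ ≤ r.ε k ω := div_le_self (ha.le.trans h1) hθ.ρ_gt_one.le
    have h4 : r.ε k ω ≤ θ.ρ * r.ε k ω :=
      le_mul_of_one_le_left (ha.le.trans h1) hθ.ρ_gt_one.le
    have h5 : a / θ.ρ ≤ r.ε k ω / θ.ρ := by gcongr
    have h6 : θ.ρ * r.ε k ω ≤ θ.ρ * b := by gcongr
    rcases h.ε_succ k ω with e | e <;> rw [e] <;> constructor <;> linarith

theorem ε_pos (hθ : θ.Valid) (h : IsRun Q θ P r) (k : ℕ) (ω : Ω) : 0 < r.ε k ω := by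
  obtain ⟨a, ha, b, hb⟩ := h.ε_mem hθ k
  exact ha.trans_le (hb ω).1

theorem μ_pos (hθ : θ.Valid) (h : IsRun Q θ P r) (k : ℕ) (ω : Ω) :
    0 < r.μStart θ k ω ∧ 0 < r.μ k ω := by
  have step : ∀ k, 0 < r.μStart θ k ω → 0 < r.μ k ω := fun k hk => by
    obtain ⟨j, hj, -⟩ := h.penalty k ω
    rw [hj]
    exact mul_pos (pow_pos hθ.ρ_pos j) hk
  induction k with
  | zero => exact ⟨hθ.μ₀_pos, step 0 hθ.μ₀_pos⟩
  | succ k ih => exact ⟨ih.2, step (k + 1) ih.2⟩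

/-- If every large penalty parameter is accepted, then the penalty parameters are bounded. -/
theorem μ_le (hθ : θ.Valid) (h : IsRun Q θ P r) {T : ℝ}
    (hT : ∀ k ω μ, T ≤ μ → PenaltyOK Q θ r k ω μ) (k : ℕ) (ω : Ω) :
    r.μ k ω ≤ max θ.μ₀ (θ.ρ * T) := by
  have step : ∀ k, r.μStart θ k ω ≤ max θ.μ₀ (θ.ρ * T) → r.μ k ω ≤ max θ.μ₀ (θ.ρ * T) :=
      fun k hk => by
    obtain ⟨j, hj, -, hn⟩ := h.penalty k ω
    cases j with
    | zero => rw [hj]; simpa using hk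
    | succ j =>
      -- the last rejected value lies below the threshold
      have h1 : θ.ρ ^ j * r.μStart θ k ω < T := by
        by_contra hlt
        exact hn j (Nat.lt_succ_self j) (hT k ω _ (not_lt.1 hlt))
      rw [hj, pow_succ']
      refine le_max_of_le_right ?_
      rw [mul_assoc]
      exact mul_le_mul_of_nonneg_left h1.le hθ.ρ_pos.le
  induction k with
  | zero => exact step 0 (le_max_left _ _)
  | succ k ih => exact step (k + 1) ih

end IsRun

/-- All search directions of a run solve Newton systems with common bounds on the data: the noise is
bounded, and the iterates stay in a compact region. -/
theorem exists_newtonStep (hθ : θ.Valid) (hrun : IsRun Q θ P r)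
    (hst : Standing Q θ r X Lam κB M₀ M₁ M₂) :
    ∃ κG κM σ : ℝ, ∀ k ω, NewtonStep (jac Q.c (r.x k ω)) (r.B k ω) (mBar Q r k ω)
      (Q.c (r.x k ω)) (lagGradBar Q r k ω) (r.Δx k ω) (r.Δt k ω) (r.Δlam k ω) θ.γ κB κG κM σ := by
  have hf := hst.contDiffAt_f
  have hc := hst.contDiffAt_c
  obtain ⟨κG, -, hκG⟩ := exists_pos_bound hst.compact_X (g := jac Q.c) fun x hx =>
    (contDiffAt_jac (p := 2) (q := 3) (hc x hx) (by norm_num)).continuousAt.continuousWithinAt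
  obtain ⟨C₁, -, hC₁⟩ := exists_pos_bound hst.compact_X (g := gradient Q.f) fun x hx =>
    (ContDiffAt.gradient (p := 2) (q := 3) (hf x hx)
      (by norm_num)).continuousAt.continuousWithinAt
  obtain ⟨C₂, -, hC₂⟩ := exists_pos_bound hst.compact_X (g := hess Q.f) fun x hx =>
    (continuousAt_hess ((hf x hx).of_le (by norm_num))).continuousWithinAt
  obtain ⟨σ, hσ, hlow⟩ := exists_jacT_lower_bound hst.compact_X hc hst.full_rank
  obtain ⟨κM, -, hκM⟩ :=
    exists_matM_bound hst.compact_X hst.compact_Lam hc (M₁ + C₁) (M₂ + C₂)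
  refine ⟨κG, κM, σ, fun k ω => ?_⟩
  have hx := hst.mem_X k ω
  refine ⟨hrun.newton_x k ω, hrun.newton_c k ω, hrun.newton_lam k ω, hσ, hθ.γ_pos, hlow _ hx,
    hst.B_pos k ω, hst.B_bound k ω, hκG _ hx, hκM _ _ _ _ ?_ ?_ hx (hst.mem_Lam k ω)⟩
  · have h1 := norm_batchMean_sub_le (hrun.one_le_size_g k ω)
      (fun ζ => hst.noise_grad ζ _ hx)
    have h2 := norm_add_le (gBar Q r k ω - gradient Q.f (r.x k ω)) (gradient Q.f (r.x k ω))
    rw [sub_add_cancel] at h2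
    exact h2.trans (add_le_add h1 (hC₁ _ hx))
  · have h1 := norm_batchMean_sub_le (hrun.one_le_size_g k ω)
      (fun ζ => hst.noise_hess ζ _ hx)
    have h2 := norm_add_le (hBar Q r k ω - hess Q.f (r.x k ω)) (hess Q.f (r.x k ω))
    rw [sub_add_cancel] at h2
    exact h2.trans (add_le_add h1 (hC₂ _ hx))

/-- A vanishing `(Δx; G ∇ₓL)` would make the whole search direction vanish. -/
theorem norm_pos_of_dir_le {D s : Pair d m} {Υ : ℝ} (hD : 0 < ‖D‖) (h : ‖D‖ ≤ Υ * ‖s‖) :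
    0 < ‖s‖ := by
  refine lt_of_le_of_ne (norm_nonneg _) fun h0 => ?_
  rw [← h0, mul_zero] at h
  exact absurd hD h.not_gt

theorem exists_constants (hθ : θ.Valid) (hrun : IsRun Q θ P r)
    (hst : Standing Q θ r X Lam κB M₀ M₁ M₂) : ∃ C : Constants, C.Valid Q θ r X Lam := by
  obtain ⟨κG, κM, σ, hN⟩ := exists_newtonStep hθ hrun hst
  obtain ⟨κν, hκν, hess_le⟩ := exists_hessian_bound hst.compact_X hst.compact_Lam θ.ν
    hst.contDiffAt_f hst.contDiffAt_c
  -- without sample points there is nothing to bound, and the signs of the bounds are unknown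
  rcases isEmpty_or_nonempty Ω with hΩ | ⟨⟨ω₀⟩⟩
  · exact ⟨⟨1, κν, 1, 1, 1⟩, one_pos, hκν, one_pos, one_pos, one_pos,
      fun _ ω => isEmptyElim ω, hess_le, fun _ ω => isEmptyElim ω, fun _ ω => isEmptyElim ω,
      fun _ ω => isEmptyElim ω⟩
  have hσ := (hN 0 ω₀).σ_pos
  have hκB := (hN 0 ω₀).κB_nonneg
  have hκG := (hN 0 ω₀).κG_nonneg
  have hκM := (hN 0 ω₀).κM_nonneg
  have hν := hθ.ν_pos
  set Υ₃ : ℝ := 1 + (1 + κM) / σ ^ 2 with hΥ₃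
  have hΥ₃pos : 0 < Υ₃ := by positivity
  set L : ℝ := κB + κG * ((κG * κB + 1) / σ ^ 2)
  have hL : 0 ≤ L := by positivity
  have hdir : ∀ k ω, ‖r.dir k ω‖ ≤ Υ₃ * ‖stepVec Q r k ω‖ := fun k ω => (hN k ω).norm_dir_le
  -- both requirements on the penalty parameter hold beyond a common threshold
  have hT : ∀ k ω μ, penaltyThreshold θ.γ κB κG κM σ + Υ₃ ^ 2 / (2 * θ.γ) ≤ μ →
      PenaltyOK Q θ r k ω μ := fun k ω μ hμ => by
    have h1 := (hN k ω).slope_le hθ.γ_le_ν μ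
    have h2 : 0 ≤ Υ₃ ^ 2 / (2 * θ.γ) := by have := hθ.γ_pos; positivity
    have h3 : 0 ≤ (μ - penaltyThreshold θ.γ κB κG κM σ) * ‖Q.c (r.x k ω)‖ ^ 2 :=
      mul_nonneg (by linarith) (sq_nonneg _)
    refine ⟨?_, ?_⟩
    · refine h1.trans ?_
      rw [stepVec]
      linarith
    · exact NewtonStep.norm_c_le_of_slope_le hθ.γ_pos
        (norm_pos_of_dir_le (hst.dir_ne_zero k ω) (hdir k ω)) hΥ₃pos (hdir k ω)
        (by linarith) h1
  set μt := max θ.μ₀ (θ.ρ * (penaltyThreshold θ.γ κB κG κM σ + Υ₃ ^ 2 / (2 * θ.γ))) with hμt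
  have hμt_pos : 0 < μt := hθ.μ₀_pos.trans_le (le_max_left _ _)
  have hμle : ∀ k ω, r.μ k ω ≤ μt := fun k ω => hrun.μ_le hθ hT k ω
  -- common estimates of the blocks of `refVec` and `augGradBar`
  have hMb : ∀ k ω, ‖θ.ν • mBar Q r k ω (jac Q.c (r.x k ω) (lagGradBar Q r k ω))‖
      ≤ θ.ν * κM * ‖stepVec Q r k ω‖ := fun k ω => by
    rw [norm_smul, Real.norm_of_nonneg hν.le, mul_assoc]
    refine mul_le_mul_of_nonneg_left (((hN k ω).norm_M_apply _).trans ?_) hν.le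
    exact mul_le_mul_of_nonneg_left (norm_snd_le_stack _ _) hκM
  have hGc : ∀ k ω, ‖jacT Q.c (r.x k ω) (Q.c (r.x k ω))‖ ≤ κG ^ 2 * ‖stepVec Q r k ω‖ :=
    fun k ω => by
    refine ((hN k ω).norm_GT_apply _).trans ?_
    rw [pow_two, mul_assoc]
    exact mul_le_mul_of_nonneg_left (hN k ω).norm_c_le hκG
  have hGG : ∀ k ω, ‖θ.ν • jac Q.c (r.x k ω) (jacT Q.c (r.x k ω)
      (jac Q.c (r.x k ω) (lagGradBar Q r k ω)))‖ ≤ θ.ν * κG ^ 2 * ‖stepVec Q r k ω‖ :=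
    fun k ω => by
    rw [norm_smul, Real.norm_of_nonneg hν.le, mul_assoc]
    refine mul_le_mul_of_nonneg_left (((hN k ω).norm_G_apply _).trans ?_) hν.le
    rw [pow_two, mul_assoc]
    refine mul_le_mul_of_nonneg_left (((hN k ω).norm_GT_apply _).trans ?_) hκG
    exact mul_le_mul_of_nonneg_left (norm_snd_le_stack _ _) hκG
  refine ⟨⟨μt, κν, L + θ.ν * κM + κG ^ 2 + θ.ν * κG ^ 2 + 1, Υ₃,
    L + θ.ν * κM + μt * κG ^ 2 + κG + θ.ν * κG ^ 2 + 1⟩, hμt_pos, hκν, by positivity, hΥ₃pos,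
    by positivity, hμle, hess_le, fun k ω => ?_, hdir, fun k ω => ?_⟩
  · refine (norm_stack_le _ _).trans ?_
    have h1 := (hN k ω).norm_l_le
    have h2 := norm_add_le (lagGradBar Q r k ω
      + θ.ν • mBar Q r k ω (jac Q.c (r.x k ω) (lagGradBar Q r k ω)))
      (jacT Q.c (r.x k ω) (Q.c (r.x k ω)))
    have h3 := norm_add_le (lagGradBar Q r k ω)
      (θ.ν • mBar Q r k ω (jac Q.c (r.x k ω) (lagGradBar Q r k ω)))
    have h4 := hMb k ω
    have h5 := hGc k ω
    have h6 := hGG k ω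
    have h7 := norm_nonneg (stepVec Q r k ω)
    change ‖lagGradBar Q r k ω‖ ≤ L * ‖stepVec Q r k ω‖ at h1
    linarith
  · refine (norm_stack_le _ _).trans ?_
    change ‖lagGradBar Q r k ω + θ.ν • mBar Q r k ω (jac Q.c (r.x k ω) (lagGradBar Q r k ω))
      + r.μ k ω • jacT Q.c (r.x k ω) (Q.c (r.x k ω))‖ + ‖Q.c (r.x k ω)
      + θ.ν • jac Q.c (r.x k ω) (jacT Q.c (r.x k ω)
        (jac Q.c (r.x k ω) (lagGradBar Q r k ω)))‖ ≤ _
    have h1 := (hN k ω).norm_l_le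
    have h2 := norm_add_le (lagGradBar Q r k ω
      + θ.ν • mBar Q r k ω (jac Q.c (r.x k ω) (lagGradBar Q r k ω)))
      (r.μ k ω • jacT Q.c (r.x k ω) (Q.c (r.x k ω)))
    have h3 := norm_add_le (lagGradBar Q r k ω)
      (θ.ν • mBar Q r k ω (jac Q.c (r.x k ω) (lagGradBar Q r k ω)))
    have h4 := hMb k ω
    have h5 : ‖r.μ k ω • jacT Q.c (r.x k ω) (Q.c (r.x k ω))‖
        ≤ μt * (κG ^ 2 * ‖stepVec Q r k ω‖) := by
      rw [norm_smul, Real.norm_of_nonneg (hrun.μ_pos hθ k ω).2.le]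
      exact mul_le_mul (hμle k ω) (hGc k ω) (norm_nonneg _) hμt_pos.le
    have h6 := hGG k ω
    have h7 := norm_nonneg (stepVec Q r k ω)
    have h8 := norm_add_le (Q.c (r.x k ω)) (θ.ν • jac Q.c (r.x k ω) (jacT Q.c (r.x k ω)
      (jac Q.c (r.x k ω) (lagGradBar Q r k ω))))
    have h9 : ‖Q.c (r.x k ω)‖ ≤ κG * ‖stepVec Q r k ω‖ := (hN k ω).norm_c_le
    change ‖lagGradBar Q r k ω‖ ≤ L * ‖stepVec Q r k ω‖ at h1
    linarith

end Run

/-! ### The pathwise change of the Lyapunov function -/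

/-- Accepted steps: the decrease `α β q / 2` of the augmented Lagrangian pays, one half each, for
the growth of `ε` after a reliable step and for the growth of the gradient term. The latter is
controlled by `s` if the gradient `D` is (accurate estimates), and costs a multiple of `α D²`
otherwise. -/
theorem accepted_step_bound {w ρ β γ Υ α ε D D' q s Ld e ε' α' i : ℝ} (hw0 : 0 < w) (hw1 : w < 1)
    (hρ : 1 < ρ) (hα : 0 < α) (hε : 0 < ε) (hβ : 0 < β) (hq : q ≤ -(γ / 2) * s ^ 2)
    (hL : Ld ≤ 1 / 2 * (α * β * q) + e)
    (h1 : 32 * ρ * Υ ^ 2 * (1 - w) ≤ w * (β * γ)) (h2 : 4 * (ρ - 1) * (1 - w) ≤ w)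
    (hD0 : 0 ≤ D') (hD' : D' ≤ D + Υ * s) (hα' : α' ≤ ρ * α)
    (hε' : ε' = ρ * ε ∧ ε ≤ -(α * β * q) ∨ ε' = ε / ρ)
    (hi : 0 ≤ D ∧ D ≤ Υ * s ∧ i = 0 ∨ i = 1) :
    w * Ld + (1 - w) / 2 * (ε' - ε) + (1 - w) / 2 * (α' * D' ^ 2 - α * D ^ 2)
      ≤ -((1 - w) / 2 * (1 - 1 / ρ) * (ε + α * D ^ 2)) + w * e
        + i * ((1 - w) * ρ * (α * D ^ 2)) := by
  have hρ0 : 0 < ρ := by linarith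
  have hv : 0 < 1 - w := by linarith
  have hρi : 0 < 1 / ρ := by positivity
  have hρi1 : 1 / ρ ≤ 1 := by rw [div_le_one hρ0]; exact hρ.le
  have hαβ : 0 < α * β := by positivity
  -- the half of the decrease that pays for the gradient term
  have hS : w * (1 / 4 * (α * β * q)) ≤ -(4 * ρ * Υ ^ 2 * (1 - w) * (α * s ^ 2)) := by
    have a1 : α * β * q ≤ α * β * (-(γ / 2) * s ^ 2) := mul_le_mul_of_nonneg_left hq hαβ.le
    have a2 : w * (α * β * q) ≤ w * (α * β * (-(γ / 2) * s ^ 2)) :=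
      mul_le_mul_of_nonneg_left a1 hw0.le
    have a3 := mul_le_mul_of_nonneg_right h1 (by positivity : 0 ≤ α * s ^ 2)
    nlinarith
  have hqneg : w * (1 / 4 * (α * β * q)) ≤ 0 := hS.trans (by
    have : 0 ≤ 4 * ρ * Υ ^ 2 * (1 - w) * (α * s ^ 2) := by positivity
    linarith)
  have hE : w * (1 / 4 * (α * β * q)) + (1 - w) / 2 * (ε' - ε)
      ≤ -((1 - w) / 2 * (1 - 1 / ρ) * ε) := by
    rcases hε' with ⟨rfl, hrel⟩ | rfl
    · have a1 : w * (α * β * q) ≤ w * (-ε) := mul_le_mul_of_nonneg_left (by linarith) hw0.le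
      have a2 := mul_le_mul_of_nonneg_right h2 hε.le
      have a3 : 1 - 1 / ρ ≤ ρ - 1 := by
        have : ρ + 1 / ρ - 2 = (ρ - 1) ^ 2 / ρ := by field_simp; ring
        have : 0 ≤ (ρ - 1) ^ 2 / ρ := by positivity
        linarith
      have a4 : (1 - w) / 2 * (1 - 1 / ρ) * ε ≤ (1 - w) / 2 * (ρ - 1) * ε := by gcongr
      nlinarith
    · have : ε / ρ = 1 / ρ * ε := by ring
      rw [this]
      linarith
  have hαD : 0 ≤ α * D ^ 2 := by positivity
  have hG : (1 - w) / 2 * (1 - 1 / ρ) * (α * D ^ 2) ≤ (1 - w) / 2 * (α * D ^ 2) := by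
    have : (1 - w) / 2 * (1 - 1 / ρ) ≤ (1 - w) / 2 := by nlinarith
    exact mul_le_mul_of_nonneg_right this hαD
  have hA' : α' * D' ^ 2 ≤ ρ * α * D' ^ 2 := mul_le_mul_of_nonneg_right hα' (sq_nonneg _)
  have hDsq : D' ^ 2 ≤ (D + Υ * s) ^ 2 := pow_le_pow_left₀ hD0 hD' 2
  have hρα : 0 < ρ * α := by positivity
  have hwL : w * Ld ≤ w * (1 / 2 * (α * β * q) + e) := mul_le_mul_of_nonneg_left hL hw0.le
  have hX : 0 ≤ ρ * α * (Υ * s) ^ 2 := by positivity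
  rcases hi with ⟨hDn, hDs, rfl⟩ | rfl
  · have b1 : D' ^ 2 ≤ 4 * (Υ * s) ^ 2 :=
      (pow_le_pow_left₀ hD0 (by linarith : D' ≤ 2 * (Υ * s)) 2).trans_eq (by ring)
    have b2 : ρ * α * D' ^ 2 ≤ ρ * α * (4 * (Υ * s) ^ 2) := mul_le_mul_of_nonneg_left b1 hρα.le
    have b3 : (1 - w) / 2 * (α' * D' ^ 2) ≤ (1 - w) / 2 * (ρ * α * (4 * (Υ * s) ^ 2)) :=
      mul_le_mul_of_nonneg_left (hA'.trans b2) (by positivity)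
    have b4 : 0 ≤ (1 - w) * (ρ * α * (Υ * s) ^ 2) := by positivity
    linarith
  · have b1 : D' ^ 2 ≤ 2 * D ^ 2 + 2 * (Υ * s) ^ 2 := by nlinarith [sq_nonneg (D - Υ * s)]
    have b2 : ρ * α * D' ^ 2 ≤ ρ * α * (2 * D ^ 2 + 2 * (Υ * s) ^ 2) :=
      mul_le_mul_of_nonneg_left b1 hρα.le
    have b3 : (1 - w) / 2 * (α' * D' ^ 2)
        ≤ (1 - w) / 2 * (ρ * α * (2 * D ^ 2 + 2 * (Υ * s) ^ 2)) :=
      mul_le_mul_of_nonneg_left (hA'.trans b2) (by positivity)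
    have b4 : 0 ≤ (1 - w) * (ρ * α * (Υ * s) ^ 2) := by positivity
    linarith

section Run

variable {d m : ℕ} {Ξ Ω : Type*} [MeasurableSpace Ξ] [MeasurableSpace Ω] {P : Measure Ω}
  {Q : Problem d m Ξ} {θ : Params} {r : Trajectory d m Ξ Ω}
  {X : Set (Vec d)} {Lam : Set (Vec m)} {κB M₀ M₁ M₂ : ℝ}

/-- The exact gradient of the augmented Lagrangian at the `k`-th iterate, by its formula. -/
def augGradTrue (Q : Problem d m Ξ) (θ : Params) (r : Trajectory d m Ξ Ω) (k : ℕ) (ω : Ω)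
    (μ : ℝ) : Pair d m :=
  augGradFormula Q.c μ θ.ν (gradient Q.f (r.x k ω)) (hess Q.f (r.x k ω)) (r.x k ω) (r.lam k ω)

theorem Standing.gradient_augLag (hst : Standing Q θ r X Lam κB M₀ M₁ M₂) (k : ℕ) (ω : Ω)
    (μ : ℝ) : gradient (augLag Q.f Q.c μ θ.ν) (r.z k ω) = augGradTrue Q θ r k ω μ :=
  StoSQP.gradient_augLag μ θ.ν (hst.contDiffAt_f _ (hst.mem_X k ω))
    (hst.contDiffAt_c _ (hst.mem_X k ω))

/-- The error of the gradient estimate does not depend on the penalty parameter. -/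
theorem augGradBar_eq_add (k : ℕ) (ω : Ω) (μ : ℝ) :
    augGradBar Q θ r k ω μ = augGradTrue Q θ r k ω μ + errVec Q θ r k ω := by
  have hl : lagGradBar Q r k ω
      = lagGradTrue Q r k ω + (gBar Q r k ω - gradient Q.f (r.x k ω)) := by
    rw [lagGradBar, lagGradTrue, lagGrad, lagGrad]; abel
  have h1 : (augGradTrue Q θ r k ω μ).fst + (errVec Q θ r k ω).fst
      = (augGradBar Q θ r k ω μ).fst := by
    change lagGradTrue Q r k ω + θ.ν • mTrue Q r k ω (jac Q.c (r.x k ω) (lagGradTrue Q r k ω))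
        + μ • jacT Q.c (r.x k ω) (Q.c (r.x k ω))
      + (gBar Q r k ω - gradient Q.f (r.x k ω)
        + θ.ν • (mBar Q r k ω (jac Q.c (r.x k ω) (lagGradBar Q r k ω))
          - mTrue Q r k ω (jac Q.c (r.x k ω) (lagGradTrue Q r k ω))))
      = lagGradBar Q r k ω + θ.ν • mBar Q r k ω (jac Q.c (r.x k ω) (lagGradBar Q r k ω))
        + μ • jacT Q.c (r.x k ω) (Q.c (r.x k ω))
    have e : gBar Q r k ω - gradient Q.f (r.x k ω)
        = lagGradBar Q r k ω - lagGradTrue Q r k ω := by rw [hl]; abel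
    rw [smul_sub, e]
    abel
  have h2 : (augGradTrue Q θ r k ω μ).snd + (errVec Q θ r k ω).snd
      = (augGradBar Q θ r k ω μ).snd := by
    change Q.c (r.x k ω) + θ.ν • jac Q.c (r.x k ω) (jacT Q.c (r.x k ω)
        (jac Q.c (r.x k ω) (lagGradTrue Q r k ω)))
      + θ.ν • jac Q.c (r.x k ω) (jacT Q.c (r.x k ω)
        (jac Q.c (r.x k ω) (gBar Q r k ω - gradient Q.f (r.x k ω))))
      = Q.c (r.x k ω) + θ.ν • jac Q.c (r.x k ω) (jacT Q.c (r.x k ω)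
        (jac Q.c (r.x k ω) (lagGradBar Q r k ω)))
    rw [hl]
    simp only [map_add, smul_add]
    abel
  exact (WithLp.ofLp_injective 2 (Prod.ext h1 h2)).symm

/-- The sum of the two errors of the estimated merit function. -/
def meritError (Q : Problem d m Ξ) (θ : Params) (r : Trajectory d m Ξ Ω) (k : ℕ) (ω : Ω) : ℝ :=
  |augBar Q θ r k ω (r.z k ω) - augTrue Q θ r k ω (r.z k ω)|
    + |augBar Q θ r k ω (r.trial k ω) - augTrue Q θ r k ω (r.trial k ω)|

theorem IsRun.penaltyOK (hrun : IsRun Q θ P r) (k : ℕ) (ω : Ω) :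
    PenaltyOK Q θ r k ω (r.μ k ω) := by
  obtain ⟨j, -, h, -⟩ := hrun.penalty k ω
  exact h

theorem IsRun.slope_nonpos (hθ : θ.Valid) (hrun : IsRun Q θ P r) (k : ℕ) (ω : Ω) :
    slope Q θ r k ω (r.μ k ω) ≤ 0 := by
  refine (hrun.penaltyOK k ω).1.trans ?_
  have := mul_nonneg hθ.γ_pos.le (sq_nonneg ‖stepVec Q r k ω‖)
  linarith

/-- An accepted step decreases the exact augmented Lagrangian by half of the predicted amount, up to
the estimation errors on the event that these are large. -/
theorem augTrue_trial_sub_le (hθ : θ.Valid) (hrun : IsRun Q θ P r) (k : ℕ) (ω : Ω)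
    (hA : Armijo Q θ r k ω) :
    augTrue Q θ r k ω (r.trial k ω) - augTrue Q θ r k ω (r.z k ω)
      ≤ 1 / 2 * (r.α k ω * θ.β * slope Q θ r k ω (r.μ k ω))
        + (eventB Q θ r k)ᶜ.indicator (fun _ => (1 : ℝ)) ω * meritError Q θ r k ω := by
  have hα := hrun.α_pos hθ k ω
  have hq := hrun.slope_nonpos hθ k ω
  set q := slope Q θ r k ω (r.μ k ω)
  have hβ := hθ.β_mem.1
  rw [Armijo] at hA
  have e1 := neg_abs_le (augBar Q θ r k ω (r.trial k ω) - augTrue Q θ r k ω (r.trial k ω))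
  have e2 := le_abs_self (augBar Q θ r k ω (r.z k ω) - augTrue Q θ r k ω (r.z k ω))
  have hαβq : r.α k ω * θ.β * q ≤ 0 := mul_nonpos_of_nonneg_of_nonpos (by positivity) hq
  by_cases hB : ω ∈ eventB Q θ r k
  · have hB' : max _ _ ≤ -θ.κf * r.α k ω ^ 2 * q := hB
    obtain ⟨b1, b2⟩ := max_le_iff.1 hB'
    rw [Set.indicator_of_notMem (by simpa using hB), zero_mul, add_zero]
    have hκ : θ.κf * r.α k ω ≤ θ.β / 4 := by
      have h1 := hθ.κf_mem.2
      rw [lt_div_iff₀ (by have := hθ.αmax_pos; positivity)] at h1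
      have h2 := mul_le_mul_of_nonneg_left (hrun.α_le hθ k ω) hθ.κf_mem.1.le
      linarith
    have h3 : θ.κf * r.α k ω * (r.α k ω * -q) ≤ θ.β / 4 * (r.α k ω * -q) :=
      mul_le_mul_of_nonneg_right hκ (mul_nonneg hα.le (by linarith))
    nlinarith
  · rw [Set.indicator_of_mem (by simpa using hB), one_mul, meritError]
    linarith

theorem WeightCond.bounds {C : Constants} {c : Vec d → Vec m} {w : ℝ} (hθ : θ.Valid)
    (hw : w ∈ Set.Ioo (0 : ℝ) 1) (h : WeightCond C c θ X w) :
    32 * θ.ρ * (max (C.κL c X C.μt * θ.αmax * C.Υ₃) (θ.κgrad * θ.αmax * C.Υ₁ + C.Υ₄)) ^ 2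
        * (1 - w) ≤ w * (θ.β * θ.γ) ∧ 4 * (θ.ρ - 1) * (1 - w) ≤ w := by
  have hv : 0 < 1 - w := by linarith [hw.2]
  have hβγ : 0 < θ.β * θ.γ := mul_pos hθ.β_mem.1 hθ.γ_pos
  obtain ⟨h1, h2⟩ := max_le_iff.1 h
  rw [div_le_div_iff₀ hβγ hv] at h1
  rw [le_div_iff₀ hv] at h2
  exact ⟨h1, h2⟩

/-- The change of the Lyapunov function in one iteration, along every sample path, with the penalty
parameter of that iteration: a guaranteed decrease, up to contributions of the events that the
merit function or the gradient is estimated poorly. -/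
theorem lyapunov_succ_sub_le (hθ : θ.Valid) (hrun : IsRun Q θ P r)
    (hst : Standing Q θ r X Lam κB M₀ M₁ M₂) {C : Constants} (hC : C.Valid Q θ r X Lam) {w : ℝ}
    (hw : w ∈ Set.Ioo (0 : ℝ) 1) (hwc : WeightCond C Q.c θ X w) (k : ℕ) (ω : Ω) :
    lyapunov Q θ r w (r.μ k ω) (k + 1) ω - lyapunov Q θ r w (r.μ k ω) k ω
      ≤ -((1 - w) / 2 * (1 - 1 / θ.ρ)
            * (r.ε k ω + r.α k ω * gradSq Q θ r (r.μ k ω) k ω))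
        + w * ((eventB Q θ r k)ᶜ.indicator (fun _ => (1 : ℝ)) ω * meritError Q θ r k ω)
        + (eventA Q θ r k)ᶜ.indicator (fun _ => (1 : ℝ)) ω
          * ((1 - w) * θ.ρ * (r.α k ω * gradSq Q θ r (r.μ k ω) k ω)) := by
  have hα := hrun.α_pos hθ k ω
  have hαm := hrun.α_le hθ k ω
  have hε := hrun.ε_pos hθ k ω
  have hρ := hθ.ρ_pos
  have hv : 0 < 1 - w := by linarith [hw.2]
  have hme : 0 ≤ meritError Q θ r k ω := add_nonneg (abs_nonneg _) (abs_nonneg _)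
  have hiA : 0 ≤ (eventA Q θ r k)ᶜ.indicator (fun _ => (1 : ℝ)) ω :=
    Set.indicator_nonneg (fun _ _ => zero_le_one) _
  have hiB : 0 ≤ (eventB Q θ r k)ᶜ.indicator (fun _ => (1 : ℝ)) ω :=
    Set.indicator_nonneg (fun _ _ => zero_le_one) _
  by_cases hA : Armijo Q θ r k ω
  · obtain ⟨hz, hα'⟩ := hrun.successful k ω hA
    have hdesc := augTrue_trial_sub_le hθ hrun k ω hA
    obtain ⟨hw1, hw2⟩ := hwc.bounds hθ hw
    set Υ := max (C.κL Q.c X C.μt * θ.αmax * C.Υ₃) (θ.κgrad * θ.αmax * C.Υ₁ + C.Υ₄)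
    have hsS : 0 ≤ sSup ((fun x => ‖fderiv ℝ (fun y => jacT Q.c y (Q.c y)) x‖) '' X) :=
      Real.sSup_nonneg (by rintro _ ⟨x, -, rfl⟩; exact norm_nonneg _)
    have hμ := (hrun.μ_pos hθ k ω).2
    have hκL : C.κL Q.c X (r.μ k ω) ≤ C.κL Q.c X C.μt := by
      unfold Constants.κL
      have := mul_le_mul_of_nonneg_right (hC.penalty_le k ω) hsS
      linarith
    have hκ0 : 0 ≤ C.κL Q.c X C.μt :=
      add_nonneg (mul_nonneg hC.μt_pos.le hsS) hC.κν_pos.le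
    -- the Lipschitz bound of the gradient along a step of length at most `αmax * Υ₃ * ‖s‖`
    have hstep : ‖gradient (augLag Q.f Q.c (r.μ k ω) θ.ν) (r.z (k + 1) ω)‖
        ≤ ‖gradient (augLag Q.f Q.c (r.μ k ω) θ.ν) (r.z k ω)‖ + Υ * ‖stepVec Q r k ω‖ := by
      have h1 := norm_gradient_augLag_sub_le hst.convex_X hst.convex_Lam (r.μ k ω) θ.ν
        hst.contDiffAt_f hst.contDiffAt_c
        (fun z h1 h2 => (hC.hessian_le _ hμ.le z h1 h2).trans hκL)
        (z := r.z k ω) (w := r.z (k + 1) ω) ⟨hst.mem_X k ω, hst.mem_Lam k ω⟩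
        ⟨hst.mem_X (k + 1) ω, hst.mem_Lam (k + 1) ω⟩
      have h2 : ‖r.z (k + 1) ω - r.z k ω‖ ≤ θ.αmax * (C.Υ₃ * ‖stepVec Q r k ω‖) := by
        rw [hz, Trajectory.trial, add_sub_cancel_left, norm_smul, Real.norm_of_nonneg hα.le]
        exact mul_le_mul hαm (hC.dir_le k ω) (norm_nonneg _) hθ.αmax_pos.le
      have h3 := mul_le_mul_of_nonneg_left h2 hκ0
      have h4 := mul_le_mul_of_nonneg_right
        (le_max_left (C.κL Q.c X C.μt * θ.αmax * C.Υ₃) (θ.κgrad * θ.αmax * C.Υ₁ + C.Υ₄))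
        (norm_nonneg (stepVec Q r k ω))
      have h5 := norm_le_norm_add_norm_sub'
        (gradient (augLag Q.f Q.c (r.μ k ω) θ.ν) (r.z (k + 1) ω))
        (gradient (augLag Q.f Q.c (r.μ k ω) θ.ν) (r.z k ω))
      change _ ≤ Υ * _ at h4
      linarith
    -- an accurate gradient estimate bounds the exact gradient by a multiple of `‖s‖`
    have hacc : ω ∈ eventA Q θ r k →
        ‖gradient (augLag Q.f Q.c (r.μ k ω) θ.ν) (r.z k ω)‖ ≤ Υ * ‖stepVec Q r k ω‖ := by
      intro hω
      have h1 : ‖errVec Q θ r k ω‖ ≤ θ.κgrad * r.α k ω * ‖refVec Q θ r k ω‖ := hω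
      have h2 : θ.κgrad * r.α k ω * ‖refVec Q θ r k ω‖
          ≤ θ.κgrad * θ.αmax * (C.Υ₁ * ‖stepVec Q r k ω‖) :=
        mul_le_mul (mul_le_mul_of_nonneg_left hαm hθ.κgrad_pos.le) (hC.refVec_le k ω)
          (norm_nonneg _) (mul_nonneg hθ.κgrad_pos.le hθ.αmax_pos.le)
      have h3 := hC.augGradBar_le k ω
      have h4 := mul_le_mul_of_nonneg_right
        (le_max_right (C.κL Q.c X C.μt * θ.αmax * C.Υ₃) (θ.κgrad * θ.αmax * C.Υ₁ + C.Υ₄))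
        (norm_nonneg (stepVec Q r k ω))
      change _ ≤ Υ * _ at h4
      rw [hst.gradient_augLag]
      have h5 : augGradTrue Q θ r k ω (r.μ k ω)
          = augGradBar Q θ r k ω (r.μ k ω) - errVec Q θ r k ω := by
        rw [augGradBar_eq_add]; abel
      have h6 := norm_sub_le (augGradBar Q θ r k ω (r.μ k ω)) (errVec Q θ r k ω)
      rw [h5]
      linarith
    have hi : 0 ≤ ‖gradient (augLag Q.f Q.c (r.μ k ω) θ.ν) (r.z k ω)‖ ∧
        ‖gradient (augLag Q.f Q.c (r.μ k ω) θ.ν) (r.z k ω)‖ ≤ Υ * ‖stepVec Q r k ω‖ ∧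
          (eventA Q θ r k)ᶜ.indicator (fun _ => (1 : ℝ)) ω = 0 ∨
        (eventA Q θ r k)ᶜ.indicator (fun _ => (1 : ℝ)) ω = 1 := by
      by_cases hω : ω ∈ eventA Q θ r k
      · exact Or.inl ⟨norm_nonneg _, hacc hω, Set.indicator_of_notMem (by simpa using hω) _⟩
      · exact Or.inr (Set.indicator_of_mem (by simpa using hω) _)
    have hε' : r.ε (k + 1) ω = θ.ρ * r.ε k ω ∧
          r.ε k ω ≤ -(r.α k ω * θ.β * slope Q θ r k ω (r.μ k ω)) ∨
        r.ε (k + 1) ω = r.ε k ω / θ.ρ := by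
      by_cases hR : Reliable Q θ r k ω
      · exact Or.inl ⟨hrun.reliable k ω hA hR, hR⟩
      · exact Or.inr (hrun.unreliable k ω hA hR)
    have key := accepted_step_bound hw.1 hw.2 hθ.ρ_gt_one hα hε hθ.β_mem.1
      (hrun.penaltyOK k ω).1 hdesc hw1 hw2 (norm_nonneg _) hstep
      (hα'.le.trans (min_le_right _ _)) hε' hi
    rw [← hz] at key
    refine le_trans (le_of_eq ?_) key
    simp only [lyapunov, gradSq, augTrue]
    ring
  · obtain ⟨hz, hα', hε'⟩ := hrun.unsuccessful k ω hA
    -- a rejected step only shrinks `α` and `ε`, which yields exactly the guaranteed decrease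
    have h1 : lyapunov Q θ r w (r.μ k ω) (k + 1) ω - lyapunov Q θ r w (r.μ k ω) k ω
        = -((1 - w) / 2 * (1 - 1 / θ.ρ)
            * (r.ε k ω + r.α k ω * gradSq Q θ r (r.μ k ω) k ω)) := by
      simp only [lyapunov, gradSq, hz, hα', hε']
      ring
    rw [h1]
    have hw0 := hw.1
    have hg : 0 ≤ gradSq Q θ r (r.μ k ω) k ω := sq_nonneg _
    have h2 : 0 ≤ w * ((eventB Q θ r k)ᶜ.indicator (fun _ => (1 : ℝ)) ω
        * meritError Q θ r k ω) := by positivity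
    have h3 : 0 ≤ (eventA Q θ r k)ᶜ.indicator (fun _ => (1 : ℝ)) ω
          * ((1 - w) * θ.ρ * (r.α k ω * gradSq Q θ r (r.μ k ω) k ω)) := by positivity
    linarith

end Run

/-! ### Measurability of the formulas -/

section Formulas

variable {α : Type*} {mα : MeasurableSpace α} {d m : ℕ}

/-- `Measurable.norm` for a σ-algebra that is not found by instance search. -/
theorem measurable_norm_apply {E : Type*} [NormedAddCommGroup E] [MeasurableSpace E]
    [OpensMeasurableSpace E] {f : α → E} (hf : Measurable f) : Measurable fun a => ‖f a‖ := hf.norm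

/-- `measurableSet_le` for a σ-algebra that is not found by instance search. -/
theorem measurableSet_setOf_le {f g : α → ℝ} (hf : Measurable f) (hg : Measurable g) :
    MeasurableSet {a | f a ≤ g a} := measurableSet_le hf hg

/-- `measurable_find` for a σ-algebra that is not found by instance search. -/
theorem measurable_nat_find {p : α → ℕ → Prop} [∀ a, DecidablePred (p a)]
    (hp : ∀ a, ∃ N, p a N) (hm : ∀ n, MeasurableSet {a | p a n}) :
    Measurable fun a => Nat.find (hp a) := measurable_find hp hm

theorem measurable_clm_apply {E F : Type*} [NormedAddCommGroup E] [NormedSpace ℝ E]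
    [SecondCountableTopology E] [MeasurableSpace E] [BorelSpace E] [NormedAddCommGroup F]
    [NormedSpace ℝ F] [MeasurableSpace F] [BorelSpace F] [SecondCountableTopology (E →L[ℝ] F)]
    {A : α → E →L[ℝ] F} {v : α → E} (hA : Measurable A) (hv : Measurable v) :
    Measurable fun a => A a (v a) :=
  (isBoundedBilinearMap_apply (𝕜 := ℝ) (E := E) (F := F)).continuous.measurable.comp
    (hA.prodMk hv)

theorem measurable_clm_comp {E F H : Type*} [NormedAddCommGroup E] [NormedSpace ℝ E]
    [NormedAddCommGroup F] [NormedSpace ℝ F] [NormedAddCommGroup H] [NormedSpace ℝ H]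
    [SecondCountableTopology (F →L[ℝ] H)] [SecondCountableTopology (E →L[ℝ] F)]
    {A : α → F →L[ℝ] H} {B : α → E →L[ℝ] F} (hA : Measurable A) (hB : Measurable B) :
    Measurable fun a => (A a).comp (B a) :=
  (isBoundedBilinearMap_comp (𝕜 := ℝ) (E := E) (F := F) (G := H)).continuous.measurable.comp
    (hA.prodMk hB)

theorem measurable_fstP {z : α → Pair d m} (hz : Measurable z) : Measurable fun a => (z a).fst :=
  (fstP d m).measurable.comp hz

theorem measurable_sndP {z : α → Pair d m} (hz : Measurable z) : Measurable fun a => (z a).snd :=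
  (sndP d m).measurable.comp hz

theorem measurable_stack {u : α → Vec d} {v : α → Vec m} (hu : Measurable u)
    (hv : Measurable v) : Measurable fun a => stack (u a) (v a) :=
  (WithLp.measurable_toLp 2 (Vec d × Vec m)).comp (hu.prodMk hv)

theorem measurable_gradient {n : ℕ} (h : Vec n → ℝ) : Measurable (gradient h) := by
  rw [gradient_eq_rieszInv]
  exact (rieszInv (Vec n)).continuous.measurable.comp (measurable_fderiv ℝ h)

theorem measurable_hess {n : ℕ} (h : Vec n → ℝ) : Measurable (hess h) := measurable_fderiv ℝ _

theorem measurable_jac (c : Vec d → Vec m) : Measurable (jac c) := measurable_fderiv ℝ c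

theorem measurable_jacT (c : Vec d → Vec m) : Measurable (jacT c) := by
  rw [jacT_eq_transposeL]
  exact (transposeL d m).continuous.measurable.comp (measurable_jac c)

variable {c : Vec d → Vec m} {g : α → Vec d} {H : α → Vec d →L[ℝ] Vec d} {x : α → Vec d}
  {lam : α → Vec m} {μ : α → ℝ}

theorem measurable_jac_apply (c : Vec d → Vec m) {u : α → Vec d} (hx : Measurable x)
    (hu : Measurable u) : Measurable fun a => jac c (x a) (u a) :=
  measurable_clm_apply ((measurable_jac c).comp hx) hu

theorem measurable_jacT_apply (c : Vec d → Vec m) {u : α → Vec m} (hx : Measurable x)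
    (hu : Measurable u) : Measurable fun a => jacT c (x a) (u a) :=
  measurable_clm_apply ((measurable_jacT c).comp hx) hu

theorem measurable_lagGrad (c : Vec d → Vec m) (hg : Measurable g) (hx : Measurable x)
    (hl : Measurable lam) : Measurable fun a => lagGrad c (g a) (x a) (lam a) :=
  hg.add (measurable_jacT_apply c hx hl)

theorem measurable_matM (c : Vec d → Vec m) (hg : Measurable g) (hH : Measurable H)
    (hx : Measurable x) (hl : Measurable lam) :
    Measurable fun a => matM c (g a) (H a) (x a) (lam a) := by
  have h2 : ∀ j, Measurable fun a => hess (fun y => c y j) (x a) := fun j =>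
    (measurable_hess _).comp hx
  have h4 : Measurable fun a => lagHess c (H a) (x a) (lam a) := by
    unfold lagHess
    refine hH.add (Finset.measurable_sum _ fun j _ => ?_)
    have h2' : Measurable fun a => lam a j :=
      (EuclideanSpace.proj j : Vec m →L[ℝ] ℝ).measurable.comp hl
    exact h2'.smul (h2 j)
  have h5 : Measurable fun a => matT c (x a) (lagGrad c (g a) (x a) (lam a)) := by
    unfold matT
    refine Finset.measurable_sum _ fun j _ => ?_
    exact (ContinuousLinearMap.smulRightL ℝ (Vec m) (Vec d)
        (EuclideanSpace.proj j)).continuous.measurable.comp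
      (measurable_clm_apply (h2 j) (measurable_lagGrad c hg hx hl))
  exact (measurable_clm_comp h4 ((measurable_jacT c).comp hx)).add h5

theorem measurable_augValue (hc : Measurable c) {v : α → ℝ} (ν : ℝ) (hμ : Measurable μ)
    (hv : Measurable v) (hg : Measurable g) (hx : Measurable x) (hl : Measurable lam) :
    Measurable fun a => augValue c (μ a) ν (v a) (g a) (x a) (lam a) := by
  have h1 := measurable_jac_apply c hx (measurable_lagGrad c hg hx hl)
  have h2 := hc.comp hx
  exact ((hv.add (h2.inner hl)).add ((hμ.div_const 2).mul (h2.norm.pow_const 2))).add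
    ((h1.norm.pow_const 2).const_mul (ν / 2))

theorem measurable_augGradFormula (hc : Measurable c) (ν : ℝ) (hμ : Measurable μ)
    (hg : Measurable g) (hH : Measurable H) (hx : Measurable x) (hl : Measurable lam) :
    Measurable fun a => augGradFormula c (μ a) ν (g a) (H a) (x a) (lam a) := by
  have h1 := measurable_lagGrad c hg hx hl
  have h2 := measurable_jac_apply c hx h1
  have h3 := measurable_clm_apply (measurable_matM c hg hH hx hl) h2
  have h4 := hc.comp hx
  exact measurable_stack
    ((h1.add (h3.const_smul ν)).add (hμ.smul (measurable_jacT_apply c hx h4)))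
    (h4.add ((measurable_jac_apply c hx (measurable_jacT_apply c hx h2)).const_smul ν))

/-- The solution of a uniquely solvable linear system depends measurably on the data. -/
theorem measurable_of_injective_apply_eq {W : Type*} [NormedAddCommGroup W] [NormedSpace ℝ W]
    [FiniteDimensional ℝ W] [MeasurableSpace W] [BorelSpace W] {K : α → W →L[ℝ] W} {u y : α → W}
    (hK : Measurable K) (hinj : ∀ a, Function.Injective (K a)) (hy : Measurable y)
    (h : ∀ a, K a (u a) = y a) : Measurable u := by
  have : CompleteSpace W := FiniteDimensional.complete ℝ W
  have : SecondCountableTopology W :=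
    have := FiniteDimensional.proper_real W; inferInstance
  have : SecondCountableTopology (W →L[ℝ] W) :=
    have := FiniteDimensional.proper_real (W →L[ℝ] W); inferInstance
  have hinv : Measurable (Ring.inverse : (W →L[ℝ] W) → (W →L[ℝ] W)) := by
    classical
    have h1 : (Ring.inverse : (W →L[ℝ] W) → (W →L[ℝ] W))
        = {A : W →L[ℝ] W | IsUnit A}.piecewise Ring.inverse 0 := by
      ext1 A
      by_cases hA : IsUnit A
      · exact (Set.piecewise_eq_of_mem {A : W →L[ℝ] W | IsUnit A} _ _ hA).symm
      · rw [Ring.inverse_non_unit _ hA]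
        exact (Set.piecewise_eq_of_notMem {A : W →L[ℝ] W | IsUnit A} _
          (0 : (W →L[ℝ] W) → (W →L[ℝ] W)) hA).symm
    rw [h1]
    refine ContinuousOn.measurable_piecewise ?_ continuousOn_const Units.isOpen.measurableSet
    rintro A ⟨A, rfl⟩
    exact (NormedRing.inverse_continuousAt A).continuousWithinAt
  have hu : ∀ a, u a = Ring.inverse (K a) (y a) := fun a => by
    have hunit : IsUnit (K a) := by
      rw [ContinuousLinearMap.isUnit_iff_bijective]
      exact ⟨hinj a, LinearMap.injective_iff_surjective.1 (hinj a)⟩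
    have h2 : (Ring.inverse (K a) * K a) (u a) = u a := by
      rw [Ring.inverse_mul_cancel _ hunit]; rfl
    rw [← h a]
    exact h2.symm
  rw [show u = fun a => Ring.inverse (K a) (y a) from funext hu]
  exact measurable_clm_apply (hinv.comp hK) hy

end Formulas

section Batches

variable {α : Type*} {mα : MeasurableSpace α} {Ξ : Type*} [MeasurableSpace Ξ]

theorem measurable_batch_iff {β : Type*} [MeasurableSpace β] {h : Batch Ξ → β} :
    Measurable h ↔ ∀ n, Measurable fun v : Fin n → Ξ => h ⟨n, v⟩ := by
  constructor
  · intro hh n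
    have : Measurable fun v : Fin n → Ξ => (⟨n, v⟩ : Batch Ξ) := fun s hs =>
      (MeasurableSpace.measurableSet_iInf.1 hs n : _)
    exact hh.comp this
  · intro hh s hs
    exact MeasurableSpace.measurableSet_iInf.2 fun n => hh n hs

/-- Averages over a measurable batch, of a function with a measurable parameter, are measurable. -/
theorem measurable_batchMean [Nonempty Ξ] {E V : Type*} [MeasurableSpace E]
    [NormedAddCommGroup V] [NormedSpace ℝ V] [MeasurableSpace V] [BorelSpace V]
    [SecondCountableTopology V] {b : α → Batch Ξ} {x : α → E} {h : E → Ξ → V}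
    (hb : Measurable b) (hx : Measurable x) (hh : Measurable fun p : E × Ξ => h p.1 p.2) :
    Measurable fun a => batchMean (b a) (h (x a)) := by
  classical
  -- the members of a batch, continued by an arbitrary value
  let e : ℕ → Batch Ξ → Ξ := fun i q =>
    if hi : i < q.1 then q.2 ⟨i, hi⟩ else Classical.arbitrary Ξ
  have he : ∀ i, Measurable (e i) := fun i => measurable_batch_iff.2 fun n => by
    by_cases hi : i < n
    · simpa [e, hi] using measurable_pi_apply (⟨i, hi⟩ : Fin n)
    · simp [e, hi]
  have hN : Measurable fun q : Batch Ξ => q.1 :=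
    measurable_batch_iff.2 fun n => measurable_const
  have hsum : ∀ q : Batch Ξ, ∀ y, batchMean q (h y)
      = (q.1 : ℝ)⁻¹ • ∑ i ∈ Finset.range q.1, h y (e i q) := fun q y => by
    rw [batchMean, Finset.sum_range]
    simp [e]
  simp only [hsum]
  have hN' : Measurable fun a => (b a).1 := hN.comp hb
  have h1 : Measurable fun p : ℕ × α => ∑ i ∈ Finset.range p.1, h (x p.2) (e i (b p.2)) :=
    measurable_from_prod_countable_right fun n =>
      Finset.measurable_sum (Finset.range n) (f := fun i a => h (x a) (e i (b a)))
        fun i _ => hh.comp (hx.prodMk ((he i).comp hb))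
  have h2 : Measurable fun a => ((b a).1 : ℝ)⁻¹ := (measurable_from_top.comp hN').inv
  exact h2.smul (h1.comp (hN'.prodMk measurable_id))

end Batches

/-! ### Measurability of the processes -/

section Processes

variable {d m : ℕ} {Ξ Ω : Type*} [MeasurableSpace Ξ] {𝓜 : MeasurableSpace Ω}
  [mΩ : MeasurableSpace Ω] {P : Measure Ω}
  {Q : Problem d m Ξ} {θ : Params} {r : Trajectory d m Ξ Ω}
  {X : Set (Vec d)} {Lam : Set (Vec m)} {κB M₀ M₁ M₂ : ℝ}

theorem Problem.nonempty (Q : Problem d m Ξ) : Nonempty Ξ :=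
  have := Q.isProb
  Q.law.nonempty_of_neZero

theorem Problem.measurable_f (Q : Problem d m Ξ) : Measurable Q.f := by
  have := Q.isProb
  exact (Q.measurable_F.stronglyMeasurable.integral_prod_right (ν := Q.law)).measurable

namespace Trajectory

theorem past_le_mid (r : Trajectory d m Ξ Ω) (k : ℕ) : r.past k ≤ r.mid k := le_sup_left

theorem mid_le_past_succ (r : Trajectory d m Ξ Ω) (k : ℕ) : r.mid k ≤ r.past (k + 1) :=
  le_sup_left

theorem mid_le (r : Trajectory d m Ξ Ω) (k : ℕ) : r.mid k ≤ mΩ :=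
  (r.mid_le_past_succ k).trans (r.past_le (k + 1))

theorem measurable_ξg_mid (r : Trajectory d m Ξ Ω) (k : ℕ) : Measurable[r.mid k] (r.ξg k) :=
  measurable_iff_comap_le.2 le_sup_right

theorem measurable_ξf_past (r : Trajectory d m Ξ Ω) (k : ℕ) :
    Measurable[r.past (k + 1)] (r.ξf k) :=
  measurable_iff_comap_le.2 le_sup_right

end Trajectory

variable {k : ℕ}

theorem measurable_x (hz : Measurable[𝓜] (r.z k)) : Measurable[𝓜] (r.x k) := measurable_fstP hz

theorem measurable_lam (hz : Measurable[𝓜] (r.z k)) : Measurable[𝓜] (r.lam k) := measurable_sndP hz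

theorem measurable_gBar (hz : Measurable[𝓜] (r.z k)) (hξ : Measurable[𝓜] (r.ξg k)) :
    Measurable[𝓜] (gBar Q r k) :=
  have := Q.nonempty
  measurable_batchMean (h := fun x ζ => gradient (fun y => Q.F y ζ) x) hξ (measurable_x hz)
    Q.measurable_gradF

theorem measurable_hBar (hz : Measurable[𝓜] (r.z k)) (hξ : Measurable[𝓜] (r.ξg k)) :
    Measurable[𝓜] (hBar Q r k) :=
  have := Q.nonempty
  measurable_batchMean (h := fun x ζ => hess (fun y => Q.F y ζ) x) hξ (measurable_x hz)
    Q.measurable_hessF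

theorem measurable_lagGradBar (hz : Measurable[𝓜] (r.z k)) (hξ : Measurable[𝓜] (r.ξg k)) :
    Measurable[𝓜] (lagGradBar Q r k) :=
  measurable_lagGrad Q.c (measurable_gBar hz hξ) (measurable_x hz) (measurable_lam hz)

theorem measurable_mBar (hz : Measurable[𝓜] (r.z k)) (hξ : Measurable[𝓜] (r.ξg k)) :
    Measurable[𝓜] (mBar Q r k) :=
  measurable_matM Q.c (measurable_gBar hz hξ) (measurable_hBar hz hξ) (measurable_x hz)
    (measurable_lam hz)

theorem measurable_augGradBar (hz : Measurable[𝓜] (r.z k)) (hξ : Measurable[𝓜] (r.ξg k))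
    {μ : Ω → ℝ} (hμ : Measurable[𝓜] μ) :
    Measurable[𝓜] fun ω => augGradBar Q θ r k ω (μ ω) :=
  measurable_augGradFormula Q.measurable_c θ.ν hμ (measurable_gBar hz hξ) (measurable_hBar hz hξ)
    (measurable_x hz) (measurable_lam hz)

theorem measurable_augGradTrue (hz : Measurable[𝓜] (r.z k)) {μ : Ω → ℝ} (hμ : Measurable[𝓜] μ) :
    Measurable[𝓜] fun ω => augGradTrue Q θ r k ω (μ ω) :=
  measurable_augGradFormula Q.measurable_c θ.ν hμ ((measurable_gradient Q.f).comp (measurable_x hz))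
    ((measurable_hess Q.f).comp (measurable_x hz)) (measurable_x hz) (measurable_lam hz)

/-- The vector of gradient errors is a difference of gradient formulas, here with penalty zero. -/
theorem measurable_errVec (hz : Measurable[𝓜] (r.z k)) (hξ : Measurable[𝓜] (r.ξg k)) :
    Measurable[𝓜] (errVec Q θ r k) := by
  have h : errVec Q θ r k
      = fun ω => augGradBar Q θ r k ω 0 - augGradTrue Q θ r k ω 0 := by
    ext1 ω
    rw [augGradBar_eq_add, add_sub_cancel_left]
  rw [h]
  exact (measurable_augGradBar hz hξ measurable_const).sub
    (measurable_augGradTrue hz measurable_const)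

theorem measurable_refVec (hz : Measurable[𝓜] (r.z k)) (hξ : Measurable[𝓜] (r.ξg k)) :
    Measurable[𝓜] (refVec Q θ r k) := by
  have hx := measurable_x hz
  have h1 := measurable_lagGradBar (Q := Q) hz hξ
  have h2 := measurable_jac_apply Q.c hx h1
  exact measurable_stack
    ((h1.add ((measurable_clm_apply (measurable_mBar hz hξ) h2).const_smul θ.ν)).add
      (measurable_jacT_apply Q.c hx (Q.measurable_c.comp hx)))
    ((measurable_jac_apply Q.c hx (measurable_jacT_apply Q.c hx h2)).const_smul θ.ν)

theorem measurable_stepVec (hz : Measurable[𝓜] (r.z k)) (hξ : Measurable[𝓜] (r.ξg k))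
    (hΔ : Measurable[𝓜] (r.Δx k)) : Measurable[𝓜] (stepVec Q r k) :=
  measurable_stack hΔ (measurable_jac_apply Q.c (measurable_x hz) (measurable_lagGradBar hz hξ))

theorem measurableSet_eventA (hz : Measurable[𝓜] (r.z k)) (hξ : Measurable[𝓜] (r.ξg k))
    (hα : Measurable[𝓜] (r.α k)) : MeasurableSet[𝓜] (eventA Q θ r k) :=
  measurableSet_setOf_le (measurable_norm_apply (measurable_errVec hz hξ))
    ((hα.const_mul θ.κgrad).mul (measurable_norm_apply (measurable_refVec hz hξ)))

/-- The solutions of the linear systems are measurable because they are unique. -/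
theorem measurable_dir {κG κM σ : ℝ}
    (hN : ∀ k ω, NewtonStep (jac Q.c (r.x k ω)) (r.B k ω) (mBar Q r k ω)
      (Q.c (r.x k ω)) (lagGradBar Q r k ω) (r.Δx k ω) (r.Δt k ω) (r.Δlam k ω) θ.γ κB κG κM σ)
    (hz : Measurable[𝓜] (r.z k)) (hξ : Measurable[𝓜] (r.ξg k)) (hB : Measurable[𝓜] (r.B k)) :
    Measurable[𝓜] (r.Δx k) ∧ Measurable[𝓜] (r.Δlam k) := by
  have hx := measurable_x hz
  have hG := (measurable_jac Q.c).comp hx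
  have hGT := (measurable_jacT Q.c).comp hx
  have hl := measurable_lagGradBar (Q := Q) hz hξ
  have hΔx : Measurable[𝓜] (r.Δx k) := by
    -- the matrix of the first system, acting on the pairs `(Δx, Δt)`
    let K : Ω → (Vec d × Vec m) →L[ℝ] (Vec d × Vec m) := fun ω =>
      (ContinuousLinearMap.inl ℝ (Vec d) (Vec m)).comp
          ((r.B k ω).comp (ContinuousLinearMap.fst ℝ (Vec d) (Vec m))
            + (jacT Q.c (r.x k ω)).comp (ContinuousLinearMap.snd ℝ (Vec d) (Vec m)))
        + (ContinuousLinearMap.inr ℝ (Vec d) (Vec m)).comp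
          ((jac Q.c (r.x k ω)).comp (ContinuousLinearMap.fst ℝ (Vec d) (Vec m)))
    have hKapply : ∀ ω p, K ω p
        = (r.B k ω p.1 + jacT Q.c (r.x k ω) p.2, jac Q.c (r.x k ω) p.1) := fun ω p => by
      simp [K]
    have hK : Measurable[𝓜] K :=
      (measurable_clm_comp measurable_const ((measurable_clm_comp hB measurable_const).add
        (measurable_clm_comp hGT measurable_const))).add
        (measurable_clm_comp measurable_const (measurable_clm_comp hG measurable_const))
    -- coercivity on the kernel of `G` gives `u = 0`, and then injectivity of the transpose `t = 0`
    have hinj : ∀ ω, Function.Injective (K ω) := fun ω => by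
      refine (injective_iff_map_eq_zero (K ω)).2 ?_
      rintro ⟨u, t⟩ hp
      rw [hKapply, Prod.mk_eq_zero] at hp
      obtain ⟨h1, h2⟩ := hp
      simp only at h1 h2
      have h3 := (hN k ω).coercive u h2
      have h4 : ⟪u, r.B k ω u⟫ = 0 := by
        rw [eq_neg_of_add_eq_zero_left h1, inner_neg_right, inner_jacT', h2, inner_zero_left,
          neg_zero]
      have h5 : u = 0 := by
        rw [h4] at h3
        have h6 : ‖u‖ ^ 2 ≤ 0 := by nlinarith [(hN k ω).γ_pos, sq_nonneg ‖u‖]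
        exact norm_eq_zero.1 (pow_eq_zero_iff two_ne_zero |>.1 (le_antisymm h6 (sq_nonneg _)))
      have h7 : t = 0 := by
        have h8 := (hN k ω).lower t
        rw [h5, map_zero, zero_add] at h1
        have h9 : ‖ContinuousLinearMap.adjoint (jac Q.c (r.x k ω)) t‖ = 0 := by
          rw [show ContinuousLinearMap.adjoint (jac Q.c (r.x k ω)) t = 0 from h1, norm_zero]
        rw [h9] at h8
        exact norm_eq_zero.1 (le_antisymm
          (by nlinarith [(hN k ω).σ_pos, norm_nonneg t]) (norm_nonneg t))
      rw [h5, h7]; rfl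
    have hy : Measurable[𝓜] fun ω => (-lagGradBar Q r k ω, -Q.c (r.x k ω)) :=
      hl.neg.prodMk (Q.measurable_c.comp hx).neg
    have hu : Measurable[𝓜] fun ω => (r.Δx k ω, r.Δt k ω) :=
      measurable_of_injective_apply_eq hK hinj hy fun ω => by
        rw [hKapply]
        exact Prod.ext (hN k ω).eq_x (hN k ω).eq_c
    exact measurable_fst.comp hu
  refine ⟨hΔx, ?_⟩
  have hK : Measurable[𝓜] fun ω => (jac Q.c (r.x k ω)).comp (jacT Q.c (r.x k ω)) :=
    measurable_clm_comp hG hGT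
  have hMT : Measurable[𝓜] fun ω => ContinuousLinearMap.adjoint (mBar Q r k ω) :=
    (transposeL m d).continuous.measurable.comp (measurable_mBar hz hξ)
  refine measurable_of_injective_apply_eq hK (fun ω => ?_)
    ((measurable_jac_apply Q.c hx hl).add (measurable_clm_apply hMT hΔx)).neg
    (fun ω => (hN k ω).eq_l)
  refine (injective_iff_map_eq_zero _).2 fun y hy => ?_
  have h1 := norm_le_of_lower (hN k ω).σ_pos (hN k ω).lower y
  rw [show jac Q.c (r.x k ω) (ContinuousLinearMap.adjoint (jac Q.c (r.x k ω)) y) = 0 from hy,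
    norm_zero] at h1
  have h2 : 0 < σ ^ 2 := by have := (hN k ω).σ_pos; positivity
  exact norm_eq_zero.1 (le_antisymm (by nlinarith [norm_nonneg y]) (norm_nonneg y))

/-- The penalty parameter is measurable, being the first accepted value of a measurable test. -/
theorem measurable_μ (hrun : IsRun Q θ P r) (hz : Measurable[𝓜] (r.z k))
    (hξ : Measurable[𝓜] (r.ξg k)) (hΔx : Measurable[𝓜] (r.Δx k))
    (hΔl : Measurable[𝓜] (r.Δlam k)) (hμ : Measurable[𝓜] (r.μStart θ k)) :
    Measurable[𝓜] (r.μ k) := by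
  classical
  let p : Ω → ℕ → Prop := fun ω n => PenaltyOK Q θ r k ω (θ.ρ ^ n * r.μStart θ k ω)
  have hp : ∀ ω, ∃ n, p ω n := fun ω => by
    obtain ⟨j, hj, hOK, -⟩ := hrun.penalty k ω
    exact ⟨j, by rw [hj] at hOK; exact hOK⟩
  have hset : ∀ n, MeasurableSet[𝓜] {ω | p ω n} := fun n => by
    have h1 := measurable_augGradBar (Q := Q) (θ := θ) hz hξ (hμ.const_mul (θ.ρ ^ n))
    have h2 : Measurable[𝓜] fun ω => slope Q θ r k ω (θ.ρ ^ n * r.μStart θ k ω) :=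
      h1.inner (measurable_stack hΔx hΔl)
    exact (measurableSet_setOf_le h2
      (((measurable_norm_apply (measurable_stepVec hz hξ hΔx)).pow_const 2).const_mul _)).inter
      (measurableSet_setOf_le (measurable_norm_apply (Q.measurable_c.comp (measurable_x hz)))
        (measurable_norm_apply h1))
  have hfind : Measurable[𝓜] fun ω => Nat.find (hp ω) := measurable_nat_find hp hset
  have heq : r.μ k = fun ω => θ.ρ ^ Nat.find (hp ω) * r.μStart θ k ω := by
    ext1 ω
    obtain ⟨j, hj, hOK, hn⟩ := hrun.penalty k ω
    have : Nat.find (hp ω) = j := by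
      rw [Nat.find_eq_iff]
      exact ⟨by rw [hj] at hOK; exact hOK, hn⟩
    rw [this, hj]
  rw [heq]
  have hpow : Measurable[𝓜] fun ω => θ.ρ ^ Nat.find (hp ω) :=
    (measurable_from_top (f := fun n : ℕ => θ.ρ ^ n)).comp hfind
  exact hpow.mul hμ

theorem measurable_augBar (hμ : Measurable[𝓜] (r.μ k)) (hξ : Measurable[𝓜] (r.ξf k))
    {z : Ω → Pair d m} (hz : Measurable[𝓜] z) :
    Measurable[𝓜] fun ω => augBar Q θ r k ω (z ω) :=
  have := Q.nonempty
  measurable_augValue Q.measurable_c θ.ν hμ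
    (measurable_batchMean (h := fun x ζ => Q.F x ζ) hξ (measurable_fstP hz) Q.measurable_F)
    (measurable_batchMean (h := fun x ζ => gradient (fun y => Q.F y ζ) x) hξ (measurable_fstP hz)
      Q.measurable_gradF) (measurable_fstP hz) (measurable_sndP hz)

theorem measurable_augLag {α : Type*} {mα : MeasurableSpace α} (Q : Problem d m Ξ) (θ : Params)
    {μ : α → ℝ} (hμ : Measurable μ) {z : α → Pair d m} (hz : Measurable z) :
    Measurable fun a => augLag Q.f Q.c (μ a) θ.ν (z a) :=
  measurable_augValue Q.measurable_c θ.ν hμ (Q.measurable_f.comp (measurable_fstP hz))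
    ((measurable_gradient Q.f).comp (measurable_fstP hz)) (measurable_fstP hz) (measurable_sndP hz)

/-- The state at the start of an iteration is determined by the past. -/
structure StateMeasurable (θ : Params) (r : Trajectory d m Ξ Ω) (k : ℕ) : Prop where
  z : Measurable[r.past k] (r.z k)
  α : Measurable[r.past k] (r.α k)
  ε : Measurable[r.past k] (r.ε k)
  μStart : Measurable[r.past k] (r.μStart θ k)

/-- The direction and the penalty parameter are determined by the past and the first batch. -/
structure StepMeasurable (r : Trajectory d m Ξ Ω) (k : ℕ) : Prop where
  Δx : Measurable[r.mid k] (r.Δx k)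
  Δlam : Measurable[r.mid k] (r.Δlam k)
  μ : Measurable[r.mid k] (r.μ k)

theorem StateMeasurable.step (hθ : θ.Valid) (hrun : IsRun Q θ P r)
    (hst : Standing Q θ r X Lam κB M₀ M₁ M₂) (h : StateMeasurable θ r k) :
    StepMeasurable r k := by
  obtain ⟨κG, κM, σ, hN⟩ := exists_newtonStep hθ hrun hst
  have hpm := r.past_le_mid k
  have hz := h.z.mono hpm le_rfl
  obtain ⟨h1, h2⟩ := measurable_dir hN hz (r.measurable_ξg_mid k)
    ((hrun.measurable_B k).mono hpm le_rfl)
  exact ⟨h1, h2, measurable_μ hrun hz (r.measurable_ξg_mid k) h1 h2 (h.μStart.mono hpm le_rfl)⟩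

theorem measurable_trial (hz : Measurable[𝓜] (r.z k)) (hα : Measurable[𝓜] (r.α k))
    (hΔx : Measurable[𝓜] (r.Δx k)) (hΔl : Measurable[𝓜] (r.Δlam k)) :
    Measurable[𝓜] (r.trial k) :=
  hz.add (hα.smul (measurable_stack hΔx hΔl))

theorem measurable_slope_μ (hz : Measurable[𝓜] (r.z k)) (hξ : Measurable[𝓜] (r.ξg k))
    (hΔx : Measurable[𝓜] (r.Δx k)) (hΔl : Measurable[𝓜] (r.Δlam k))
    (hμ : Measurable[𝓜] (r.μ k)) : Measurable[𝓜] fun ω => slope Q θ r k ω (r.μ k ω) :=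
  (measurable_augGradBar hz hξ hμ).inner (measurable_stack hΔx hΔl)

/-- The next state is a case distinction over the acceptance and the reliability of the step, both
of which are decided by the two batches of the iteration. -/
theorem StateMeasurable.succ (hθ : θ.Valid) (hrun : IsRun Q θ P r)
    (hst : Standing Q θ r X Lam κB M₀ M₁ M₂) (h : StateMeasurable θ r k) :
    StateMeasurable θ r (k + 1) := by
  classical
  have hs := h.step hθ hrun hst
  have hms := r.mid_le_past_succ k
  have hps := (r.past_le_mid k).trans hms
  have hz := h.z.mono hps le_rfl
  have hα := h.α.mono hps le_rfl
  have hε := h.ε.mono hps le_rfl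
  have hΔx := hs.Δx.mono hms le_rfl
  have hΔl := hs.Δlam.mono hms le_rfl
  have hμ := hs.μ.mono hms le_rfl
  have ht := measurable_trial hz hα hΔx hΔl
  have hsl := measurable_slope_μ (Q := Q) (θ := θ) hz ((r.measurable_ξg_mid k).mono hms le_rfl)
    hΔx hΔl hμ
  have hξ := r.measurable_ξf_past k
  have hred := (hα.mul_const θ.β).mul hsl
  have hA : MeasurableSet[r.past (k + 1)] {ω | Armijo Q θ r k ω} :=
    measurableSet_setOf_le (measurable_augBar hμ hξ ht) ((measurable_augBar hμ hξ hz).add hred)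
  have hR : MeasurableSet[r.past (k + 1)] {ω | Reliable Q θ r k ω} :=
    measurableSet_setOf_le hε hred.neg
  refine ⟨?_, ?_, ?_, hμ⟩
  · have e : r.z (k + 1) = fun ω => if Armijo Q θ r k ω then r.trial k ω else r.z k ω := by
      ext1 ω
      split_ifs with hω
      · exact (hrun.successful k ω hω).1
      · exact (hrun.unsuccessful k ω hω).1
    rw [e]
    exact Measurable.ite hA ht hz
  · have e : r.α (k + 1) = fun ω => if Armijo Q θ r k ω then min θ.αmax (θ.ρ * r.α k ω)
        else r.α k ω / θ.ρ := by
      ext1 ω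
      split_ifs with hω
      · exact (hrun.successful k ω hω).2
      · exact (hrun.unsuccessful k ω hω).2.1
    rw [e]
    exact Measurable.ite hA (measurable_const.min (hα.const_mul _)) (hα.div_const _)
  · have e : r.ε (k + 1) = fun ω => if Armijo Q θ r k ω then
        (if Reliable Q θ r k ω then θ.ρ * r.ε k ω else r.ε k ω / θ.ρ) else r.ε k ω / θ.ρ := by
      ext1 ω
      split_ifs with hω hω'
      · exact hrun.reliable k ω hω hω'
      · exact hrun.unreliable k ω hω hω'
      · exact (hrun.unsuccessful k ω hω).2.2
    rw [e]
    exact Measurable.ite hA (Measurable.ite hR (hε.const_mul _) (hε.div_const _))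
      (hε.div_const _)

theorem stateMeasurable (hθ : θ.Valid) (hrun : IsRun Q θ P r)
    (hst : Standing Q θ r X Lam κB M₀ M₁ M₂) (k : ℕ) : StateMeasurable θ r k := by
  induction k with
  | zero =>
    refine ⟨measurable_iff_comap_le.2 le_rfl, ?_, ?_, measurable_const⟩
    · rw [show r.α 0 = fun _ => θ.αmax from funext hrun.α_zero]; exact measurable_const
    · rw [show r.ε 0 = fun _ => θ.ε₀ from funext hrun.ε_zero]; exact measurable_const
  | succ k ih => exact ih.succ hθ hrun hst

end Processes

/-! ### Conditional expectations -/

section CondExp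

variable {Ω : Type*} {𝓜 : MeasurableSpace Ω} [mΩ : MeasurableSpace Ω] {P : Measure Ω}

theorem integrable_mul_of_bounded {f g : Ω → ℝ} (hf : Measurable f) {b : ℝ} (hb : ∀ ω, |f ω| ≤ b)
    (hg : Integrable g P) : Integrable (fun ω => f ω * g ω) P :=
  hg.bdd_mul hf.aestronglyMeasurable (Filter.Eventually.of_forall hb)

theorem condExp_mul_left {f g : Ω → ℝ} (hm : 𝓜 ≤ mΩ) (hf : Measurable[𝓜] f) {b : ℝ}
    (hb : ∀ ω, |f ω| ≤ b) (hg : Integrable g P) :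
    P[fun ω => f ω * g ω | 𝓜] =ᵐ[P] fun ω => f ω * (P[g | 𝓜]) ω :=
  condExp_mul_of_stronglyMeasurable_left hf.stronglyMeasurable
    (integrable_mul_of_bounded (hf.mono hm le_rfl) hb hg) hg

variable [IsProbabilityMeasure P]

/-- A conditional Cauchy-Schwarz estimate: an event of small conditional probability contributes
little to the conditional mean of a variable with bounded conditional mean square. -/
theorem condExp_indicator_mul_abs_le (hm : 𝓜 ≤ mΩ) {S : Set Ω} (hS : MeasurableSet S) {Y ε : Ω → ℝ}
    (hY : Measurable Y) (hY2 : Integrable (fun ω => Y ω ^ 2) P) (hε : Measurable[𝓜] ε) {a b p : ℝ}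
    (ha : 0 < a) (hεab : ∀ ω, a ≤ ε ω ∧ ε ω ≤ b) (hp : 0 < p)
    (hSp : ∀ᵐ ω ∂P, (P[S.indicator (fun _ => (1 : ℝ)) | 𝓜]) ω ≤ p)
    (hYε : ∀ᵐ ω ∂P, (P[fun ω => Y ω ^ 2 | 𝓜]) ω ≤ ε ω ^ 2) :
    Integrable (fun ω => S.indicator (fun _ => (1 : ℝ)) ω * |Y ω|) P ∧
      ∀ᵐ ω ∂P, (P[fun ω => S.indicator (fun _ => (1 : ℝ)) ω * |Y ω| | 𝓜]) ω
        ≤ Real.sqrt p * ε ω := by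
  have hsp : 0 < Real.sqrt p := Real.sqrt_pos.2 hp
  have hε0 : ∀ ω, 0 < ε ω := fun ω => ha.trans_le (hεab ω).1
  have hind : Measurable (S.indicator fun _ => (1 : ℝ)) := measurable_const.indicator hS
  have hI : Integrable (S.indicator fun _ => (1 : ℝ)) P :=
    (integrable_const 1).indicator hS
  -- weights known to `𝓜`, for the inequality between the arithmetic and the geometric mean
  have hf₁ : Measurable[𝓜] fun ω => Real.sqrt p / 2 * (ε ω)⁻¹ := hε.inv.const_mul _
  have hf₂ : Measurable[𝓜] fun ω => (2 * Real.sqrt p)⁻¹ * ε ω := hε.const_mul _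
  have hb₁ : ∀ ω, |Real.sqrt p / 2 * (ε ω)⁻¹| ≤ Real.sqrt p / 2 * a⁻¹ := fun ω => by
    have := hε0 ω
    rw [abs_of_nonneg (by positivity)]
    gcongr
    exact (hεab ω).1
  have hb₂ : ∀ ω, |(2 * Real.sqrt p)⁻¹ * ε ω| ≤ (2 * Real.sqrt p)⁻¹ * b := fun ω => by
    have := hε0 ω
    rw [abs_of_nonneg (by positivity)]
    gcongr
    exact (hεab ω).2
  -- with these weights the inequality is a perfect square, and both terms contribute `√p ε / 2`
  have hle : ∀ ω, S.indicator (fun _ => (1 : ℝ)) ω * |Y ω|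
      ≤ Real.sqrt p / 2 * (ε ω)⁻¹ * Y ω ^ 2
        + (2 * Real.sqrt p)⁻¹ * ε ω * S.indicator (fun _ => (1 : ℝ)) ω := fun ω => by
    have h0 := hε0 ω
    by_cases hω : ω ∈ S
    · rw [Set.indicator_of_mem hω, one_mul, mul_one, ← sq_abs (Y ω)]
      have e : Real.sqrt p / 2 * (ε ω)⁻¹ * |Y ω| ^ 2 + (2 * Real.sqrt p)⁻¹ * ε ω - |Y ω|
          = (Real.sqrt p * |Y ω| - ε ω) ^ 2 / (2 * Real.sqrt p * ε ω) := by
        field_simp; ring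
      have : 0 ≤ (Real.sqrt p * |Y ω| - ε ω) ^ 2 / (2 * Real.sqrt p * ε ω) := by positivity
      linarith
    · rw [Set.indicator_of_notMem hω, zero_mul, mul_zero, add_zero]
      positivity
  have hi₁ := integrable_mul_of_bounded (hf₁.mono hm le_rfl) hb₁ hY2
  have hi₂ := integrable_mul_of_bounded (hf₂.mono hm le_rfl) hb₂ hI
  have hint : Integrable (fun ω => S.indicator (fun _ => (1 : ℝ)) ω * |Y ω|) P := by
    refine (hi₁.add hi₂).mono' (hind.mul hY.abs).aestronglyMeasurable
      (Filter.Eventually.of_forall fun ω => ?_)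
    rw [Real.norm_of_nonneg (mul_nonneg (Set.indicator_nonneg (fun _ _ => zero_le_one) _)
      (abs_nonneg _))]
    exact hle ω
  refine ⟨hint, ?_⟩
  have hmono := condExp_mono (m := 𝓜) hint (hi₁.add hi₂) (Filter.Eventually.of_forall hle)
  filter_upwards [hmono, condExp_add hi₁ hi₂ 𝓜, condExp_mul_left hm hf₁ hb₁ hY2,
    condExp_mul_left hm hf₂ hb₂ hI, hSp, hYε] with ω h1 h2 h3 h4 h5 h6
  have h0 := hε0 ω
  rw [Pi.add_apply, h3, h4] at h2
  refine (h1.trans_eq h2).trans ?_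
  have h7 : Real.sqrt p / 2 * (ε ω)⁻¹ * (P[fun ω => Y ω ^ 2 | 𝓜]) ω
      ≤ Real.sqrt p / 2 * (ε ω)⁻¹ * ε ω ^ 2 := by gcongr
  have h8 : (2 * Real.sqrt p)⁻¹ * ε ω * (P[S.indicator (fun _ => (1 : ℝ)) | 𝓜]) ω
      ≤ (2 * Real.sqrt p)⁻¹ * ε ω * p := by gcongr
  have e1 : Real.sqrt p / 2 * (ε ω)⁻¹ * ε ω ^ 2 = Real.sqrt p * ε ω / 2 := by field_simp
  have e2 : (2 * Real.sqrt p)⁻¹ * ε ω * p = Real.sqrt p * ε ω / 2 := by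
    nth_rewrite 2 [← Real.mul_self_sqrt hp.le]
    field_simp
  linarith

/-- A bound on a conditional expectation passes to a coarser σ-algebra. -/
theorem condExp_le_of_condExp_le {𝓜' : MeasurableSpace Ω} (h12 : 𝓜 ≤ 𝓜') (h2 : 𝓜' ≤ mΩ)
    {f g : Ω → ℝ} (hg : Measurable[𝓜] g) {b : ℝ} (hb : ∀ ω, |g ω| ≤ b)
    (h : ∀ᵐ ω ∂P, (P[f | 𝓜']) ω ≤ g ω) : ∀ᵐ ω ∂P, (P[f | 𝓜]) ω ≤ g ω := by
  have hgi : Integrable g P := Integrable.of_bound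
    (hg.mono (h12.trans h2) le_rfl).aestronglyMeasurable b (Filter.Eventually.of_forall hb)
  have h1 := condExp_mono (m := 𝓜) integrable_condExp hgi h
  have h3 : P[g | 𝓜] = g := condExp_of_stronglyMeasurable (h12.trans h2) hg.stronglyMeasurable hgi
  filter_upwards [h1, condExp_condExp_of_le (μ := P) (f := f) h12 h2] with ω h4 h5
  rw [h5, h3] at h4
  exact h4

end CondExp

/-! ### Bounds and integrability of the Lyapunov function -/

section Lyapunov

variable {d m : ℕ}

theorem augLag_eq_add (f : Vec d → ℝ) (c : Vec d → Vec m) (μ ν : ℝ) (z : Pair d m) :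
    augLag f c μ ν z = augLag f c 0 ν z + μ / 2 * ‖c z.fst‖ ^ 2 := by
  simp only [augLag, augValue]
  ring

/-- The augmented Lagrangian and its gradient are bounded on the region of the iterates, uniformly
for bounded penalty parameters. -/
theorem exists_augLag_bound {X : Set (Vec d)} {Lam : Set (Vec m)} {f : Vec d → ℝ}
    {c : Vec d → Vec m} (hX : IsCompact X) (hL : IsCompact Lam) (ν : ℝ)
    (hf : ∀ x ∈ X, ContDiffAt ℝ 3 f x) (hc : ∀ x ∈ X, ContDiffAt ℝ 3 c x) (T : ℝ) :
    ∃ K, ∀ μ, |μ| ≤ T → ∀ z ∈ region X Lam,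
      |augLag f c μ ν z| ≤ K ∧ ‖gradient (augLag f c μ ν) z‖ ≤ K := by
  have hR := isCompact_region hX hL
  obtain ⟨K₁, -, h₁⟩ := exists_pos_bound hR (g := augLag f c 0 ν) fun z hz =>
    (contDiffAt_augLag (p := 2) (q := 3) 0 ν (hf _ hz.1) (hc _ hz.1)
      (by norm_num)).continuousAt.continuousWithinAt
  obtain ⟨K₂, -, h₂⟩ := exists_pos_bound hR (g := gradient (augLag f c 0 ν)) fun z hz =>
    (contDiffAt_gradient_augLag 0 ν (hf _ hz.1) (hc _ hz.1)).continuousAt.continuousWithinAt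
  obtain ⟨K₃, hK₃, h₃⟩ := exists_pos_bound hX (g := c) fun x hx =>
    (hc x hx).continuousAt.continuousWithinAt
  obtain ⟨K₄, hK₄, h₄⟩ := exists_pos_bound hX (g := fun x => jacT c x (c x)) fun x hx =>
    (contDiffAt_jacT_apply (hc x hx)).continuousAt.continuousWithinAt
  refine ⟨max (K₁ + T / 2 * K₃ ^ 2) (K₂ + T * K₄), fun μ hμ z hz => ?_⟩
  have hT : 0 ≤ T := (abs_nonneg μ).trans hμ
  constructor
  · refine le_max_of_le_left ?_
    rw [augLag_eq_add]
    refine (abs_add_le _ _).trans (add_le_add (h₁ z hz) ?_)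
    rw [abs_mul, abs_div, abs_two, abs_of_nonneg (sq_nonneg ‖c z.fst‖)]
    gcongr
    exact h₃ _ hz.1
  · refine le_max_of_le_right ?_
    rw [gradient_augLag μ ν (hf _ hz.1) (hc _ hz.1), augGradFormula_eq_add,
      ← gradient_augLag 0 ν (hf _ hz.1) (hc _ hz.1)]
    refine (norm_add_le _ _).trans (add_le_add (h₂ z hz) ?_)
    rw [norm_smul, norm_inlP, Real.norm_eq_abs]
    gcongr
    exact h₄ _ hz.1

variable {Ξ Ω : Type*} [MeasurableSpace Ξ] {𝓜 : MeasurableSpace Ω} [mΩ : MeasurableSpace Ω]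
  {P : Measure Ω} {Q : Problem d m Ξ} {θ : Params} {r : Trajectory d m Ξ Ω}
  {X : Set (Vec d)} {Lam : Set (Vec m)} {κB M₀ M₁ M₂ : ℝ} {k : ℕ}

theorem measurable_stoppedValue_μ (hμ : ∀ k, Measurable (r.μ k)) {Kbar : Ω → WithTop ℕ}
    (hK : IsStoppingTime r.filtration Kbar) : Measurable (stoppedValue r.μ Kbar) := by
  have h1 : Measurable fun ω => (Kbar ω).untopA := hK.measurable'.untopA
  have h2 : Measurable fun p : ℕ × Ω => r.μ p.1 p.2 :=
    measurable_from_prod_countable_right hμ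
  exact h2.comp (h1.prodMk measurable_id)

theorem measurable_gradSq (hst : Standing Q θ r X Lam κB M₀ M₁ M₂) (hz : Measurable[𝓜] (r.z k))
    {μ : Ω → ℝ} (hμ : Measurable[𝓜] μ) : Measurable[𝓜] fun ω => gradSq Q θ r (μ ω) k ω := by
  simp only [gradSq, hst.gradient_augLag]
  exact (measurable_norm_apply (measurable_augGradTrue hz hμ)).pow_const 2

theorem integrable_lyapunov [IsProbabilityMeasure P] (hθ : θ.Valid) (hrun : IsRun Q θ P r)
    (hst : Standing Q θ r X Lam κB M₀ M₁ M₂) (w : ℝ) {μ : Ω → ℝ} (hμ : Measurable μ) {T : ℝ}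
    (hT : ∀ ω, |μ ω| ≤ T) (k : ℕ) :
    Integrable (fun ω => lyapunov Q θ r w (μ ω) k ω) P := by
  have hs := stateMeasurable hθ hrun hst k
  have hpl := r.past_le k
  have hz := hs.z.mono hpl le_rfl
  obtain ⟨K, hK⟩ := exists_augLag_bound hst.compact_X hst.compact_Lam θ.ν hst.contDiffAt_f
    hst.contDiffAt_c T
  have hmem : ∀ ω, r.z k ω ∈ region X Lam := fun ω => ⟨hst.mem_X k ω, hst.mem_Lam k ω⟩
  obtain ⟨a, ha, b, hab⟩ := hrun.ε_mem hθ k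
  have i1 : Integrable (fun ω => augLag Q.f Q.c (μ ω) θ.ν (r.z k ω)) P :=
    Integrable.of_bound (measurable_augLag Q θ hμ hz).aestronglyMeasurable K
      (Filter.Eventually.of_forall fun ω => (hK _ (hT ω) _ (hmem ω)).1)
  have i2 : Integrable (r.ε k) P :=
    Integrable.of_bound (hs.ε.mono hpl le_rfl).aestronglyMeasurable b
      (Filter.Eventually.of_forall fun ω => by
        rw [Real.norm_of_nonneg (hrun.ε_pos hθ k ω).le]; exact (hab ω).2)
  have i3 : Integrable (fun ω => gradSq Q θ r (μ ω) k ω) P :=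
    Integrable.of_bound (measurable_gradSq hst hz hμ).aestronglyMeasurable (K ^ 2)
      (Filter.Eventually.of_forall fun ω => by
        rw [gradSq, Real.norm_of_nonneg (sq_nonneg _)]
        exact pow_le_pow_left₀ (norm_nonneg _) (hK _ (hT ω) _ (hmem ω)).2 2)
  have i4 : Integrable (fun ω => r.α k ω * gradSq Q θ r (μ ω) k ω) P :=
    integrable_mul_of_bounded (hs.α.mono hpl le_rfl)
      (fun ω => by rw [abs_of_pos (hrun.α_pos hθ k ω)]; exact hrun.α_le hθ k ω) i3
  exact ((i1.const_mul w).add (i2.const_mul _)).add (i4.const_mul _)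

theorem measurable_eventB_meritError (hrun : IsRun Q θ P r) (hθ : θ.Valid)
    (hst : Standing Q θ r X Lam κB M₀ M₁ M₂) (k : ℕ) :
    MeasurableSet (eventB Q θ r k) ∧
      (Measurable fun ω => augBar Q θ r k ω (r.z k ω) - augTrue Q θ r k ω (r.z k ω)) ∧
      Measurable fun ω => augBar Q θ r k ω (r.trial k ω) - augTrue Q θ r k ω (r.trial k ω) := by
  have hs := stateMeasurable hθ hrun hst k
  have ht := hs.step hθ hrun hst
  have hpl := r.past_le k
  have hml := r.mid_le k
  have hz := hs.z.mono hpl le_rfl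
  have hα := hs.α.mono hpl le_rfl
  have hΔx := ht.Δx.mono hml le_rfl
  have hΔl := ht.Δlam.mono hml le_rfl
  have hμ := ht.μ.mono hml le_rfl
  have htr := measurable_trial hz hα hΔx hΔl
  have e1 : Measurable fun ω => augBar Q θ r k ω (r.z k ω) - augTrue Q θ r k ω (r.z k ω) :=
    (measurable_augBar hμ (r.measurable_ξf k) hz).sub (measurable_augLag Q θ hμ hz)
  have e2 : Measurable fun ω =>
      augBar Q θ r k ω (r.trial k ω) - augTrue Q θ r k ω (r.trial k ω) :=
    (measurable_augBar hμ (r.measurable_ξf k) htr).sub (measurable_augLag Q θ hμ htr)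
  exact ⟨measurableSet_le (e1.abs.max e2.abs) (((hα.pow_const 2).const_mul _).mul
    (measurable_slope_μ hz (r.measurable_ξg k) hΔx hΔl hμ)), e1, e2⟩

/-- The error of the merit function on the event of poor estimates, in conditional mean. -/
theorem condExp_meritError_le [IsProbabilityMeasure P] (hθ : θ.Valid) (hrun : IsRun Q θ P r)
    (hst : Standing Q θ r X Lam κB M₀ M₁ M₂) (k : ℕ) :
    Integrable (fun ω => (eventB Q θ r k)ᶜ.indicator (fun _ => (1 : ℝ)) ω
        * meritError Q θ r k ω) P ∧
      ∀ᵐ ω ∂P, (P[fun ω => (eventB Q θ r k)ᶜ.indicator (fun _ => (1 : ℝ)) ω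
        * meritError Q θ r k ω | r.past k]) ω ≤ 2 * Real.sqrt θ.pf * r.ε k ω := by
  have hs := stateMeasurable hθ hrun hst k
  obtain ⟨hB, e1, e2⟩ := measurable_eventB_meritError hrun hθ hst k
  obtain ⟨a, ha, b, hab⟩ := hrun.ε_mem hθ k
  have hε := hs.ε.mono (r.past_le_mid k) le_rfl
  obtain ⟨i1, b1⟩ := condExp_indicator_mul_abs_le (r.mid_le k) hB.compl e1
    (hrun.meanSq_iterate k).1 hε ha hab hθ.pf_mem.1 (hrun.accurate_f k) (hrun.meanSq_iterate k).2
  obtain ⟨i2, b2⟩ := condExp_indicator_mul_abs_le (r.mid_le k) hB.compl e2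
    (hrun.meanSq_trial k).1 hε ha hab hθ.pf_mem.1 (hrun.accurate_f k) (hrun.meanSq_trial k).2
  have heq : (fun ω => (eventB Q θ r k)ᶜ.indicator (fun _ => (1 : ℝ)) ω
        * meritError Q θ r k ω)
      = (fun ω => (eventB Q θ r k)ᶜ.indicator (fun _ => (1 : ℝ)) ω
          * |augBar Q θ r k ω (r.z k ω) - augTrue Q θ r k ω (r.z k ω)|)
        + fun ω => (eventB Q θ r k)ᶜ.indicator (fun _ => (1 : ℝ)) ω
          * |augBar Q θ r k ω (r.trial k ω) - augTrue Q θ r k ω (r.trial k ω)| := by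
    ext1 ω
    rw [meritError, mul_add]; rfl
  rw [heq]
  refine ⟨i1.add i2, condExp_le_of_condExp_le (r.past_le_mid k) (r.mid_le k)
    (b := 2 * Real.sqrt θ.pf * b) (hs.ε.const_mul _) (fun ω => ?_) ?_⟩
  · have := (hrun.ε_pos hθ k ω).le
    rw [abs_of_nonneg (by positivity)]
    gcongr
    exact (hab ω).2
  · filter_upwards [b1, b2, condExp_add i1 i2 (r.mid k)] with ω h1 h2 h3
    rw [h3, Pi.add_apply]
    linarith

/-- The contributions of the two failure events use up at most half of the guaranteed decrease. -/
theorem ProbCond.bound {w ε G : ℝ} (hθ : θ.Valid) (hw : w ∈ Set.Ioo (0 : ℝ) 1)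
    (h : ProbCond θ w) (hε : 0 ≤ ε) (hG : 0 ≤ G) :
    -((1 - w) / 2 * (1 - 1 / θ.ρ) * (ε + G)) + w * (2 * Real.sqrt θ.pf * ε)
        + θ.pgrad * ((1 - w) * θ.ρ * G)
      ≤ -(1 / 4) * (1 - θ.pgrad) * (1 - θ.pf) * (1 - w) * (1 - 1 / θ.ρ) * (ε + G) := by
  have hρ := hθ.ρ_pos
  have hρ1 := hθ.ρ_gt_one
  obtain ⟨hg0, hg1⟩ := hθ.pgrad_mem
  obtain ⟨hf0, hf1⟩ := hθ.pf_mem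
  obtain ⟨hw0, hw1⟩ := hw
  have hs := Real.sqrt_nonneg θ.pf
  have ha : 0 < (1 - θ.pgrad) * (1 - θ.pf) := mul_pos (by linarith) (by linarith)
  have ha1 : (1 - θ.pgrad) * (1 - θ.pf) ≤ 1 := by nlinarith
  set A := (1 - θ.pgrad) * (1 - θ.pf) with hA
  have hv : 0 < 1 - w := by linarith
  have hq : 0 < (θ.ρ - 1) / (8 * θ.ρ) := div_pos (by linarith) (by positivity)
  rw [ProbCond, div_le_iff₀ ha] at h
  -- the two terms of the minimum control `pgrad` and `√pf`, respectively
  have h1 : θ.pgrad ≤ (θ.ρ - 1) / (8 * θ.ρ) * (1 / θ.ρ) * A := by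
    have := mul_le_mul_of_nonneg_right (mul_le_mul_of_nonneg_left
      (min_le_left (1 / θ.ρ) ((1 - w) / w)) hq.le) ha.le
    linarith
  have h2 : Real.sqrt θ.pf ≤ (θ.ρ - 1) / (8 * θ.ρ) * ((1 - w) / w) * A := by
    have := mul_le_mul_of_nonneg_right (mul_le_mul_of_nonneg_left
      (min_le_right (1 / θ.ρ) ((1 - w) / w)) hq.le) ha.le
    linarith
  have h3 : θ.pgrad * ((1 - w) * θ.ρ * G)
      ≤ (θ.ρ - 1) / (8 * θ.ρ) * (1 / θ.ρ) * A * ((1 - w) * θ.ρ * G) := by gcongr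
  have h4 : w * (2 * Real.sqrt θ.pf * ε)
      ≤ w * (2 * ((θ.ρ - 1) / (8 * θ.ρ) * ((1 - w) / w) * A) * ε) := by gcongr
  have e3 : (θ.ρ - 1) / (8 * θ.ρ) * (1 / θ.ρ) * A * ((1 - w) * θ.ρ * G)
      = A * ((1 - w) * (1 - 1 / θ.ρ) * G) / 8 := by field_simp
  have e4 : w * (2 * ((θ.ρ - 1) / (8 * θ.ρ) * ((1 - w) / w) * A) * ε)
      = A * ((1 - w) * (1 - 1 / θ.ρ) * ε) / 4 := by field_simp; ring
  have hi : 0 ≤ 1 - 1 / θ.ρ := by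
    have : 1 / θ.ρ ≤ 1 := by rw [div_le_one hρ]; exact hρ1.le
    linarith
  have hu : 0 ≤ (1 - w) * (1 - 1 / θ.ρ) * ε := by positivity
  have hv' : 0 ≤ (1 - w) * (1 - 1 / θ.ρ) * G := by positivity
  have h5 := mul_le_mul_of_nonneg_right ha1 hu
  have h6 := mul_le_mul_of_nonneg_right ha1 hv'
  have e5 : -(1 / 4) * (1 - θ.pgrad) * (1 - θ.pf) * (1 - w) * (1 - 1 / θ.ρ) * (ε + G)
      = -(A * ((1 - w) * (1 - 1 / θ.ρ) * ε) / 4) - A * ((1 - w) * (1 - 1 / θ.ρ) * G) / 4 := by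
    rw [hA]; ring
  rw [e5]
  rw [e3] at h3
  rw [e4] at h4
  have hAv : 0 ≤ A * ((1 - w) * (1 - 1 / θ.ρ) * G) := by positivity
  linarith

end Lyapunov

/-! ### The one-step error recursion -/

section Recursion

variable {d m : ℕ} {Ξ Ω : Type*} [MeasurableSpace Ξ] [mΩ : MeasurableSpace Ω]
  {P : Measure Ω} [IsProbabilityMeasure P] {Q : Problem d m Ξ} {θ : Params}
  {r : Trajectory d m Ξ Ω} {X : Set (Vec d)} {Lam : Set (Vec m)} {κB M₀ M₁ M₂ : ℝ}

/-- The conditional mean of the pathwise bound of `lyapunov_succ_sub_le`, with any bounded penalty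
parameter known at the start of the iteration. -/
theorem condExp_pathwise_bound_le (hθ : θ.Valid) (hrun : IsRun Q θ P r)
    (hst : Standing Q θ r X Lam κB M₀ M₁ M₂) {w : ℝ} (hw : w ∈ Set.Ioo (0 : ℝ) 1)
    (hp : ProbCond θ w) (k : ℕ) {μ : Ω → ℝ} (hμ : Measurable[r.past k] μ) {T : ℝ}
    (hT : ∀ ω, |μ ω| ≤ T) {U : Ω → ℝ}
    (hU : ∀ ω, U ω = -((1 - w) / 2 * (1 - 1 / θ.ρ)
            * (r.ε k ω + r.α k ω * gradSq Q θ r (μ ω) k ω))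
        + w * ((eventB Q θ r k)ᶜ.indicator (fun _ => (1 : ℝ)) ω * meritError Q θ r k ω)
        + (eventA Q θ r k)ᶜ.indicator (fun _ => (1 : ℝ)) ω
          * ((1 - w) * θ.ρ * (r.α k ω * gradSq Q θ r (μ ω) k ω))) :
    Integrable U P ∧ ∀ᵐ ω ∂P, (P[U | r.past k]) ω ≤
      -(1 / 4) * (1 - θ.pgrad) * (1 - θ.pf) * (1 - w) * (1 - 1 / θ.ρ)
          * (r.ε k ω + r.α k ω * gradSq Q θ r (μ ω) k ω) := by
  have hs := stateMeasurable hθ hrun hst k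
  have hpl := r.past_le k
  have hρ := hθ.ρ_pos
  have hv : 0 < 1 - w := by linarith [hw.2]
  obtain ⟨K, hK⟩ := exists_augLag_bound hst.compact_X hst.compact_Lam θ.ν hst.contDiffAt_f
    hst.contDiffAt_c T
  obtain ⟨a, ha, b, hab⟩ := hrun.ε_mem hθ k
  have hgm : Measurable[r.past k] fun ω => r.α k ω * gradSq Q θ r (μ ω) k ω :=
    hs.α.mul (measurable_gradSq hst hs.z hμ)
  have hg0 : ∀ ω, 0 ≤ r.α k ω * gradSq Q θ r (μ ω) k ω := fun ω =>
    mul_nonneg (hrun.α_pos hθ k ω).le (sq_nonneg _)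
  have hgb : ∀ ω, r.α k ω * gradSq Q θ r (μ ω) k ω ≤ θ.αmax * K ^ 2 := fun ω =>
    mul_le_mul (hrun.α_le hθ k ω) (pow_le_pow_left₀ (norm_nonneg _)
      (hK _ (hT ω) _ ⟨hst.mem_X k ω, hst.mem_Lam k ω⟩).2 2) (sq_nonneg _) hθ.αmax_pos.le
  obtain ⟨iB, cB⟩ := condExp_meritError_le hθ hrun hst k
  have hA : MeasurableSet (eventA Q θ r k) :=
    measurableSet_eventA (hs.z.mono hpl le_rfl) (r.measurable_ξg k) (hs.α.mono hpl le_rfl)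
  have iA : Integrable ((eventA Q θ r k)ᶜ.indicator fun _ => (1 : ℝ)) P :=
    (integrable_const 1).indicator hA.compl
  have hhm : Measurable[r.past k] fun ω => (1 - w) * θ.ρ * (r.α k ω * gradSq Q θ r (μ ω) k ω) :=
    hgm.const_mul _
  have hhb : ∀ ω, |(1 - w) * θ.ρ * (r.α k ω * gradSq Q θ r (μ ω) k ω)|
      ≤ (1 - w) * θ.ρ * (θ.αmax * K ^ 2) := fun ω => by
    have := hg0 ω
    rw [abs_of_nonneg (by positivity)]
    exact mul_le_mul_of_nonneg_left (hgb ω) (by positivity)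
  let U₁ : Ω → ℝ := fun ω => -((1 - w) / 2 * (1 - 1 / θ.ρ)
            * (r.ε k ω + r.α k ω * gradSq Q θ r (μ ω) k ω))
  let U₂ : Ω → ℝ := fun ω =>
    w * ((eventB Q θ r k)ᶜ.indicator (fun _ => (1 : ℝ)) ω * meritError Q θ r k ω)
  let U₃ : Ω → ℝ := fun ω => (1 - w) * θ.ρ * (r.α k ω * gradSq Q θ r (μ ω) k ω)
    * (eventA Q θ r k)ᶜ.indicator (fun _ => (1 : ℝ)) ω
  have m₁ : Measurable[r.past k] U₁ := ((hs.ε.add hgm).const_mul _).neg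
  have iε : Integrable (r.ε k) P :=
    Integrable.of_bound (hs.ε.mono hpl le_rfl).aestronglyMeasurable b
      (Filter.Eventually.of_forall fun ω => by
        rw [Real.norm_of_nonneg (hrun.ε_pos hθ k ω).le]; exact (hab ω).2)
  have ig : Integrable (fun ω => r.α k ω * gradSq Q θ r (μ ω) k ω) P :=
    Integrable.of_bound (hgm.mono hpl le_rfl).aestronglyMeasurable (θ.αmax * K ^ 2)
      (Filter.Eventually.of_forall fun ω => by
        rw [Real.norm_of_nonneg (hg0 ω)]; exact hgb ω)
  have i₁ : Integrable U₁ P := ((iε.add ig).const_mul _).neg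
  have i₂ : Integrable U₂ P := iB.const_mul w
  have i₃ : Integrable U₃ P := integrable_mul_of_bounded (hhm.mono hpl le_rfl) hhb iA
  have hUeq : U = U₁ + U₂ + U₃ := by
    ext1 ω
    rw [hU ω, Pi.add_apply, Pi.add_apply]
    simp only [U₁, U₂, U₃]
    ring
  rw [hUeq]
  refine ⟨(i₁.add i₂).add i₃, ?_⟩
  have c₁ : P[U₁ | r.past k] = U₁ := condExp_of_stronglyMeasurable hpl m₁.stronglyMeasurable i₁
  filter_upwards [condExp_add (i₁.add i₂) i₃ (r.past k), condExp_add i₁ i₂ (r.past k),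
    condExp_smul (μ := P) w (fun ω => (eventB Q θ r k)ᶜ.indicator (fun _ => (1 : ℝ)) ω
      * meritError Q θ r k ω) (r.past k), condExp_mul_left hpl hhm hhb iA, cB,
    hrun.accurate_g k] with ω h1 h2 h3 h4 h5 h6
  have h3' : (P[U₂ | r.past k]) ω ≤ w * (2 * Real.sqrt θ.pf * r.ε k ω) := by
    refine h3.le.trans ?_
    rw [Pi.smul_apply, smul_eq_mul]
    exact mul_le_mul_of_nonneg_left h5 hw.1.le
  have h4' : (P[U₃ | r.past k]) ω
      ≤ θ.pgrad * ((1 - w) * θ.ρ * (r.α k ω * gradSq Q θ r (μ ω) k ω)) := by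
    refine h4.le.trans ?_
    rw [mul_comm]
    refine mul_le_mul_of_nonneg_right h6 ?_
    have := hg0 ω
    positivity
  rw [Pi.add_apply, h2, Pi.add_apply, c₁] at h1
  rw [h1]
  have h7 := hp.bound hθ hw (hrun.ε_pos hθ k ω).le (hg0 ω)
  have h8 : U₁ ω = -((1 - w) / 2 * (1 - 1 / θ.ρ)
            * (r.ε k ω + r.α k ω * gradSq Q θ r (μ ω) k ω)) := rfl
  linarith

end Recursion

end StoSQP

end

theorem mainTheorem3 {d m : ℕ} {Ξ Ω : Type*} [MeasurableSpace Ξ] [MeasurableSpace Ω]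
    (P : Measure Ω) [IsProbabilityMeasure P]
    (Q : StoSQP.Problem d m Ξ) (θ : StoSQP.Params) (hθ : θ.Valid)
    (r : StoSQP.Trajectory d m Ξ Ω) (hrun : StoSQP.IsRun Q θ P r)
    (X : Set (StoSQP.Vec d)) (Lam : Set (StoSQP.Vec m)) (κB M₀ M₁ M₂ : ℝ)
    (hst : StoSQP.Standing Q θ r X Lam κB M₀ M₁ M₂)
    (Kbar : Ω → WithTop ℕ) (hK : IsStoppingTime r.filtration Kbar)
    (hstab : ∀ᵐ ω ∂P, ∀ k : ℕ, Kbar ω ≤ k → r.μ k ω = stoppedValue r.μ Kbar ω) :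
    (∃ C : StoSQP.Constants, C.Valid Q θ r X Lam) ∧
    ∀ C : StoSQP.Constants, C.Valid Q θ r X Lam →
    ∀ w ∈ Set.Ioo (0 : ℝ) 1, StoSQP.WeightCond C Q.c θ X w → StoSQP.ProbCond θ w →
    ∀ k : ℕ,
      Integrable (fun ω => StoSQP.lyapunov Q θ r w (stoppedValue r.μ Kbar ω) (k + 1) ω
        - StoSQP.lyapunov Q θ r w (stoppedValue r.μ Kbar ω) k ω) P ∧
      ∀ᵐ ω ∂P, Kbar ω < k →
        (P[fun ω => StoSQP.lyapunov Q θ r w (stoppedValue r.μ Kbar ω) (k + 1) ω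
          - StoSQP.lyapunov Q θ r w (stoppedValue r.μ Kbar ω) k ω | r.past k]) ω ≤
        -(1 / 4) * (1 - θ.pgrad) * (1 - θ.pf) * (1 - w) * (1 - 1 / θ.ρ)
          * (r.ε k ω + r.α k ω * StoSQP.gradSq Q θ r (stoppedValue r.μ Kbar ω) k ω) := by
  refine ⟨StoSQP.exists_constants hθ hrun hst, fun C hC w hw hwc hp k => ?_⟩
  have hμm : ∀ k, Measurable (r.μ k) := fun k =>
    ((StoSQP.stateMeasurable hθ hrun hst k).step hθ hrun hst).μ.mono (r.mid_le k) le_rfl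
  have hsm := StoSQP.measurable_stoppedValue_μ hμm hK
  have hsb : ∀ ω, |stoppedValue r.μ Kbar ω| ≤ C.μt := fun ω => by
    rw [stoppedValue, abs_of_pos (hrun.μ_pos hθ _ ω).2]
    exact hC.penalty_le _ ω
  have hint : Integrable (fun ω => StoSQP.lyapunov Q θ r w (stoppedValue r.μ Kbar ω) (k + 1) ω
        - StoSQP.lyapunov Q θ r w (stoppedValue r.μ Kbar ω) k ω) P :=
    (StoSQP.integrable_lyapunov hθ hrun hst w hsm hsb (k + 1)).sub
      (StoSQP.integrable_lyapunov hθ hrun hst w hsm hsb k)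
  refine ⟨hint, ?_⟩
  -- nothing happens before time zero
  cases k with
  | zero => exact Filter.Eventually.of_forall fun ω h => absurd h (by simp)
  | succ n =>
    -- the filtration at time `n` contains the batches of iteration `n`: it is the past of `n + 1`
    have hE : MeasurableSet[r.past (n + 1)] {ω | Kbar ω ≤ n} := hK n
    have hlt : ∀ ω, Kbar ω < ((n + 1 : ℕ) : WithTop ℕ) → Kbar ω ≤ n := fun ω h => by
      cases hω : Kbar ω with
      | top => simp [hω] at h
      | coe a =>
        rw [hω] at h
        exact WithTop.coe_le_coe.2 (Nat.lt_succ_iff.1 (WithTop.coe_lt_coe.1 h))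
    have hs := StoSQP.stateMeasurable hθ hrun hst (n + 1)
    -- the penalty parameter of the previous iteration is known, and is the stabilized one
    have hμ : Measurable[r.past (n + 1)] (r.μ n) := hs.μStart
    have hμb : ∀ ω, |r.μ n ω| ≤ C.μt := fun ω => by
      rw [abs_of_pos (hrun.μ_pos hθ n ω).2]
      exact hC.penalty_le n ω
    obtain ⟨U, hU⟩ : ∃ U : Ω → ℝ, ∀ ω, U ω = -((1 - w) / 2 * (1 - 1 / θ.ρ)
            * (r.ε (n + 1) ω + r.α (n + 1) ω * StoSQP.gradSq Q θ r (r.μ n ω) (n + 1) ω))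
        + w * ((StoSQP.eventB Q θ r (n + 1))ᶜ.indicator (fun _ => (1 : ℝ)) ω
          * StoSQP.meritError Q θ r (n + 1) ω)
        + (StoSQP.eventA Q θ r (n + 1))ᶜ.indicator (fun _ => (1 : ℝ)) ω
          * ((1 - w) * θ.ρ
            * (r.α (n + 1) ω * StoSQP.gradSq Q θ r (r.μ n ω) (n + 1) ω)) :=
      ⟨_, fun _ => rfl⟩
    obtain ⟨iU, cU⟩ := StoSQP.condExp_pathwise_bound_le hθ hrun hst hw hp (n + 1) hμ hμb hU
    -- localized to the event of stabilization, the pathwise bound holds for the stopped value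
    have hle : {ω | Kbar ω ≤ n}.indicator
          (fun ω => StoSQP.lyapunov Q θ r w (stoppedValue r.μ Kbar ω) (n + 1 + 1) ω
            - StoSQP.lyapunov Q θ r w (stoppedValue r.μ Kbar ω) (n + 1) ω)
        ≤ᵐ[P] {ω | Kbar ω ≤ n}.indicator U := by
      filter_upwards [hstab] with ω hω
      by_cases hin : ω ∈ {ω | Kbar ω ≤ n}
      · rw [Set.indicator_of_mem hin, Set.indicator_of_mem hin]
        have h1 := hω n hin
        have h2 := hω (n + 1) (le_trans hin (by exact_mod_cast Nat.le_succ n))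
        have h3 := StoSQP.lyapunov_succ_sub_le hθ hrun hst hC hw hwc (n + 1) ω
        rw [h2] at h3
        rw [hU ω, h1]
        exact h3
      · rw [Set.indicator_of_notMem hin, Set.indicator_of_notMem hin]
    have hpl := r.past_le (n + 1)
    have hmono := condExp_mono (m := r.past (n + 1)) (hint.indicator (hpl _ hE))
      (iU.indicator (hpl _ hE)) hle
    filter_upwards [hmono, condExp_indicator hint hE, condExp_indicator iU hE, cU, hstab]
      with ω h1 h2 h3 h4 hω hk
    have hin : ω ∈ {ω | Kbar ω ≤ n} := hlt ω hk
    rw [h2, h3, Set.indicator_of_mem hin, Set.indicator_of_mem hin] at h1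
    rw [← hω n hin]
    exact h1.trans h4
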